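/- **Setting.** Let $H$ be a separable complex Hilbert space with a bounded operator $\gamma$ such that $\gamma^2=-I$, $\gamma^*=-\gamma$, and such that $\mathcal E_i=\ker(\gamma-i)$ and $\mathcal E_{-i}=\ker(\gamma+i)$ have the same Hilbert space dimension (a *Hermitian symplectic Hilbert space*; $H$ may be finite-dimensional). Let $\mathrm{Gr}(H)$ be the set of orthogonal projections $P$ with $\gamma P\gamma^*=I-P$. With respect to $H=\mathcal E_i\oplus\mathcal E_{-i}$ each $P\in\mathrm{Gr}(H)$ has the form $P=\frac12\begin{pmatrix} I&\Phi(P)^*\\ \Phi(P)&I\end{pmatrix}$ with $\Phi(P):\mathcal E_i\to\mathcal E_{-i}$ unitary. A pair $(P,Q)$ in $\mathrm{Gr}(H)$ is *Fredholm* (*invertible*) if $P:\operatorname{im}Q\to\operatorname{im}P$ is a Fredholm operator (an isomorphism); $\mathrm{Gr}^{(2)}_{\mathrm{Fred}}$ and $\mathrm{Gr}^{(2)}_*$ denote the sets of such pairs, with the operator norm topology. **Winding number.** For a Hilbert space $K$ let $\mathcal U_{\mathrm{Fred}}(K)$ (resp. $\mathcal U_*(K)$) be the set of unitaries $U$ with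 $-1\notin\operatorname{spec}_{\mathrm{ess}}U$ (resp. $-1\notin\operatorname{spec}U$). The winding number of a closed path in $\mathcal U_{\mathrm{Fred}}(K)$ is $\frac1{2\pi i}\int_0^1\operatorname{tr}(g^{-1}g')\,dt$ for any closed path $g$ of unitaries with $g-I$ trace class, $C^1$ in trace norm, that is homotopic to it through closed paths in $\mathcal U_{\mathrm{Fred}}(K)$. For a path $u$ with endpoints in $\mathcal U_*(K)$, $\operatorname{wind}(u)$ is the winding number of the closed path obtained by composing $u$ with a path in $\mathcal U_*(K)$ from $u(1)$ to $u(0)$. For an arbitrary path, $\operatorname{wind}(u):=\operatorname{wind}(e^{-i\varepsilon}u)$, where $\varepsilon>0$ is so small that $e^{i\varphi}u(t)\in\mathcal U_{\mathrm{Fred}}(K)$ for $|\varphi|\le\varepsilon$, $t\in[0,1]$, and $e^{i\varphi}u(0),e^{i\varphi}u(1)\in\mathcal U_*(K)$ for $0<|\varphi|\le\varepsilon$. **Maslov index.** A Maslov index is a map $\mathrm{Mas}$ from the continuous paths $[0,1]\to\mathrm{Gr}^{(2)}_{\mathrm{Fred}}$ to $\mathbb Z$ such that: 1. On paths with endpoints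 in $\mathrm{Gr}^{(2)}_*$ it induces a group isomorphism $\pi_1(\mathrm{Gr}^{(2)}_{\mathrm{Fred}},\mathrm{Gr}^{(2)}_*)\to\mathbb Z$, i.e. two such paths have the same index if and only if they are homotopic through paths in $\mathrm{Gr}^{(2)}_{\mathrm{Fred}}$ with endpoints in $\mathrm{Gr}^{(2)}_*$, the index of a composition of two such paths is the sum of their indices, and every integer occurs (the last is required only if $H\ne0$). 2. For $(P,Q)\in\mathrm{Gr}^{(2)}_{\mathrm{Fred}}$ and $\varepsilon>0$ such that $(e^{s\gamma}Pe^{-s\gamma},Q)$ is invertible for $0<|s|\le\varepsilon$, one has $\mathrm{Mas}(e^{s\gamma}Pe^{-s\gamma},Q)_{-\varepsilon\le s\le\varepsilon}=\dim(\ker P\cap\operatorname{im}Q)$. 3. For an arbitrary path $(f,g)$, $\mathrm{Mas}(f,g)=\mathrm{Mas}(e^{\varepsilon\gamma}fe^{-\varepsilon\gamma},g)$ whenever $\varepsilon>0$ is so small that $(e^{s\gamma}f(t)e^{-s\gamma},g(t))$ is Fredholm for all $0\le s\le\varepsilon$, $t\in[0,1]$, and invertible for $0<s\le\varepsilon$,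 $t\in\{0,1\}$. **Theorem.** There is exactly one Maslov index $\mathrm{Mas}$. For every continuous path $(f,g):[0,1]\to\mathrm{Gr}^{(2)}_{\mathrm{Fred}}$, the winding number of the path $\Phi(f)\Phi(g)^*$ in $\mathcal U_{\mathrm{Fred}}(\mathcal E_{-i})$ is well defined, i.e. it exists and is independent of all choices, and $$\mathrm{Mas}(f,g)=-\operatorname{wind}\bigl(\Phi(f)\Phi(g)^*\bigr).$$ -/

import Mathlib

open scoped unitInterval ENNReal Topology

noncomputable section

namespace Maslov

/-! ### Unitary operators, Fredholm operators, trace class operators -/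

section Winding

variable {K : Type*} [NormedAddCommGroup K] [InnerProductSpace ℂ K] [CompleteSpace K]

/-- The essential spectrum: all `z` for which `T - z` is not a Fredholm operator. -/
def essSpectrum (T : K →L[ℂ] K) : Set ℂ :=
  {z | ¬ (T - z • (1 : K →L[ℂ] K)).IsFredholm}

variable (K) in
/-- Unitary operators with `-1` outside the essential spectrum (norm topology). -/
def UFred : Set (K →L[ℂ] K) :=
  {U | U ∈ unitary (K →L[ℂ] K) ∧ (-1 : ℂ) ∉ essSpectrum U}

variable (K) in
/-- Unitary operators with `-1` outside the spectrum. -/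
def UStar : Set (K →L[ℂ] K) :=
  {U | U ∈ unitary (K →L[ℂ] K) ∧ (-1 : ℂ) ∉ spectrum ℂ U}

/-- The trace norm of a bounded operator (`∞` when it is not of trace class), as the nuclear norm:
the infimum of `∑ ‖xₙ‖ ‖yₙ‖` over all representations `T = ∑ ⟨yₙ, ·⟩ xₙ`. -/
def traceNorm (T : K →L[ℂ] K) : ℝ≥0∞ :=
  ⨅ (x : ℕ → K) (y : ℕ → K) (_ : ∀ v, HasSum (fun n => inner ℂ (y n) v • x n) (T v)),
    ∑' n, ‖x n‖ₑ * ‖y n‖ₑ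

/-- Trace class operators. -/
def IsTraceClass (T : K →L[ℂ] K) : Prop := traceNorm T < ∞

/-- The trace `∑ ⟨eᵢ, T eᵢ⟩` of a trace class operator, with respect to an orthonormal (Hilbert)
basis of `K`. -/
def trace (T : K →L[ℂ] K) : ℂ :=
  ∑' i, inner ℂ ((exists_hilbertBasis ℂ K).choose_spec.choose i)
    (T ((exists_hilbertBasis ℂ K).choose_spec.choose i))

/-- `g : [0,1] → B(K)` is a closed path of unitaries differing from the identity by trace class
operators, and it is `C¹` for the trace norm with derivative `g'`. -/
structure IsC1TraceLoop (g g' : ℝ → K →L[ℂ] K) : Prop where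
  unitary : ∀ t ∈ Set.Icc (0 : ℝ) 1, g t ∈ unitary (K →L[ℂ] K)
  traceClass : ∀ t ∈ Set.Icc (0 : ℝ) 1, IsTraceClass (g t - 1)
  closed : g 0 = g 1
  hasDeriv : ∀ t ∈ Set.Icc (0 : ℝ) 1,
    Filter.Tendsto (fun s : ℝ => traceNorm (((s - t)⁻¹ : ℂ) • (g s - g t) - g' t))
      (𝓝[Set.Icc 0 1 \ {t}] t) (𝓝 0)
  contDeriv : ∀ t ∈ Set.Icc (0 : ℝ) 1,
    Filter.Tendsto (fun s : ℝ => traceNorm (g' s - g' t)) (𝓝[Set.Icc 0 1] t) (𝓝 0)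

/-! ### The winding number -/

/-- The winding number of a closed path `u` in `UFred K`: `u` is homotopic through closed paths in
`UFred K` to a `C¹` loop `g` in `1 + (trace class)`, and the number is
`(2πi)⁻¹ ∫₀¹ tr (g⁻¹ g')`; note that `star (g t)` is the inverse of the unitary `g t`. -/
def HasLoopWinding {a : UFred K} (u : Path a a) (n : ℤ) : Prop :=
  ∃ (b : UFred K) (v : Path b b) (g g' : ℝ → K →L[ℂ] K),
    IsC1TraceLoop g g' ∧ (∀ t : I, (v t : K →L[ℂ] K) = g t) ∧
    ContinuousMap.HomotopicWith u.toContinuousMap v.toContinuousMap (fun f => f 0 = f 1) ∧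
    (n : ℂ) = (2 * Real.pi * Complex.I)⁻¹ * ∫ t in (0 : ℝ)..1, trace (star (g t) * g' t)

/-- The winding number of a path `u` in `UFred K` with endpoints in `UStar K`: close `u` up by a
path in `UStar K`. -/
def HasRelWinding {a b : UFred K} (u : Path a b) (n : ℤ) : Prop :=
  ∃ v : Path b a, (∀ t, (v t : K →L[ℂ] K) ∈ UStar K) ∧ HasLoopWinding (u.trans v) n

/-- The winding number of an arbitrary path `u` in `UFred K`: that of `e^{-iε} u`, where `ε > 0` is
so small that the rotated paths stay in `UFred K` and have endpoints in `UStar K` for all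
nonzero angles in `[-ε, ε]`. -/
def HasWinding {a b : UFred K} (u : Path a b) (n : ℤ) : Prop :=
  ∃ ε : ℝ, 0 < ε ∧
    (∀ φ ∈ Set.Icc (-ε) ε, ∀ t : I,
      Complex.exp (φ * Complex.I) • (u t : K →L[ℂ] K) ∈ UFred K) ∧
    (∀ φ ∈ Set.Icc (-ε) ε, φ ≠ 0 →
      Complex.exp (φ * Complex.I) • (a : K →L[ℂ] K) ∈ UStar K ∧
      Complex.exp (φ * Complex.I) • (b : K →L[ℂ] K) ∈ UStar K) ∧
    ∃ (a' b' : UFred K) (u' : Path a' b'),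
      (∀ t : I, (u' t : K →L[ℂ] K) =
        Complex.exp (-(ε : ℂ) * Complex.I) • (u t : K →L[ℂ] K)) ∧
      HasRelWinding u' n

/-- The winding number of a path in `UFred K`. -/
def wind {a b : UFred K} (u : Path a b) : ℤ := Classical.epsilon (HasWinding u)

end Winding

/-! ### Hermitian symplectic Hilbert spaces and Lagrangian projections -/

section Symplectic

variable {H : Type*} [NormedAddCommGroup H] [InnerProductSpace ℂ H]

/-- The eigenspace `E_i = ker (γ - i)`. -/
abbrev Eplus (γ : H →L[ℂ] H) : Submodule ℂ H := (γ - Complex.I • (1 : H →L[ℂ] H)).ker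

/-- The eigenspace `E_{-i} = ker (γ + i)`. -/
abbrev Eminus (γ : H →L[ℂ] H) : Submodule ℂ H := (γ + Complex.I • (1 : H →L[ℂ] H)).ker

theorem mem_Eplus {γ : H →L[ℂ] H} {x : H} : x ∈ Eplus γ ↔ γ x = Complex.I • x := by
  simp [Eplus, LinearMap.mem_ker, sub_eq_zero]

theorem mem_Eminus {γ : H →L[ℂ] H} {x : H} : x ∈ Eminus γ ↔ γ x = -(Complex.I • x) := by
  simp [Eminus, LinearMap.mem_ker, add_eq_zero_iff_eq_neg]

variable [CompleteSpace H]

/-- `γ` makes the Hilbert space `H` Hermitian symplectic: `γ² = -1`, `γ* = -γ`, and the two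
eigenspaces have the same Hilbert space dimension, that is, they are isometrically isomorphic. -/
structure IsHermitianSymplectic (γ : H →L[ℂ] H) : Prop where
  sq : γ * γ = -1
  adj : star γ = -γ
  dim_eq : Nonempty (Eplus γ ≃ₗᵢ[ℂ] Eminus γ)

/-- Orthogonal projections `P` with `γ P γ* = 1 - P`, i.e. with Lagrangian image. -/
def Gr (γ : H →L[ℂ] H) : Set (H →L[ℂ] H) :=
  {P | IsStarProjection P ∧ γ * P * star γ = 1 - P}

/-- The restriction of `P` to a map `im Q → im P`. -/
def pairMap (P Q : H →L[ℂ] H) : Q.range →L[ℂ] P.range :=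
  (P ∘L Q.range.subtypeL).codRestrict P.range (fun x => ⟨x, rfl⟩)

/-- Fredholm pairs of Lagrangian projections: `P : im Q → im P` is Fredholm. The topology is the
norm topology of `B(H) × B(H)`. -/
def GrFred (γ : H →L[ℂ] H) : Set ((H →L[ℂ] H) × (H →L[ℂ] H)) :=
  {p | p.1 ∈ Gr γ ∧ p.2 ∈ Gr γ ∧ (pairMap p.1 p.2).IsFredholm}

/-- Invertible pairs of Lagrangian projections: `P : im Q → im P` is an isomorphism. -/
def GrStar (γ : H →L[ℂ] H) : Set ((H →L[ℂ] H) × (H →L[ℂ] H)) :=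
  {p | p.1 ∈ Gr γ ∧ p.2 ∈ Gr γ ∧ Function.Bijective (pairMap p.1 p.2)}

/-- The map `Φ(P) : E_i → E_{-i}`, twice the corresponding block of `P` with respect to
`H = E_i ⊕ E_{-i}`, so that `P = ½ [[1, Φ(P)*], [Φ(P), 1]]` for Lagrangian projections `P`. -/
def Phi (γ P : H →L[ℂ] H) : Eplus γ →L[ℂ] Eminus γ :=
  (2 : ℂ) • ((Eminus γ).orthogonalProjectionOnto ∘L P ∘L (Eplus γ).subtypeL)

/-- The operator `Φ(P) Φ(Q)*` on `E_{-i}`. -/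
def PhiPair (γ : H →L[ℂ] H) (p : (H →L[ℂ] H) × (H →L[ℂ] H)) : Eminus γ →L[ℂ] Eminus γ :=
  Phi γ p.1 ∘L ContinuousLinearMap.adjoint (Phi γ p.2)

/-! ### The path `Φ(f) Φ(g)*` lies in `UFred` -/

section Helper

variable {γ P Q : H →L[ℂ] H}

theorem gr_map_gamma (hγ : IsHermitianSymplectic γ) (hP : P ∈ Gr γ) (x : H) :
    γ (P x) = γ x - P (γ x) := by
  have h1 : γ * P = γ - P * γ := by
    have h2 : γ * P * star γ * γ = γ * P := by
      rw [mul_assoc, hγ.adj, neg_mul, hγ.sq]; simp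
    rw [← h2, hP.2, sub_mul, one_mul]
  simpa using congrArg (fun T : H →L[ℂ] H => T x) h1

theorem gr_idem (hP : P ∈ Gr γ) (x : H) : P (P x) = P x := by
  simpa using congrArg (fun T : H →L[ℂ] H => T x) hP.1.isIdempotentElem.eq

/-- The reflection `2P - 1` maps `E_i` to `E_{-i}`. -/
theorem gr_reflect_plus (hγ : IsHermitianSymplectic γ) (hP : P ∈ Gr γ) {x : H}
    (hx : x ∈ Eplus γ) : (2 : ℂ) • P x - x ∈ Eminus γ := by
  rw [mem_Eplus] at hx
  rw [mem_Eminus, map_sub, map_smul, gr_map_gamma hγ hP, hx, map_smul]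
  module

/-- The reflection `2P - 1` maps `E_{-i}` to `E_i`. -/
theorem gr_reflect_minus (hγ : IsHermitianSymplectic γ) (hP : P ∈ Gr γ) {x : H}
    (hx : x ∈ Eminus γ) : (2 : ℂ) • P x - x ∈ Eplus γ := by
  rw [mem_Eminus] at hx
  rw [mem_Eplus, map_sub, map_smul, gr_map_gamma hγ hP, hx, map_neg, map_smul]
  module

theorem inner_plus_minus (hγ : IsHermitianSymplectic γ) {x y : H} (hx : x ∈ Eplus γ)
    (hy : y ∈ Eminus γ) : inner ℂ y x = 0 := by
  rw [mem_Eplus] at hx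
  rw [mem_Eminus] at hy
  have h : inner ℂ (γ y) x = inner ℂ y (star γ x) := by
    rw [ContinuousLinearMap.star_eq_adjoint, ContinuousLinearMap.adjoint_inner_right]
  rw [hγ.adj, neg_apply, hx, hy, inner_neg_left, inner_neg_right,
    inner_smul_left, inner_smul_right] at h
  have h2 : (2 * Complex.I) * inner ℂ y x = 0 := by
    simp only [Complex.conj_I] at h
    linear_combination h
  simpa using h2

theorem proj_minus (hγ : IsHermitianSymplectic γ) {x y : H} (hx : x ∈ Eplus γ)
    (hy : y ∈ Eminus γ) : (Eminus γ).orthogonalProjectionOnto (x + y) = ⟨y, hy⟩ := by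
  have hx' : x ∈ (Eminus γ)ᗮ := fun z hz => inner_plus_minus hγ hx hz
  rw [map_add, Submodule.orthogonalProjectionOnto_apply_of_mem_orthogonal hx', zero_add]
  exact Submodule.orthogonalProjectionOnto_mem_subspace_eq_self (⟨y, hy⟩ : Eminus γ)

theorem Phi_apply (hγ : IsHermitianSymplectic γ) (hP : P ∈ Gr γ) (x : Eplus γ) :
    (Phi γ P x : H) = (2 : ℂ) • P x - x := by
  have h := proj_minus hγ x.2 (gr_reflect_plus hγ hP x.2)
  rw [add_sub_cancel, map_smul] at h
  simpa [Phi] using congrArg Subtype.val h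

theorem Phi_adjoint_apply (hγ : IsHermitianSymplectic γ) (hP : P ∈ Gr γ) (y : Eminus γ) :
    (ContinuousLinearMap.adjoint (Phi γ P) y : H) = (2 : ℂ) • P y - y := by
  have key : ContinuousLinearMap.adjoint (Phi γ P) y
      = ⟨(2 : ℂ) • P y - y, gr_reflect_minus hγ hP y.2⟩ := by
    refine ext_inner_right ℂ fun x => ?_
    rw [ContinuousLinearMap.adjoint_inner_left, Submodule.coe_inner, Submodule.coe_inner,
      Phi_apply hγ hP]
    have hs : inner ℂ (P (y : H)) (x : H) = inner ℂ (y : H) (P x) := by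
      conv_lhs => rw [← hP.1.isSelfAdjoint.star_eq, ContinuousLinearMap.star_eq_adjoint]
      rw [ContinuousLinearMap.adjoint_inner_left]
    simp [inner_sub_left, inner_sub_right, inner_smul_left, inner_smul_right, hs, Complex.conj_ofNat]
  rw [key]

theorem Phi_comp_adjoint (hγ : IsHermitianSymplectic γ) (hP : P ∈ Gr γ) :
    Phi γ P ∘L ContinuousLinearMap.adjoint (Phi γ P) = 1 := by
  ext y
  simp only [ContinuousLinearMap.comp_apply, Phi_apply hγ hP, Phi_adjoint_apply hγ hP,
    map_sub, map_smul, gr_idem hP, one_apply_eq_self]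
  module

theorem Phi_adjoint_comp (hγ : IsHermitianSymplectic γ) (hP : P ∈ Gr γ) :
    ContinuousLinearMap.adjoint (Phi γ P) ∘L Phi γ P = 1 := by
  ext y
  simp only [ContinuousLinearMap.comp_apply, Phi_apply hγ hP, Phi_adjoint_apply hγ hP,
    map_sub, map_smul, gr_idem hP, one_apply_eq_self]
  module

theorem PhiPair_mem_unitary (hγ : IsHermitianSymplectic γ) (hP : P ∈ Gr γ) (hQ : Q ∈ Gr γ) :
    PhiPair γ (P, Q) ∈ unitary (Eminus γ →L[ℂ] Eminus γ) := by
  have hP1 := Phi_comp_adjoint hγ hP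
  have hP2 := Phi_adjoint_comp hγ hP
  have hQ1 := Phi_comp_adjoint hγ hQ
  have hQ2 := Phi_adjoint_comp hγ hQ
  rw [Unitary.mem_iff]
  simp only [PhiPair, ContinuousLinearMap.star_eq_adjoint, ContinuousLinearMap.adjoint_comp,
    ContinuousLinearMap.adjoint_adjoint, ContinuousLinearMap.mul_def]
  constructor
  · rw [ContinuousLinearMap.comp_assoc,
      ← ContinuousLinearMap.comp_assoc _ (Phi γ P) (ContinuousLinearMap.adjoint (Phi γ Q)), hP2,
      ContinuousLinearMap.one_def, ContinuousLinearMap.id_comp, hQ1, ContinuousLinearMap.one_def]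
  · rw [ContinuousLinearMap.comp_assoc,
      ← ContinuousLinearMap.comp_assoc _ (Phi γ Q) (ContinuousLinearMap.adjoint (Phi γ P)), hQ2,
      ContinuousLinearMap.one_def, ContinuousLinearMap.id_comp, hP1, ContinuousLinearMap.one_def]

/-- The isomorphism `y ↦ 2 Q y` from `E_{-i}` onto the Lagrangian `im Q`; its inverse is the
projection to `E_{-i}`. -/
def graphEquiv (hγ : IsHermitianSymplectic γ) (hQ : Q ∈ Gr γ) : Eminus γ ≃L[ℂ] Q.range :=
  ContinuousLinearEquiv.equivOfInverse
    ((((2 : ℂ) • Q) ∘L (Eminus γ).subtypeL).codRestrict Q.range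
      (fun y => Q.range.smul_mem _ ⟨y, rfl⟩))
    ((Eminus γ).orthogonalProjectionOnto ∘L Q.range.subtypeL)
    (fun y => by
      have h := proj_minus hγ (gr_reflect_minus hγ hQ y.2) y.2
      simpa using h)
    (fun z => by
      obtain ⟨z, w, rfl⟩ := z
      set z : H := Q w with hz
      have hQz : Q z = z := gr_idem hQ w
      set zm : H := (2⁻¹ : ℂ) • (z + Complex.I • γ z) with hzm
      set zp : H := (2⁻¹ : ℂ) • (z - Complex.I • γ z) with hzp
      have hg2 : γ (γ z) = -z := by
        simpa using congrArg (fun T : H →L[ℂ] H => T z) hγ.sq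
      have hI : Complex.I • Complex.I • z = -z := by rw [smul_smul]; simp
      have hI' : Complex.I • Complex.I • γ z = -γ z := by rw [smul_smul]; simp
      have hm : zm ∈ Eminus γ := by
        rw [mem_Eminus, hzm, map_smul, map_add, map_smul, hg2, smul_comm Complex.I, ← smul_neg,
          smul_add Complex.I, hI']
        congr 1; module
      have hp : zp ∈ Eplus γ := by
        rw [mem_Eplus, hzp, map_smul, map_sub, map_smul, hg2, smul_comm Complex.I,
          smul_sub Complex.I, hI']
        congr 1; module
      have hsum : z = zp + zm := by rw [hzp, hzm]; module
      have hproj : (Eminus γ).orthogonalProjectionOnto z = ⟨zm, hm⟩ := by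
        conv_lhs => rw [hsum]
        exact proj_minus hγ hp hm
      have hQg : Q (γ z) = 0 := by
        have := gr_map_gamma hγ hQ z
        rw [hQz] at this
        simpa using this.symm
      apply Subtype.ext
      change (2 : ℂ) • Q ((Eminus γ).orthogonalProjectionOnto z : H) = z
      rw [hproj]
      simp only [hzm, map_smul, map_add, hQz, hQg]
      module)

theorem PhiPair_mem_UFred (hγ : IsHermitianSymplectic γ)
    {p : (H →L[ℂ] H) × (H →L[ℂ] H)} (hp : p ∈ GrFred γ) :
    PhiPair γ p ∈ UFred (Eminus γ) := by
  obtain ⟨P, Q⟩ := p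
  obtain ⟨hP, hQ, hF⟩ := hp
  refine ⟨PhiPair_mem_unitary hγ hP hQ, ?_⟩
  simp only [essSpectrum, Set.mem_ofPred_eq, not_not]
  obtain ⟨v, hv⟩ := hF.exists_isQuasiInverse
  let c : Eminus γ ≃L[ℂ] Eminus γ := ContinuousLinearEquiv.smulLeft (Units.mk0 (2 : ℂ) two_ne_zero)
  let eP := (graphEquiv hγ hP).symm.trans c
  let eQ := graphEquiv hγ hQ
  refine ContinuousLinearMap.IsFredholm.of_isQuasiInverse
    (v := eQ.symm.toContinuousLinearMap ∘L v ∘L eP.symm.toContinuousLinearMap) ?_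
  have h1 := (eQ.toLinearEquiv.isQuasiInverse.comp hv).comp eP.toLinearEquiv.isQuasiInverse
  have h2 : (PhiPair γ (P, Q) - (-1 : ℂ) • (1 : Eminus γ →L[ℂ] Eminus γ)) =
      eP.toContinuousLinearMap ∘L pairMap P Q ∘L eQ.toContinuousLinearMap := by
    ext y
    have e1 : (eQ y : H) = (2 : ℂ) • Q y := rfl
    have e2 : ∀ z : P.range, eP z = (2 : ℂ) • (Eminus γ).orthogonalProjectionOnto (z : H) :=
      fun z => rfl
    have hw : (2 : ℂ) • Q (y : H) - y ∈ Eplus γ := gr_reflect_minus hγ hQ y.2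
    have e3 : P ((2 : ℂ) • Q (y : H)) = (2⁻¹ : ℂ) • ((2 : ℂ) • P y - y + ((2 : ℂ) • Q y - y)) +
        (2⁻¹ : ℂ) • (((2 : ℂ) • P ((2 : ℂ) • Q y - y) - ((2 : ℂ) • Q y - y)) + y) := by
      simp only [map_sub, map_smul]; module
    have e4 := proj_minus hγ
      ((Eplus γ).smul_mem (2⁻¹ : ℂ) ((Eplus γ).add_mem (gr_reflect_minus hγ hP y.2) hw))
      ((Eminus γ).smul_mem (2⁻¹ : ℂ) ((Eminus γ).add_mem (gr_reflect_plus hγ hP hw) y.2))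
    rw [← e3] at e4
    have e5 : (eP (pairMap P Q (eQ y)) : H) =
        (2 : ℂ) • ((Eminus γ).orthogonalProjectionOnto (P (eQ y : H)) : H) := rfl
    change (PhiPair γ (P, Q) y - (-1 : ℂ) • y : H) = eP (pairMap P Q (eQ y))
    rw [e5, e1, e4]
    simp only [PhiPair, ContinuousLinearMap.comp_apply, Phi_apply hγ hP, Phi_adjoint_apply hγ hQ]
    module
  rw [h2]
  exact h1

theorem continuous_PhiPair : Continuous (PhiPair γ) := by
  have h : Continuous (Phi γ) := by
    unfold Phi; fun_prop
  unfold PhiPair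
  have h2 : Continuous fun p : (H →L[ℂ] H) × (H →L[ℂ] H) =>
      ContinuousLinearMap.adjoint (Phi γ p.2) :=
    ContinuousLinearMap.adjoint.continuous.comp (h.comp continuous_snd)
  exact (h.comp continuous_fst).clm_comp h2

end Helper

/-- The map `(P, Q) ↦ Φ(P) Φ(Q)*` from Fredholm pairs to `UFred(E_{-i})`. -/
def toUFred {γ : H →L[ℂ] H} (hγ : IsHermitianSymplectic γ) (p : GrFred γ) : UFred (Eminus γ) :=
  ⟨PhiPair γ p, PhiPair_mem_UFred hγ p.2⟩

theorem continuous_toUFred {γ : H →L[ℂ] H} (hγ : IsHermitianSymplectic γ) :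
    Continuous (toUFred hγ) :=
  (continuous_PhiPair.comp continuous_subtype_val).subtype_mk _

/-- The path `Φ(f) Φ(g)*` in `UFred(E_{-i})` of a path `(f, g)` of Fredholm pairs. -/
def phiPath {γ : H →L[ℂ] H} (hγ : IsHermitianSymplectic γ) {a b : GrFred γ} (p : Path a b) :
    Path (toUFred hγ a) (toUFred hγ b) :=
  p.map (continuous_toUFred hγ)

/-! ### The Maslov index -/

/-- The rotated pair `(e^{sγ} P e^{-sγ}, Q)`. -/
def rotate (γ : H →L[ℂ] H) (s : ℝ) (p : (H →L[ℂ] H) × (H →L[ℂ] H)) :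
    (H →L[ℂ] H) × (H →L[ℂ] H) :=
  (NormedSpace.exp ((s : ℂ) • γ) * p.1 * NormedSpace.exp (-((s : ℂ) • γ)), p.2)

/-- `M` is a Maslov index on the paths of Fredholm pairs of Lagrangian projections. The first three
fields say that on paths with endpoints in `GrStar γ` it induces an isomorphism
`π₁(GrFred γ, GrStar γ) → ℤ`, the fourth one fixes the sign, and the last one is the convention
for arbitrary endpoints. -/
structure IsMaslovIndex (γ : H →L[ℂ] H) (M : ∀ ⦃a b : GrFred γ⦄, Path a b → ℤ) : Prop where
  /-- Two paths with endpoints in `GrStar γ` have the same index exactly when they are homotopic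
  in `GrFred γ` through paths with endpoints in `GrStar γ`. -/
  eq_iff_homotopic : ∀ ⦃a b c d : GrFred γ⦄ (p : Path a b) (q : Path c d),
    a.1 ∈ GrStar γ → b.1 ∈ GrStar γ → c.1 ∈ GrStar γ → d.1 ∈ GrStar γ →
    (M p = M q ↔ ContinuousMap.HomotopicWith p.toContinuousMap q.toContinuousMap
      (fun f => (f 0).1 ∈ GrStar γ ∧ (f 1).1 ∈ GrStar γ))
  /-- Composition of paths goes to addition. -/
  map_trans : ∀ ⦃a b c : GrFred γ⦄ (p : Path a b) (q : Path b c),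
    a.1 ∈ GrStar γ → b.1 ∈ GrStar γ → c.1 ∈ GrStar γ → M (p.trans q) = M p + M q
  /-- Every integer is attained (unless `H = 0`, where there is only one path). -/
  surjective : Nontrivial H → ∀ n : ℤ, ∃ (a b : GrFred γ) (p : Path a b),
    a.1 ∈ GrStar γ ∧ b.1 ∈ GrStar γ ∧ M p = n
  /-- The path `(e^{sγ} P e^{-sγ}, Q)`, `-ε ≤ s ≤ ε`, has index `dim (ker P ∩ im Q)` for small
  `ε > 0`. -/
  normalization : ∀ (x : GrFred γ) (ε : ℝ), 0 < ε →
    (∀ s : ℝ, s ≠ 0 → |s| ≤ ε → rotate γ s x.1 ∈ GrStar γ) →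
    ∀ ⦃a b : GrFred γ⦄ (p : Path a b),
      (∀ t : I, (p t).1 = rotate γ (ε * (2 * (t : ℝ) - 1)) x.1) →
      M p = Module.finrank ℂ ↥(x.1.1.ker ⊓ x.1.2.range)
  /-- The index of an arbitrary path `(f, g)` is that of `(e^{εγ} f e^{-εγ}, g)` for small
  `ε > 0`. -/
  endpoints : ∀ ⦃a b : GrFred γ⦄ (p : Path a b) (ε : ℝ), 0 < ε →
    (∀ s ∈ Set.Icc 0 ε, ∀ t : I, rotate γ s (p t).1 ∈ GrFred γ) →
    (∀ s ∈ Set.Ioc 0 ε, rotate γ s a.1 ∈ GrStar γ ∧ rotate γ s b.1 ∈ GrStar γ) →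
    ∀ ⦃a' b' : GrFred γ⦄ (q : Path a' b'), (∀ t : I, (q t).1 = rotate γ ε (p t).1) →
      M p = M q

/-- The Maslov index `Mas(f, g)` of a path `p = (f, g)` of Fredholm pairs. -/
def mas (γ : H →L[ℂ] H) : ∀ ⦃a b : GrFred γ⦄, Path a b → ℤ :=
  Classical.epsilon (IsMaslovIndex γ)

end Symplectic

end Maslov

end

noncomputable section

namespace Maslov

/-! With respect to H = E_i ⊕ E_{-i} a Lagrangian projection P is the same thing as a unitary Φ(P) :
E_i → E_{-i}. Hence (P, Q) ↦ (Φ(P)Φ(Q)*, Φ(Q)) identifies Fredholm pairs with UFred(E_{-i}) × U(E_i,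
E_{-i}), and a pair is invertible exactly when its first entry lies in UStar
(`exists_PhiPair_add_one`, `mem_GrStar_iff`, `lagPair_toUFred`). The second factor is path connected
(`joined_one_unitary`), so paths of pairs with invertible endpoints are classified by the relative
homotopy classes of (UFred, UStar) (`index_eq_iff_homotopicWith`).

These classes are computed with one tool, the operator Möbius transform `mob P U r`, a path of
unitaries starting at U. Up to invertible factors it does not change U + 1 for r < 1
(`mob_add_one`), and at r = 1 it is the identity on ker P. With P = 0 it is (r + U)(1 + rU)⁻¹ and
contracts UStar to the identity (`starContraction`), so relative classes become loops at 1. With P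
the projection to a large finite set of basis vectors it pushes a whole compact family in UFred into
a finite unitary group (`eventually_isUnit_one_add`). There a basis vector is freed at a time: the
curve it traces is deformed off a suitable point (`exists_homotopic_erase`), and the transform with
P of corank one then fixes it. What remains is U(1), so every loop is homotopic to a standard loop 1
+ (e^{2πint} − 1)p (`exists_homotopic_stdLoop`).

The winding integral is a homotopy invariant (`integral_trace_eq`). For a C¹ loop g in 1 + trace
class, the integral of tr(g⁻¹g') is the limit of the logarithmic increments of determinants of
finite compressions, by Jacobi's formula. Such a determinant is homotopic to that of the Möbius
transform of g, and the latter is nonvanishing along any given homotopy in UFred once the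
compression is large. So the winding number exists, is unique, and classifies loops at 1.

Conjugating P by e^{sγ} multiplies Φ(P)Φ(Q)* by e^{-2is} (`PhiPair_rotate`). This matches the
endpoint convention for the Maslov index with the one for the winding number. In the normalization
path the angle decreases through 0, and the transform with P the projection to ker(U + 1) deforms it
to −dim ker(U + 1) turns (`hasIndex_crossing`), whence the sign in the theorem.

For uniqueness, a Maslov index on paths with invertible endpoints is an additive function of the
class, hence fixed by its value on one standard loop; the normalization at a crossing of
multiplicity one determines this value, and the endpoint rule extends the equality to all paths. -/

theorem isUnit_one_add_mul_swap {R : Type*} [Ring R] {a b : R} (h : IsUnit (1 + a * b)) :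
    IsUnit (1 + b * a) := by
  obtain ⟨u, hu⟩ := h
  have h1 : (1 + a * b) * ↑u⁻¹ = 1 := by rw [← hu]; simp
  have h2 : ↑u⁻¹ * (1 + a * b) = 1 := by rw [← hu]; simp
  refine ⟨⟨1 + b * a, 1 - b * ↑u⁻¹ * a, ?_, ?_⟩, rfl⟩
  · calc (1 + b * a) * (1 - b * ↑u⁻¹ * a) = 1 + b * (1 - (1 + a * b) * ↑u⁻¹) * a := by noncomm_ring
      _ = 1 := by rw [h1]; simp
  · calc (1 - b * ↑u⁻¹ * a) * (1 + b * a) = 1 + b * (1 - ↑u⁻¹ * (1 + a * b)) * a := by noncomm_ring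
      _ = 1 := by rw [h2]; simp

/-! ### Fredholm operators and the conditions defining UFred and UStar -/

section Fredholm

variable {K : Type*} [NormedAddCommGroup K] [InnerProductSpace ℂ K]

theorem mem_UStar_iff [CompleteSpace K] {U : K →L[ℂ] K} :
    U ∈ UStar K ↔ U ∈ unitary (K →L[ℂ] K) ∧ IsUnit (U + 1) := by
  have h : -(algebraMap ℂ (K →L[ℂ] K) (-1) - U) = U + 1 := by
    simp [Algebra.algebraMap_eq_smul_one]
  rw [UStar, Set.mem_ofPred_eq, spectrum.notMem_iff, ← IsUnit.neg_iff, h]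

theorem mem_UFred_iff [CompleteSpace K] {U : K →L[ℂ] K} :
    U ∈ UFred K ↔ U ∈ unitary (K →L[ℂ] K) ∧ (U + 1).IsFredholm := by
  simp [UFred, essSpectrum]

theorem isFredholm_of_isUnit {T : K →L[ℂ] K} (h : IsUnit T) : T.IsFredholm := by
  obtain ⟨u, rfl⟩ := h
  refine ContinuousLinearMap.IsFredholm.of_isQuasiInverse (v := (↑u⁻¹ : K →L[ℂ] K)) ?_
  have h1 : ((↑u⁻¹ : K →L[ℂ] K) : K →ₗ[ℂ] K) ∘ₗ ((↑u : K →L[ℂ] K) : K →ₗ[ℂ] K) = LinearMap.id := by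
    ext x; exact congrArg (fun T : K →L[ℂ] K => T x) u.inv_mul
  have h2 : ((↑u : K →L[ℂ] K) : K →ₗ[ℂ] K) ∘ₗ ((↑u⁻¹ : K →L[ℂ] K) : K →ₗ[ℂ] K) = LinearMap.id := by
    ext x; exact congrArg (fun T : K →L[ℂ] K => T x) u.mul_inv
  constructor
  · rw [LinearMap.IsLeftQuasiInverse, h1]
  · rw [LinearMap.IsRightQuasiInverse, h2]

theorem isFredholm_mul {S T : K →L[ℂ] K} (hS : S.IsFredholm) (hT : T.IsFredholm) :
    (S * T).IsFredholm := by
  obtain ⟨v, hv⟩ := hS.exists_isQuasiInverse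
  obtain ⟨w, hw⟩ := hT.exists_isQuasiInverse
  exact ContinuousLinearMap.IsFredholm.of_isQuasiInverse (v := w * v) (hw.comp hv)

-- Quasi-inverses only matter modulo finite rank, so an inverse of T + F is a quasi-inverse of T.
open LinearMap.FiniteRangeSetoid in
theorem isFredholm_of_isUnit_add {T F : K →L[ℂ] K} (h : IsUnit (T + F))
    (hF : (F : K →ₗ[ℂ] K).HasFiniteRange) : T.IsFredholm := by
  obtain ⟨v, hv⟩ := (isFredholm_of_isUnit h).exists_isQuasiInverse
  refine ContinuousLinearMap.IsFredholm.of_isQuasiInverse (v := v) (hv.congr (Setoid.refl _) ?_)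
  rw [LinearMap.FiniteRangeSetoid.equiv_iff_hasFiniteRange]
  have : (T : K →ₗ[ℂ] K) - ((T + F : K →L[ℂ] K) : K →ₗ[ℂ] K) = -F := by
    ext x; simp
  rw [this]
  exact hF.neg

end Fredholm

/-! ### Unitaries, orthogonal projections, and lower bounds for U + 1 -/

section Unitary

variable {K : Type*} [NormedAddCommGroup K] [InnerProductSpace ℂ K] [CompleteSpace K]

theorem unitary_inner_map {U : K →L[ℂ] K} (hU : U ∈ unitary (K →L[ℂ] K)) (x y : K) :
    inner ℂ (U x) (U y) = inner ℂ x y := by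
  have h : (star U * U) y = y := by rw [(Unitary.mem_iff.1 hU).1]; rfl
  rw [← ContinuousLinearMap.adjoint_inner_right, ← ContinuousLinearMap.star_eq_adjoint]
  exact congrArg _ h

theorem unitary_norm_map {U : K →L[ℂ] K} (hU : U ∈ unitary (K →L[ℂ] K)) (x : K) :
    ‖U x‖ = ‖x‖ := by
  rw [@norm_eq_sqrt_re_inner ℂ, @norm_eq_sqrt_re_inner ℂ _ _ _ _ x, unitary_inner_map hU]

theorem mem_unitary_of_norm_map {U : K →L[ℂ] K} (h : ∀ x, ‖U x‖ = ‖x‖)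
    (h' : ∀ x, ‖star U x‖ = ‖x‖) : U ∈ unitary (K →L[ℂ] K) := by
  rw [Unitary.mem_iff]
  constructor
  · exact (ContinuousLinearMap.norm_map_iff_adjoint_comp_self U).1 h
  · have := (ContinuousLinearMap.norm_map_iff_adjoint_comp_self (star U)).1 h'
    rwa [← ContinuousLinearMap.star_eq_adjoint, star_star] at this

theorem norm_unitary_le {U : K →L[ℂ] K} (hU : U ∈ unitary (K →L[ℂ] K)) : ‖U‖ ≤ 1 :=
  U.opNorm_le_bound zero_le_one fun x => by rw [unitary_norm_map hU, one_mul]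

/-- Expand ‖Ux + x‖² and use ‖Ux‖ = ‖x‖. This turns a lower bound for ‖(U + 1)x‖ into coercivity of
the quadratic form, a property that survives compression to a subspace. -/
theorem re_inner_unitary_add_one {U : K →L[ℂ] K} (hU : U ∈ unitary (K →L[ℂ] K)) (x : K) :
    (inner ℂ ((U + 1) x) x).re = ‖(U + 1) x‖ ^ 2 / 2 := by
  have h := @norm_add_sq ℂ _ _ _ _ (U x) x
  have h2 := @inner_self_eq_norm_sq ℂ _ _ _ _ x
  simp only [add_apply, one_apply_eq_self, inner_add_left, Complex.add_re]
  rw [unitary_norm_map hU] at h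
  simp only [RCLike.re_eq_complex_re] at h h2
  rw [h, h2]; ring

theorem starProj_inner {P : K →L[ℂ] K} (hP : IsStarProjection P) (x y : K) :
    inner ℂ (P x) y = inner ℂ x (P y) := by
  conv_lhs => rw [← hP.isSelfAdjoint.star_eq, ContinuousLinearMap.star_eq_adjoint]
  rw [ContinuousLinearMap.adjoint_inner_left]

theorem starProj_idem {P : K →L[ℂ] K} (hP : IsStarProjection P) (x : K) : P (P x) = P x :=
  congrArg (fun T : K →L[ℂ] K => T x) hP.isIdempotentElem.eq

theorem starProj_norm_sq {P : K →L[ℂ] K} (hP : IsStarProjection P) (x : K) :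
    ‖x‖ ^ 2 = ‖P x‖ ^ 2 + ‖x - P x‖ ^ 2 := by
  have h0 : inner ℂ (P x) (x - P x) = 0 := by
    rw [starProj_inner hP, map_sub, starProj_idem hP, sub_self, inner_zero_right]
  have := norm_add_sq_eq_norm_sq_add_norm_sq_of_inner_eq_zero (P x) (x - P x) h0
  rw [add_sub_cancel] at this
  nlinarith

theorem re_inner_starProj {P : K →L[ℂ] K} (hP : IsStarProjection P) (x : K) :
    (inner ℂ (P x) x).re = ‖P x‖ ^ 2 := by
  have h2 := @inner_self_eq_norm_sq ℂ _ _ _ _ (P x)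
  rw [← h2, starProj_inner hP, starProj_inner hP, starProj_idem hP]; rfl

theorem norm_starProj_le {P : K →L[ℂ] K} (hP : IsStarProjection P) : ‖P‖ ≤ 1 :=
  P.opNorm_le_bound zero_le_one fun x => by
    rw [one_mul]
    refine le_of_sq_le_sq ?_ (norm_nonneg _)
    rw [starProj_norm_sq hP x]; nlinarith [sq_nonneg ‖x - P x‖]

/-- Lax–Milgram. -/
theorem isUnit_of_re_inner_le {T : K →L[ℂ] K} {c : ℝ} (hc : 0 < c)
    (h : ∀ x, c * ‖x‖ ^ 2 ≤ (inner ℂ (T x) x).re) : IsUnit T := by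
  refine ContinuousLinearMap.isUnit_of_forall_le_norm_inner_map T (c := ⟨c, hc.le⟩) hc fun x => ?_
  calc ‖x‖ ^ 2 * c = c * ‖x‖ ^ 2 := mul_comm _ _
    _ ≤ _ := (h x).trans (Complex.re_le_norm _)

/-- A unitary which is bounded away from `-1` on the kernel of the projection `P`. -/
def AwayOn (P U : K →L[ℂ] K) (c : ℝ) : Prop := ∀ x, P x = 0 → c * ‖x‖ ≤ ‖(U + 1) x‖

/-- With Q = 1 − P one has 1 + QU = (1 + QUP)(P + Q(U + 1)Q). The first factor is unipotent because
(QUP)² = 0; the second is coercive, being P on one block and the compression of U + 1 to the range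
of Q on the other. -/
theorem isUnit_one_add_mul_of_awayOn {P U : K →L[ℂ] K} {c : ℝ} (hP : IsStarProjection P)
    (hU : U ∈ unitary (K →L[ℂ] K)) (hc : 0 < c) (h : AwayOn P U c) :
    IsUnit (1 + (1 - P) * U) := by
  set Q := 1 - P with hQ
  have hPP : P * P = P := hP.isIdempotentElem.eq
  have hPQ : P * Q = 0 := by rw [hQ, mul_sub, hPP, mul_one, sub_self]
  have hQQ : Q * Q = Q := hP.one_sub.isIdempotentElem.eq
  have hQP : Q * P = 0 := by rw [hQ, sub_mul, hPP, one_mul, sub_self]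
  have hQs : IsStarProjection Q := hP.one_sub
  have hC : IsUnit (P + Q * (U + 1) * Q) := by
    refine isUnit_of_re_inner_le (c := min 1 (c ^ 2 / 2)) (by positivity) fun x => ?_
    have e1 : inner ℂ ((P + Q * (U + 1) * Q) x) x =
        inner ℂ (P x) x + inner ℂ ((U + 1) (Q x)) (Q x) := by
      rw [add_apply, inner_add_left, ← starProj_inner hQs]; rfl
    rw [e1, Complex.add_re, re_inner_unitary_add_one hU, re_inner_starProj hP,
      starProj_norm_sq hP x]
    have e2 : P (Q x) = 0 := congrArg (fun T : K →L[ℂ] K => T x) hPQ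
    have e3 := h _ e2
    have e4 : x - P x = Q x := rfl
    rw [e4]
    have e5 : c ^ 2 * ‖Q x‖ ^ 2 ≤ ‖(U + 1) (Q x)‖ ^ 2 := by
      rw [← mul_pow]; exact pow_le_pow_left₀ (by positivity) e3 2
    have := min_le_left 1 (c ^ 2 / 2)
    have := min_le_right 1 (c ^ 2 / 2)
    nlinarith [sq_nonneg ‖P x‖, sq_nonneg ‖Q x‖]
  have hN : IsUnit (1 + Q * U * P) := by
    refine ⟨⟨1 + Q * U * P, 1 - Q * U * P, ?_, ?_⟩, rfl⟩
    · calc (1 + Q * U * P) * (1 - Q * U * P) = 1 - Q * U * (P * Q) * U * P := by noncomm_ring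
        _ = 1 := by rw [hPQ]; simp
    · calc (1 - Q * U * P) * (1 + Q * U * P) = 1 - Q * U * (P * Q) * U * P := by noncomm_ring
        _ = 1 := by rw [hPQ]; simp
  convert hN.mul hC using 1
  have e : (1 + Q * U * P) * (P + Q * (U + 1) * Q) =
      P + Q * U * Q + Q * Q + Q * U * (P * P) + Q * U * (P * Q) * (U + 1) * Q := by noncomm_ring
  rw [e, hPP, hPQ, hQQ]
  have : (1 : K →L[ℂ] K) = P + Q := by simp [hQ]
  calc 1 + Q * U = P + Q + Q * U * (P + Q) := by rw [← this]; simp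
    _ = _ := by noncomm_ring

/-- The orthogonal projection onto the kernel of `U + 1`. -/
def kerProj (U : K →L[ℂ] K) : K →L[ℂ] K := ((U + 1).ker).starProjection

theorem isStarProjection_kerProj (U : K →L[ℂ] K) : IsStarProjection (kerProj U) :=
  isStarProjection_starProjection

omit [CompleteSpace K] in
theorem mem_ker_add_one {U : K →L[ℂ] K} {x : K} : x ∈ (U + 1).ker ↔ U x = -x := by
  simp [LinearMap.mem_ker, add_eq_zero_iff_eq_neg]

theorem range_kerProj (U : K →L[ℂ] K) : (kerProj U).range = (U + 1).ker := by
  simp [kerProj]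

theorem mul_kerProj (U : K →L[ℂ] K) : U * kerProj U = -kerProj U := by
  ext x
  exact mem_ker_add_one.1 (Submodule.starProjection_apply_mem _ x)

/-- The adjoint of U also acts as −1 on the eigenspace, so the eigenspace reduces U; take adjoints.
-/
theorem kerProj_mul {U : K →L[ℂ] K} (hU : U ∈ unitary (K →L[ℂ] K)) :
    kerProj U * U = -kerProj U := by
  have h1 : star U * kerProj U = -kerProj U := by
    have := congrArg (fun T => star U * T) (mul_kerProj U)
    simp only [← mul_assoc, (Unitary.mem_iff.1 hU).1, one_mul, mul_neg] at this
    rw [← neg_eq_iff_eq_neg, ← this]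
  have := congrArg star h1
  rwa [star_mul, star_star, star_neg, (isStarProjection_kerProj U).isSelfAdjoint.star_eq] at this

theorem hasFiniteRange_kerProj {U : K →L[ℂ] K} (hU : U ∈ UFred K) :
    ((kerProj U : K →L[ℂ] K) : K →ₗ[ℂ] K).HasFiniteRange := by
  have := (mem_UFred_iff.1 hU).2.finite_ker
  rw [LinearMap.HasFiniteRange]
  have h := range_kerProj U
  rw [h]
  exact Submodule.fg_iff_finiteDimensional _ |>.2 this

/-- A Fredholm operator T = U + 1 has a bounded quasi-inverse v with TvT = T. For x orthogonal to
ker T the difference vTx − x lies in ker T, so Pythagoras gives ‖x‖ ≤ ‖vTx‖ ≤ ‖v‖ ‖Tx‖. -/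
theorem exists_awayOn_kerProj {U : K →L[ℂ] K} (hU : U ∈ UFred K) :
    ∃ c : ℝ, 0 < c ∧ AwayOn (kerProj U) U c := by
  obtain ⟨pkg⟩ := (mem_UFred_iff.1 hU).2.nonempty_fredholmPackage
  set T := U + 1 with hT
  set v := pkg.quasiInverse with hv
  have h1 : ∀ x, T (v (T x)) = T x := by
    intro x
    have hx : ∀ z, T z = pkg.equiv (pkg.decDom.proj z) := fun z => by
      conv_lhs => rw [pkg.eq_equiv]
      rfl
    have h2 : v (T x) = pkg.decDom.proj x := by
      rw [hx x, hv, ContinuousLinearMap.FredholmPackage.quasiInverse]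
      simp
    rw [h2, hx, hx x]
    exact congrArg (fun z => (pkg.equiv z : K)) (Submodule.projectionOnto_apply_left _ _)
  -- The summand 1 avoids dividing by zero when v = 0.
  refine ⟨(‖v‖ + 1)⁻¹, by positivity, fun x hx => ?_⟩
  have hxo : x ∈ (T.ker)ᗮ := by
    rw [kerProj] at hx
    rwa [Submodule.starProjection_apply_eq_zero_iff] at hx
  have hk : v (T x) - x ∈ T.ker := by
    rw [LinearMap.mem_ker]; simp [h1]
  have h3 : ‖x‖ ≤ ‖v (T x)‖ := by
    have h0 : inner ℂ (v (T x) - x) x = 0 := hxo _ hk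
    have := norm_add_sq_eq_norm_sq_add_norm_sq_of_inner_eq_zero _ _ h0
    rw [sub_add_cancel] at this
    refine le_of_sq_le_sq ?_ (norm_nonneg _)
    nlinarith [sq_nonneg ‖v (T x) - x‖]
  rw [inv_mul_le_iff₀ (by positivity)]
  calc ‖x‖ ≤ ‖v‖ * ‖T x‖ := h3.trans (v.le_opNorm _)
    _ ≤ _ := by gcongr; linarith

/-- Here (1 − p)U = U + p for p = `kerProj U`, so this is the criterion for 1 + (1 − p)U.
Invertibility is an open condition, which makes the finite rank correction p useful for perturbing
U. -/
theorem isUnit_add_kerProj {U : K →L[ℂ] K} (hU : U ∈ UFred K) : IsUnit (U + 1 + kerProj U) := by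
  obtain ⟨c, hc, h⟩ := exists_awayOn_kerProj hU
  convert isUnit_one_add_mul_of_awayOn (isStarProjection_kerProj U) hU.1 hc h using 1
  rw [sub_mul, one_mul, kerProj_mul hU.1]; abel

end Unitary

/-! ### The operator Möbius transform: algebra -/

section MoebiusAlgebra

variable {A : Type*} [Ring A] [Algebra ℂ A]

omit [Algebra ℂ A] in
theorem inverse_eq_of_mul_eq_one {x y : A} (hx : IsUnit x) (h : x * y = 1) :
    Ring.inverse x = y := by
  rw [← mul_one (Ring.inverse x), ← h, ← mul_assoc, Ring.inverse_mul_cancel _ hx, one_mul]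

/-- The element `P + √(1 - r²) (1 - P)`. -/
def mobD (P : A) (r : ℝ) : A := P + (√(1 - r ^ 2) : ℂ) • (1 - P)

/-- The operator Möbius transform of `U` with parameter `r (1 - P)`. For `r = 0` it is `U`, and for
`r = 1` it is the identity on the kernel of the projection `P`. -/
def mob (P U : A) (r : ℝ) : A :=
  (r : ℂ) • (1 - P) + mobD P r * (U * Ring.inverse (1 + (r : ℂ) • ((1 - P) * U)) * mobD P r)

variable {P U : A} {r : ℝ}

theorem mob_zero : mob P U 0 = U := by
  simp [mob, mobD]

theorem mob_one : mob P U 1 = (1 - P) + P * (U * Ring.inverse (1 + (1 - P) * U) * P) := by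
  simp [mob, mobD]

theorem add_smul_compl_mul (hPP : P * P = P) (w v : ℂ) :
    (P + w • (1 - P)) * (P + v • (1 - P)) = P + (w * v) • (1 - P) := by
  simp only [mul_add, add_mul, Algebra.mul_smul_comm, Algebra.smul_mul_assoc, mul_sub, sub_mul, hPP,
    mul_one, one_mul, sub_self, smul_zero]
  module

theorem isUnit_add_smul_compl (hPP : P * P = P) {z : ℂ} (hz : z ≠ 0) :
    IsUnit (P + z • (1 - P)) :=
  ⟨⟨_, P + z⁻¹ • (1 - P), by rw [add_smul_compl_mul hPP, mul_inv_cancel₀ hz]; simp,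
    by rw [add_smul_compl_mul hPP, inv_mul_cancel₀ hz]; simp⟩, rfl⟩

/-- The operator form of (r + u)/(1 + ru) + 1 = (1 + r)(1 + u)/(1 + ru). All factors around U + 1
are invertible for r < 1, so the transform preserves both the Fredholm property and invertibility of
U + 1. -/
theorem mob_add_one (hPP : P * P = P) (hr : 0 ≤ r) (hr1 : r < 1)
    (hu : IsUnit (1 + (r : ℂ) • ((1 - P) * U))) :
    mob P U r + 1 = mobD P r * (P + (1 - (r : ℂ))⁻¹ • (1 - P)) * (U + 1) *
      (Ring.inverse (1 + (r : ℂ) • ((1 - P) * U)) * mobD P r) := by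
  have hr' : (1 - r : ℂ) ≠ 0 := by
    have : (1 - r : ℝ) ≠ 0 := by linarith
    exact_mod_cast this
  have hc2 : (√(1 - r ^ 2) : ℂ) * √(1 - r ^ 2) = 1 - (r : ℂ) ^ 2 := by
    rw [← Complex.ofReal_mul, Real.mul_self_sqrt (by nlinarith)]; push_cast; ring
  set Z := Ring.inverse (1 + (r : ℂ) • ((1 - P) * U)) with hZ
  have hZ1 : (1 + (r : ℂ) • ((1 - P) * U)) * Z = 1 := Ring.mul_inverse_cancel _ hu
  have e1 : (P + (1 - (r : ℂ))⁻¹ • (1 - P)) * (U + 1) =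
      (P + (1 - (r : ℂ))⁻¹ • (1 - P)) * (1 + (r : ℂ) • ((1 - P) * U)) + U := by
    simp only [mul_add, add_mul, Algebra.mul_smul_comm, Algebra.smul_mul_assoc, mul_sub, sub_mul,
      hPP, mul_one, one_mul, ← mul_assoc]
    have h3 : (r : ℂ) * (1 - (r : ℂ))⁻¹ = (1 - (r : ℂ))⁻¹ - 1 := by field_simp; ring
    rw [← sub_eq_zero]
    trans ((1 - (r : ℂ))⁻¹ - 1 - (r : ℂ) * (1 - (r : ℂ))⁻¹) • (U - P * U)
    · module
    · rw [h3, sub_self, zero_smul]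
  have e2 : mobD P r * (P + (1 - (r : ℂ))⁻¹ • (1 - P)) * mobD P r = P + (1 + (r : ℂ)) • (1 - P) := by
    rw [mobD, add_smul_compl_mul hPP, add_smul_compl_mul hPP]
    have h3 : (√(1 - r ^ 2) : ℂ) * (1 - (r : ℂ))⁻¹ * √(1 - r ^ 2) = 1 + r := by
      rw [mul_right_comm, hc2]; field_simp; ring
    rw [h3]
  calc mob P U r + 1 = (P + (1 + (r : ℂ)) • (1 - P)) + mobD P r * (U * Z * mobD P r) := by
        rw [mob]; module
    _ = mobD P r * ((P + (1 - (r : ℂ))⁻¹ • (1 - P)) * ((1 + (r : ℂ) • ((1 - P) * U)) * Z) + U * Z) *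
          mobD P r := by
        rw [hZ1, ← e2]; noncomm_ring
    _ = mobD P r * ((P + (1 - (r : ℂ))⁻¹ • (1 - P)) * (1 + (r : ℂ) • ((1 - P) * U)) + U) *
          (Z * mobD P r) := by
        noncomm_ring
    _ = _ := by rw [← e1]; noncomm_ring

/-- The factorization for r < 1 degenerates at r = 1. Put Q = 1 − P, Z = (1 + QU)⁻¹ and T = (U +
1)Z. Then QT = Q, so T is block triangular and its inverse compresses to an inverse of the corner
PTP; the operator in question is 2Q + PTP. -/
theorem isUnit_mob_one_add_one (hPP : P * P = P) (hu1 : IsUnit (1 + (1 - P) * U))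
    (hU1 : IsUnit (U + 1)) : IsUnit (mob P U 1 + 1) := by
  obtain ⟨Q, hQ⟩ : ∃ Q, Q = 1 - P := ⟨_, rfl⟩
  have hPe : P = 1 - Q := by rw [hQ]; abel
  have hPQ : P * Q = 0 := by rw [hQ, mul_sub, hPP, mul_one, sub_self]
  have hQP : Q * P = 0 := by rw [hQ, sub_mul, hPP, one_mul, sub_self]
  have hQQ : Q * Q = Q := by
    have : Q * (1 - P) = Q := by rw [mul_sub, hQP]; simp
    rwa [← hQ] at this
  rw [mob_one, ← hQ]
  rw [← hQ] at hu1
  set Z := Ring.inverse (1 + Q * U) with hZ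
  have hZ1 : (1 + Q * U) * Z = 1 := Ring.mul_inverse_cancel _ hu1
  obtain ⟨T, hT⟩ : IsUnit ((U + 1) * Z) := hU1.mul hu1.ringInverse
  obtain ⟨S, hS⟩ : ∃ S : A, S = ↑T⁻¹ := ⟨_, rfl⟩
  obtain ⟨T', hT'⟩ : ∃ S : A, S = ↑T := ⟨_, rfl⟩
  have hTS : T' * S = 1 := by rw [hT', hS]; simp
  have hST : S * T' = 1 := by rw [hT', hS]; simp
  rw [← hT'] at hT
  clear_value Z
  clear hS hT' hZ
  have hQT : Q * T' = Q := by
    rw [hT]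
    calc Q * ((U + 1) * Z) = (Q * U + Q) * Z := by noncomm_ring
      _ = (Q * Q * U + Q) * Z := by rw [hQQ]
      _ = Q * ((1 + Q * U) * Z) := by noncomm_ring
      _ = Q := by rw [hZ1, mul_one]
  have hQS : Q * S = Q := by
    calc Q * S = Q * T' * S := by rw [hQT]
      _ = Q := by rw [mul_assoc, hTS, mul_one]
  have e : Q + P * (U * Z * P) + 1 = (2 : ℂ) • Q + P * T' * P := by
    have h5 : P = P * Z * P := by
      calc P = P * ((1 + Q * U) * Z) * P := by rw [hZ1, mul_one, hPP]
        _ = P * Z * P + (P * Q) * U * Z * P := by noncomm_ring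
        _ = _ := by rw [hPQ]; simp
    have h6 : P * T' * P = P * (U * Z * P) + P * Z * P := by rw [hT]; noncomm_ring
    rw [h6, ← h5, two_smul, hPe]; abel
  rw [e]
  have a1 : ∀ A' B : A, A' * B = 1 → Q * B = Q → ∀ z w : ℂ, z * w = 1 →
      (z • Q + P * A' * P) * (w • Q + P * B * P) = 1 := by
    intro A' B hAB hB z w hzw
    have h7 : (z • Q + P * A' * P) * (w • Q + P * B * P) = (z * w) • (Q * Q) +
        z • (Q * P * (B * P)) + w • (P * A' * (P * Q)) + P * A' * (P * P) * B * P := by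
      simp only [mul_add, add_mul, Algebra.mul_smul_comm, Algebra.smul_mul_assoc, mul_assoc]
      module
    have h2 : P * A' * P * B * P = P * (A' * B) * P - P * A' * (Q * B) * P := by
      rw [hQ]; noncomm_ring
    rw [h7, hzw, hQQ, hQP, hPQ, hPP, h2, hAB, hB, mul_assoc _ Q P, hQP, mul_one, hPP, hQ]
    simp
  exact ⟨⟨_, (2⁻¹ : ℂ) • Q + P * S * P, a1 _ _ hTS hQS _ _ (by norm_num),
    a1 _ _ hST hQT _ _ (by norm_num)⟩, rfl⟩

theorem isUnit_mobD (hPP : P * P = P) (hr : 0 ≤ r) (hr1 : r < 1) : IsUnit (mobD P r) := by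
  refine isUnit_add_smul_compl hPP ?_
  have : 0 < √(1 - r ^ 2) := Real.sqrt_pos.2 (by nlinarith)
  exact_mod_cast this.ne'

theorem isUnit_inv_one_sub (hPP : P * P = P) (hr1 : r < 1) :
    IsUnit (P + (1 - (r : ℂ))⁻¹ • (1 - P)) := by
  refine isUnit_add_smul_compl hPP (inv_ne_zero ?_)
  have : (1 - r : ℝ) ≠ 0 := by linarith
  exact_mod_cast this

theorem isUnit_mob_add_one (hPP : P * P = P) (hr : r ∈ Set.Icc (0 : ℝ) 1)
    (hu : IsUnit (1 + (r : ℂ) • ((1 - P) * U))) (hU1 : IsUnit (U + 1)) :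
    IsUnit (mob P U r + 1) := by
  rcases hr.2.lt_or_eq with hr1 | rfl
  · rw [mob_add_one hPP hr.1 hr1 hu]
    have hD := isUnit_mobD hPP hr.1 hr1
    exact ((hD.mul (isUnit_inv_one_sub hPP hr1)).mul hU1).mul (hu.ringInverse.mul hD)
  · exact isUnit_mob_one_add_one hPP (by simpa using hu) hU1

/-- On the range of 1 − P this is r + (1 − r²)/(1 + r) = 1. It ensures that transforming a loop
based at 1 keeps the base point. -/
theorem mob_one_right (hPP : P * P = P) (hr : r ∈ Set.Icc (0 : ℝ) 1) : mob P 1 r = 1 := by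
  have hr' : (1 + r : ℂ) ≠ 0 := by
    have : (1 + r : ℝ) ≠ 0 := by linarith [hr.1]
    exact_mod_cast this
  have h1 : (1 + (r : ℂ) • ((1 - P) * 1)) = P + (1 + r : ℂ) • (1 - P) := by
    rw [mul_one]; module
  have h2 : Ring.inverse (P + (1 + r : ℂ) • (1 - P)) = P + (1 + r : ℂ)⁻¹ • (1 - P) := by
    refine inverse_eq_of_mul_eq_one (isUnit_add_smul_compl hPP hr') ?_
    rw [add_smul_compl_mul hPP, mul_inv_cancel₀ hr']; simp
  have hc2 : (√(1 - r ^ 2) : ℂ) * √(1 - r ^ 2) = 1 - (r : ℂ) ^ 2 := by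
    rw [← Complex.ofReal_mul, Real.mul_self_sqrt (by nlinarith [hr.1, hr.2])]; push_cast; ring
  have h3 : (√(1 - r ^ 2) : ℂ) * ((1 + r : ℂ)⁻¹ * √(1 - r ^ 2)) = 1 - r := by
    rw [mul_left_comm, hc2]; field_simp; ring
  rw [mob, h1, h2, one_mul, mobD, add_smul_compl_mul hPP, add_smul_compl_mul hPP, h3]
  module

end MoebiusAlgebra

/-! ### The Möbius transform of unitary operators -/

section Moebius

variable {K : Type*} [NormedAddCommGroup K] [InnerProductSpace ℂ K] [CompleteSpace K]

variable {P U : K →L[ℂ] K} {r : ℝ}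

theorem isUnit_one_add_smul_of_lt (hP : IsStarProjection P) (hU : U ∈ unitary (K →L[ℂ] K))
    (hr : 0 ≤ r) (hr1 : r < 1) : IsUnit (1 + (r : ℂ) • ((1 - P) * U)) := by
  have h : ‖-((r : ℂ) • ((1 - P) * U))‖ < 1 := by
    rw [norm_neg, norm_smul, Complex.norm_real, Real.norm_of_nonneg hr]
    have h1 := norm_mul_le (1 - P) U
    have h2 := norm_starProj_le hP.one_sub
    have h3 := norm_unitary_le hU
    have h4 : ‖(1 - P) * U‖ ≤ 1 := h1.trans (mul_le_one₀ h2 (norm_nonneg _) h3)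
    calc r * ‖(1 - P) * U‖ ≤ r * 1 := by gcongr
      _ < 1 := by simpa
  simpa using (isUnit_one_sub_of_norm_lt_one h)

theorem isUnit_one_add_smul (hP : IsStarProjection P) (hU : U ∈ unitary (K →L[ℂ] K))
    (hu : IsUnit (1 + (1 - P) * U)) (hr : r ∈ Set.Icc (0 : ℝ) 1) :
    IsUnit (1 + (r : ℂ) • ((1 - P) * U)) := by
  rcases hr.2.lt_or_eq with h | rfl
  · exact isUnit_one_add_smul_of_lt hP hU hr.1 h
  · simpa using hu

theorem mobD_star (hP : IsStarProjection P) : star (mobD P r) = mobD P r := by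
  simp [mobD, hP.isSelfAdjoint.star_eq]

/-- Pull U* through the resolvent: (1 + rU*Q)⁻¹U* = U*(1 + rQU*)⁻¹ with Q = 1 − P. As the adjoint is
again a transform, unitarity reduces to the isometry property. -/
theorem star_mob (hP : IsStarProjection P)
    (hu : IsUnit (1 + (r : ℂ) • ((1 - P) * U))) :
    IsUnit (1 + (r : ℂ) • ((1 - P) * star U)) ∧ star (mob P U r) = mob P (star U) r := by
  have hs : star (1 + (r : ℂ) • ((1 - P) * U)) = 1 + (r : ℂ) • (star U * (1 - P)) := by
    simp [hP.isSelfAdjoint.star_eq]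
  have h1 : IsUnit (1 + (r : ℂ) • (star U * (1 - P))) := hs ▸ hu.star
  have h2 : IsUnit (1 + (r : ℂ) • ((1 - P) * star U)) := by
    rw [← Algebra.mul_smul_comm] at h1
    have := isUnit_one_add_mul_swap h1
    rwa [Algebra.smul_mul_assoc] at this
  refine ⟨h2, ?_⟩
  have h3 : Ring.inverse (1 + (r : ℂ) • (star U * (1 - P))) * star U =
      star U * Ring.inverse (1 + (r : ℂ) • ((1 - P) * star U)) := by
    have e : star U * (1 + (r : ℂ) • ((1 - P) * star U)) =
        (1 + (r : ℂ) • (star U * (1 - P))) * star U := by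
      simp only [mul_add, add_mul, mul_one, one_mul, Algebra.mul_smul_comm, Algebra.smul_mul_assoc, mul_assoc]
    calc _ = Ring.inverse (1 + (r : ℂ) • (star U * (1 - P))) * (star U *
          (1 + (r : ℂ) • ((1 - P) * star U))) * Ring.inverse (1 + (r : ℂ) • ((1 - P) * star U)) := by
          rw [mul_assoc, mul_assoc, Ring.mul_inverse_cancel _ h2, mul_one]
      _ = _ := by rw [e, ← mul_assoc, Ring.inverse_mul_cancel _ h1, one_mul]
  have h4 : star (Ring.inverse (1 + (r : ℂ) • ((1 - P) * U))) =
      Ring.inverse (1 + (r : ℂ) • (star U * (1 - P))) := by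
    rw [← Ring.inverse_star, hs]
  simp only [mob, star_add, star_mul, mobD_star hP, h4, h3, star_smul, star_sub, star_one,
    hP.isSelfAdjoint.star_eq, mul_assoc]
  simp

/-- Let Q = 1 − P, c = √(1 − r²), M the transform, and x = (1 + rQU)⁻¹(P + cQ)y. Then Px = Py and
PMy = PUx, while (Qx, QMy) arises from (Qy, QUx) by the rotation matrix with entries c, −r, r, c.
Hence ‖Qx‖² + ‖QMy‖² = ‖Qy‖² + ‖QUx‖², and ‖Ux‖ = ‖x‖ gives the claim. -/
theorem norm_mob_apply (hP : IsStarProjection P) (hU : U ∈ unitary (K →L[ℂ] K))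
    (hr : r ∈ Set.Icc (0 : ℝ) 1) (hu : IsUnit (1 + (r : ℂ) • ((1 - P) * U))) (y : K) :
    ‖mob P U r y‖ = ‖y‖ := by
  set c : ℝ := √(1 - r ^ 2) with hc
  have hc2 : c ^ 2 = 1 - r ^ 2 := Real.sq_sqrt (by nlinarith [hr.1, hr.2])
  set x := Ring.inverse (1 + (r : ℂ) • ((1 - P) * U)) (mobD P r y) with hx
  have hxy : x + (r : ℂ) • (U x - P (U x)) = P y + (c : ℂ) • (y - P y) := by
    have h1 : mobD P r y = P y + (c : ℂ) • (y - P y) := by simp [mobD, hc]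
    rw [← h1]
    have h2 := congrArg (fun T : K →L[ℂ] K => T (mobD P r y)) (Ring.mul_inverse_cancel _ hu)
    simp only [mul_apply_eq_comp] at h2
    rw [← hx] at h2
    simpa using h2
  have hM : mob P U r y = (r : ℂ) • (y - P y) + (P (U x) + (c : ℂ) • (U x - P (U x))) := by
    simp only [mob, mobD, add_apply, mul_apply_eq_comp] at hx ⊢
    rw [← hx]; simp [hc]
  have hPx : P x = P y := by
    have := congrArg P hxy
    simpa [starProj_idem hP] using this
  have hxq : x - P x = (c : ℂ) • (y - P y) - (r : ℂ) • (U x - P (U x)) := by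
    rw [hPx, eq_sub_iff_add_eq, sub_add_eq_add_sub, hxy]; abel
  have hPM : P (mob P U r y) = P (U x) := by
    rw [hM]; simp [starProj_idem hP]
  have hQM : mob P U r y - P (mob P U r y) = (r : ℂ) • (y - P y) + (c : ℂ) • (U x - P (U x)) := by
    rw [hPM, hM]; abel
  have hn := starProj_norm_sq hP (mob P U r y)
  have hny := starProj_norm_sq hP y
  have hnx := starProj_norm_sq hP x
  have hnU := starProj_norm_sq hP (U x)
  rw [unitary_norm_map hU] at hnU
  rw [hQM, hPM, @norm_add_sq ℂ] at hn
  rw [hxq, @norm_sub_sq ℂ, hPx] at hnx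
  simp only [norm_smul, Complex.norm_real, inner_smul_left, inner_smul_right, Complex.conj_ofReal,
    mul_pow, Real.norm_eq_abs, sq_abs, hc2] at hn hnx
  have e : ∀ z : ℂ, RCLike.re ((c : ℂ) * ((r : ℂ) * z)) = c * (r * z.re) := fun z => by
    simp
  have e' : ∀ z : ℂ, RCLike.re ((r : ℂ) * ((c : ℂ) * z)) = c * (r * z.re) := fun z => by
    simp; ring
  simp only [e, e'] at hn hnx
  rw [← sq_eq_sq₀ (norm_nonneg _) (norm_nonneg _)]
  nlinarith

theorem mob_mem_unitary (hP : IsStarProjection P) (hU : U ∈ unitary (K →L[ℂ] K))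
    (hr : r ∈ Set.Icc (0 : ℝ) 1) (hu : IsUnit (1 + (r : ℂ) • ((1 - P) * U))) :
    mob P U r ∈ unitary (K →L[ℂ] K) := by
  obtain ⟨h1, h2⟩ := star_mob hP hu
  refine mem_unitary_of_norm_map (norm_mob_apply hP hU hr hu) ?_
  rw [h2]
  exact norm_mob_apply hP (Unitary.star_mem hU) hr h1

theorem mob_mem_UFred_of_lt (hP : IsStarProjection P) (hU : U ∈ UFred K) (hr : 0 ≤ r)
    (hr1 : r < 1) : mob P U r ∈ UFred K := by
  have hPP := hP.isIdempotentElem.eq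
  have hu := isUnit_one_add_smul_of_lt hP hU.1 hr hr1
  refine mem_UFred_iff.2 ⟨mob_mem_unitary hP hU.1 ⟨hr, hr1.le⟩ hu, ?_⟩
  rw [mob_add_one hPP hr hr1 hu]
  have hD := isUnit_mobD hPP hr hr1
  exact isFredholm_mul (isFredholm_mul (isFredholm_of_isUnit (hD.mul (isUnit_inv_one_sub hPP hr1)))
    (mem_UFred_iff.1 hU).2) (isFredholm_of_isUnit (hu.ringInverse.mul hD))

theorem mob_mem_UStar (hP : IsStarProjection P) (hU : U ∈ UStar K)
    (hr : r ∈ Set.Icc (0 : ℝ) 1) (hu1 : IsUnit (1 + (1 - P) * U)) : mob P U r ∈ UStar K :=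
  have hu := isUnit_one_add_smul hP hU.1 hu1 hr
  mem_UStar_iff.2 ⟨mob_mem_unitary hP hU.1 hr hu,
    isUnit_mob_add_one hP.isIdempotentElem.eq hr hu (mem_UStar_iff.1 hU).2⟩

/-- U + 1 differs from the invertible operator 2 by the finite rank operator U − 1. -/
theorem mem_UFred_of_finiteRange (hU : U ∈ unitary (K →L[ℂ] K))
    (hF : ((U - 1 : K →L[ℂ] K) : K →ₗ[ℂ] K).HasFiniteRange) : U ∈ UFred K := by
  refine mem_UFred_iff.2 ⟨hU, isFredholm_of_isUnit_add (F := -(U - 1)) ?_ ?_⟩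
  · have : U + 1 + -(U - 1) = algebraMap ℂ (K →L[ℂ] K) 2 := by
      rw [Algebra.algebraMap_eq_smul_one, two_smul]; abel
    rw [this]
    exact (IsUnit.mk0 (2 : ℂ) two_ne_zero).map _
  · exact hF.neg

/-- The finite rank of P matters only at r = 1, where the transform differs from the identity by an
operator with range in that of P. -/
theorem mob_mem_UFred (hP : IsStarProjection P) (hPf : (P : K →ₗ[ℂ] K).HasFiniteRange)
    (hU : U ∈ UFred K) (hr : r ∈ Set.Icc (0 : ℝ) 1) (hu1 : IsUnit (1 + (1 - P) * U)) :
    mob P U r ∈ UFred K := by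
  rcases hr.2.lt_or_eq with hr1 | rfl
  · exact mob_mem_UFred_of_lt hP hU hr.1 hr1
  · refine mem_UFred_of_finiteRange (mob_mem_unitary hP hU.1 hr (by simpa using hu1)) ?_
    have : mob P U 1 - 1 = P * (U * Ring.inverse (1 + (1 - P) * U) * P - 1) := by
      rw [mob_one]; noncomm_ring
    rw [this]
    exact hPf.comp_right _

theorem UStar_subset_UFred : UStar K ⊆ UFred K := fun _ h =>
  mem_UFred_iff.2 ⟨h.1, isFredholm_of_isUnit (mem_UStar_iff.1 h).2⟩

theorem one_mem_UStar : (1 : K →L[ℂ] K) ∈ UStar K := by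
  refine mem_UStar_iff.2 ⟨one_mem _, ?_⟩
  have : (1 + 1 : K →L[ℂ] K) = algebraMap ℂ (K →L[ℂ] K) 2 := by
    rw [Algebra.algebraMap_eq_smul_one, two_smul]
  rw [this]
  exact (IsUnit.mk0 (2 : ℂ) two_ne_zero).map _

theorem continuous_mob {X : Type*} [TopologicalSpace X] {U : X → K →L[ℂ] K} {r : X → ℝ}
    (P : K →L[ℂ] K) (hU : Continuous U) (hr : Continuous r)
    (hu : ∀ x, IsUnit (1 + (r x : ℂ) • ((1 - P) * U x))) :
    Continuous fun x => mob P (U x) (r x) := by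
  have hD : Continuous fun x => mobD P (r x) := by unfold mobD; fun_prop
  have hZ : Continuous fun x => Ring.inverse (1 + (r x : ℂ) • ((1 - P) * U x)) := by
    rw [continuous_iff_continuousAt]
    intro x
    obtain ⟨u, hx⟩ := hu x
    have h1 : ContinuousAt (fun x => 1 + (r x : ℂ) • ((1 - P) * U x)) x := by fun_prop
    have h2 := NormedRing.inverse_continuousAt u
    rw [hx] at h2
    exact ContinuousAt.comp (f := fun x => 1 + (r x : ℂ) • ((1 - P) * U x)) h2 h1
  unfold mob
  fun_prop

omit [CompleteSpace K] in
theorem mob_one_apply {x : K} (hx : P x = 0) : mob P U 1 x = x := by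
  rw [mob_one]; simp [hx]

theorem isUnit_one_add_of_mem_UStar (hU : U ∈ UStar K) :
    IsUnit (1 + (1 - (0 : K →L[ℂ] K)) * U) := by
  simpa [add_comm] using (mem_UStar_iff.1 hU).2

end Moebius

/-! ### Projections to finitely many vectors of a Hilbert basis -/

section BasisProjection

variable {K : Type*} [NormedAddCommGroup K] [InnerProductSpace ℂ K] {ι : Type*}

/-- The orthogonal projection onto the span of finitely many members of a Hilbert basis. -/
def bproj (b : HilbertBasis ι ℂ K) (S : Finset ι) : K →L[ℂ] K :=
  ∑ i ∈ S, (innerSL ℂ (b i)).smulRight (b i)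

variable (b : HilbertBasis ι ℂ K) (S : Finset ι)

theorem bproj_apply (x : K) : bproj b S x = ∑ i ∈ S, inner ℂ (b i) x • b i := by
  simp [bproj]

open Classical in
theorem inner_bproj (i : ι) (x : K) :
    inner ℂ (b i) (bproj b S x) = if i ∈ S then inner ℂ (b i) x else 0 := by
  rw [bproj_apply, inner_sum]
  simp only [inner_smul_right, orthonormal_iff_ite.1 b.orthonormal]
  simp

theorem bproj_of_mem {i : ι} (hi : i ∈ S) : bproj b S (b i) = b i := by
  classical
  rw [bproj_apply]
  simp only [orthonormal_iff_ite.1 b.orthonormal]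
  simp [hi]

theorem bproj_of_notMem {i : ι} (hi : i ∉ S) : bproj b S (b i) = 0 := by
  classical
  rw [bproj_apply]
  simp only [orthonormal_iff_ite.1 b.orthonormal]
  simp [hi]

theorem isStarProjection_bproj [CompleteSpace K] : IsStarProjection (bproj b S) := by
  constructor
  · ext x
    simp only [mul_apply_eq_comp]
    rw [bproj_apply b S x, map_sum]
    exact Finset.sum_congr rfl fun i hi => by rw [map_smul, bproj_of_mem b S hi]
  · rw [ContinuousLinearMap.isSelfAdjoint_iff_isSymmetric]
    intro x y
    simp only [ContinuousLinearMap.coe_coe, bproj_apply, sum_inner, inner_sum, inner_smul_left,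
      inner_smul_right, inner_conj_symm]
    exact Finset.sum_congr rfl fun i _ => mul_comm _ _

theorem hasFiniteRange_bproj : ((bproj b S : K →L[ℂ] K) : K →ₗ[ℂ] K).HasFiniteRange := by
  have h : (bproj b S).range ≤ Submodule.span ℂ (b '' S) := by
    rintro _ ⟨x, rfl⟩
    change bproj b S x ∈ _
    rw [bproj_apply]
    exact Submodule.sum_mem _ fun i hi => Submodule.smul_mem _ _
      (Submodule.subset_span ⟨i, hi, rfl⟩)
  have : FiniteDimensional ℂ (Submodule.span ℂ (b '' (S : Set ι))) :=
    FiniteDimensional.span_of_finite ℂ (S.finite_toSet.image _)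
  exact (Submodule.fg_iff_finiteDimensional _).2 (Submodule.finiteDimensional_of_le h)

theorem tendsto_bproj (x : K) : Filter.Tendsto (fun S => bproj b S x) Filter.atTop (𝓝 x) := by
  simp only [bproj_apply]
  simpa [HasSum, b.repr_apply_apply] using b.hasSum_repr x

end BasisProjection

/-! ### Compact families in UFred, and openness of UFred -/

section Away

variable {K : Type*} [NormedAddCommGroup K] [InnerProductSpace ℂ K] [CompleteSpace K] {ι : Type*}

/-- The space ker(U + 1) has a finite orthonormal basis f_k. If P_S x = 0 then ⟨f_k, x⟩ = ⟨f_k − P_S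
f_k, x⟩, and P_S f_k → f_k. -/
theorem eventually_norm_kerProj_le (b : HilbertBasis ι ℂ K) {U : K →L[ℂ] K} (hU : U ∈ UFred K)
    {η : ℝ} (hη : 0 < η) :
    ∀ᶠ S in Filter.atTop, ∀ x, bproj b S x = 0 → ‖kerProj U x‖ ≤ η * ‖x‖ := by
  have := (mem_UFred_iff.1 hU).2.finite_ker
  let f := stdOrthonormalBasis ℂ (U + 1).ker
  have h1 : ∀ x, ‖kerProj U x‖ ≤ ∑ k, ‖inner ℂ (f k : K) x‖ := by
    intro x
    have h2 := f.sum_repr ((U + 1).ker.orthogonalProjectionOnto x)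
    have h3 : kerProj U x = ∑ k, inner ℂ (f k : K) x • (f k : K) := by
      have := congrArg Subtype.val h2
      rw [kerProj, Submodule.starProjection_apply, ← this, Submodule.coe_sum]
      refine Finset.sum_congr rfl fun k _ => ?_
      rw [Submodule.coe_smul, f.repr_apply_apply, Submodule.coe_inner]
      congr 1
      exact ((U + 1).ker.inner_starProjection_left_eq_right _ x).symm.trans (by
        rw [Submodule.starProjection_eq_self_iff.2 (f k).2])
    rw [h3]
    refine (norm_sum_le _ _).trans (Finset.sum_le_sum fun k _ => ?_)
    rw [norm_smul, Submodule.norm_coe, f.norm_eq_one, mul_one]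
  have h4 : Filter.Tendsto (fun S => ∑ k, ‖(f k : K) - bproj b S (f k)‖) Filter.atTop (𝓝 0) := by
    have : (0 : ℝ) = ∑ k, ‖(f k : K) - f k‖ := by simp
    rw [this]
    exact tendsto_finsetSum _ fun k _ => (tendsto_const_nhds.sub (tendsto_bproj b _)).norm
  filter_upwards [h4.eventually (gt_mem_nhds hη)] with S hS x hx
  refine (h1 x).trans ?_
  calc ∑ k, ‖inner ℂ (f k : K) x‖ ≤ ∑ k, ‖(f k : K) - bproj b S (f k)‖ * ‖x‖ := by
        refine Finset.sum_le_sum fun k _ => ?_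
        have : inner ℂ (f k : K) x = inner ℂ ((f k : K) - bproj b S (f k)) x := by
          rw [inner_sub_left, starProj_inner (isStarProjection_bproj b S), hx, inner_zero_right,
            sub_zero]
        rw [this]
        exact norm_inner_le_norm _ _
    _ ≤ η * ‖x‖ := by
        rw [← Finset.sum_mul]
        gcongr

/-- Vectors killed by a large P_S are nearly orthogonal to ker(U + 1), where the lower bound for U +
1 holds. The bound is stable under small perturbations of U, with S independent of the perturbation,
as compactness arguments require. -/
theorem eventually_awayOn (b : HilbertBasis ι ℂ K) {U : K →L[ℂ] K} (hU : U ∈ UFred K) :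
    ∃ c : ℝ, 0 < c ∧ ∀ᶠ S in Filter.atTop, ∀ V : K →L[ℂ] K, ‖V - U‖ < c →
      AwayOn (bproj b S) V c := by
  obtain ⟨c, hc, h⟩ := exists_awayOn_kerProj hU
  -- Half of c is lost to the component of x in the kernel, of norm at most ‖x‖/2, and a quarter of
  -- c to ‖V − U‖.
  refine ⟨c / 4, by positivity, ?_⟩
  filter_upwards [eventually_norm_kerProj_le b hU (η := 1 / 2) (by norm_num)] with S hS V hV x hx
  set p := kerProj U with hp
  have h1 : (U + 1) x = (U + 1) (x - p x) := by
    have : U (p x) = -p x := congrArg (fun T : K →L[ℂ] K => T x) (mul_kerProj U)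
    simp [this]
  have h2 : c * ‖x - p x‖ ≤ ‖(U + 1) x‖ := by
    rw [h1]
    exact h _ (by rw [map_sub, starProj_idem (isStarProjection_kerProj U), sub_self])
  have h3 : ‖x‖ ≤ ‖x - p x‖ + ‖p x‖ := by simpa using norm_add_le (x - p x) (p x)
  have h4 := hS x hx
  have h5 : ‖(U + 1) x‖ ≤ ‖(V + 1) x‖ + ‖(V - U) x‖ := by
    have : (U + 1) x = (V + 1) x - (V - U) x := by simp; abel
    rw [this]; exact norm_sub_le _ _
  have h6 : ‖(V - U) x‖ ≤ c / 4 * ‖x‖ := (V - U).le_of_opNorm_le hV.le x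
  nlinarith [norm_nonneg x]

/-- On a compact family in `UFred K`, the Möbius transform to large finite-dimensional
subspaces is defined. -/
theorem eventually_isUnit_one_add (b : HilbertBasis ι ℂ K) {X : Type*} [TopologicalSpace X]
    [CompactSpace X] {U : X → K →L[ℂ] K} (hUc : Continuous U) (hU : ∀ x, U x ∈ UFred K) :
    ∀ᶠ S in Filter.atTop, ∀ x, IsUnit (1 + (1 - bproj b S) * U x) := by
  have key : ∀ᶠ S in Filter.atTop, ∀ x ∈ (Set.univ : Set X),
      IsUnit (1 + (1 - bproj b S) * U x) := by
    refine isCompact_univ.induction_on (p := fun s => ∀ᶠ S in Filter.atTop, ∀ x ∈ s,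
      IsUnit (1 + (1 - bproj b S) * U x)) ?_ ?_ ?_ ?_
    · simp
    · intro s t hst ht
      filter_upwards [ht] with S hS x hx using hS x (hst hx)
    · intro s t hs ht
      filter_upwards [hs, ht] with S h1 h2 x hx using hx.elim (h1 x) (h2 x)
    · intro x _
      obtain ⟨c, hc, h⟩ := eventually_awayOn b (hU x)
      refine ⟨{y | ‖U y - U x‖ < c}, mem_nhdsWithin_of_mem_nhds ?_, ?_⟩
      · have : ContinuousAt (fun y => ‖U y - U x‖) x := by fun_prop
        refine this.eventually_lt_const ?_
        simpa using hc
      · filter_upwards [h] with S hS y hy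
        exact isUnit_one_add_mul_of_awayOn (isStarProjection_bproj b S) (hU y).1 hc (hS _ hy)
  simpa using key

/-- V + 1 + p stays invertible for V near U and the fixed finite rank projection p = `kerProj U`. -/
theorem exists_ball_mem_UFred {U : K →L[ℂ] K} (hU : U ∈ UFred K) :
    ∃ δ : ℝ, 0 < δ ∧ ∀ V ∈ unitary (K →L[ℂ] K), ‖V - U‖ < δ → V ∈ UFred K := by
  have h := isUnit_add_kerProj hU
  have hopen : ∀ᶠ V in 𝓝 U, IsUnit (V + 1 + kerProj U) := by
    have hc : ContinuousAt (fun V : K →L[ℂ] K => V + 1 + kerProj U) U := by fun_prop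
    exact hc.eventually (Units.isOpen.mem_nhds h)
  obtain ⟨δ, hδ, hb⟩ := Metric.eventually_nhds_iff.1 hopen
  refine ⟨δ, hδ, fun V hV hd => mem_UFred_iff.2 ⟨hV, ?_⟩⟩
  exact isFredholm_of_isUnit_add (hb (by rwa [dist_eq_norm])) (hasFiniteRange_kerProj hU)

theorem smul_mem_unitary {U : K →L[ℂ] K} (hU : U ∈ unitary (K →L[ℂ] K)) {z : ℂ} (hz : ‖z‖ = 1) :
    z • U ∈ unitary (K →L[ℂ] K) := by
  have h : (starRingEnd ℂ) z * z = 1 := by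
    rw [mul_comm, Complex.mul_conj, Complex.normSq_eq_norm_sq, hz]; simp
  refine Unitary.mem_iff.2 ⟨?_, ?_⟩
  · rw [star_smul, smul_mul_smul_comm, (Unitary.mem_iff.1 hU).1]
    simp [h]
  · rw [star_smul, smul_mul_smul_comm, (Unitary.mem_iff.1 hU).2]
    simp [mul_comm z, h]

/-- If `-1` is not in the essential spectrum, then it is isolated in the spectrum. -/
theorem exists_smul_mem_UStar {U : K →L[ℂ] K} (hU : U ∈ UFred K) :
    ∃ δ : ℝ, 0 < δ ∧ ∀ z : ℂ, ‖z‖ = 1 → z ≠ 1 → ‖z - 1‖ < δ → z • U ∈ UStar K := by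
  have h := isUnit_add_kerProj hU
  set p := kerProj U with hp
  have hpp : p * p = p := (isStarProjection_kerProj U).isIdempotentElem.eq
  have hUp : U * p = -p := mul_kerProj U
  have hopen : ∀ᶠ w : ℂ in 𝓝 0, IsUnit (U + 1 + p + w • 1) := by
    have hc : ContinuousAt (fun w : ℂ => U + 1 + p + w • 1) 0 := by fun_prop
    exact hc.eventually (Units.isOpen.mem_nhds (by simpa using h))
  obtain ⟨δ, hδ, hb⟩ := Metric.eventually_nhds_iff.1 hopen
  refine ⟨δ, hδ, fun z hz hz1 hzd => mem_UStar_iff.2 ⟨smul_mem_unitary hU.1 hz, ?_⟩⟩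
  have hz0 : z ≠ 0 := by rintro rfl; simp at hz
  set w := z⁻¹ - 1 with hw
  have hw0 : w ≠ 0 := by
    rw [hw, sub_ne_zero]; exact fun h => hz1 (inv_eq_one.1 h)
  have hwn : ‖w‖ < δ := by
    have : w = -(z - 1) * z⁻¹ := by rw [hw]; field_simp; ring
    rw [this, norm_mul, norm_neg, norm_inv, hz]; simpa using hzd
  have hu1 : IsUnit (U + 1 + p + w • 1) := hb (by rwa [dist_zero_right])
  have hu2 := isUnit_add_smul_compl (P := 1 - p) (isStarProjection_kerProj U).one_sub.isIdempotentElem.eq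
    (mul_ne_zero hw0 hz0)
  -- Away from ker(U + 1) the operator zU + 1 = z(U + 1 + w) is invertible for small w; on the
  -- kernel it acts as the scalar 1 − z = wz. The two factors separate these effects.
  have e : z • U + 1 = z • ((U + 1 + p + w • 1) * (1 - p + (w * z) • (1 - (1 - p)))) := by
    have e1 : (U + 1 + p + w • 1) * (1 - p + (w * z) • (1 - (1 - p))) =
        U + p + (1 + w) • (1 - p) + (w * z * (1 + w)) • p := by
      simp only [sub_sub_cancel, mul_add, add_mul, mul_sub, Algebra.mul_smul_comm,
        Algebra.smul_mul_assoc, one_mul, mul_one, hpp, hUp]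
      module
    have hzw : z * (1 + w) = 1 := by rw [hw]; field_simp; ring
    have e2 : w * z * (1 + w) = w := by rw [mul_assoc, hzw, mul_one]
    rw [e1, e2]
    trans z • U + (z * (1 + w)) • (1 : K →L[ℂ] K)
    · rw [hzw, one_smul]
    · module
  rw [e]
  exact (hu1.mul hu2).smul (Units.mk0 z hz0)

end Away

/-! ### Nuclear representations, trace norm and trace -/

section TraceClass

variable {K : Type*} [NormedAddCommGroup K] [InnerProductSpace ℂ K]

/-- `T = ∑ ⟨yₙ, ·⟩ xₙ`. -/
def NuclearRep (T : K →L[ℂ] K) (x y : ℕ → K) : Prop :=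
  ∀ v, HasSum (fun n => inner ℂ (y n) v • x n) (T v)

variable {T : K →L[ℂ] K} {x y : ℕ → K}

theorem le_traceNorm {a : ℝ≥0∞}
    (h : ∀ x y, NuclearRep T x y → a ≤ ∑' n, ‖x n‖ₑ * ‖y n‖ₑ) : a ≤ traceNorm T :=
  le_iInf fun x => le_iInf fun y => le_iInf fun hT => h x y hT

theorem NuclearRep.traceNorm_le (h : NuclearRep T x y) :
    traceNorm T ≤ ∑' n, ‖x n‖ₑ * ‖y n‖ₑ :=
  iInf_le_of_le x (iInf_le_of_le y (iInf_le_of_le h le_rfl))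

theorem exists_nuclearRep (hT : IsTraceClass T) :
    ∃ x y, NuclearRep T x y ∧ ∑' n, ‖x n‖ₑ * ‖y n‖ₑ < ∞ := by
  simp only [IsTraceClass, traceNorm, iInf_lt_iff] at hT
  obtain ⟨x, y, h, hlt⟩ := hT
  exact ⟨x, y, h, hlt⟩

omit [InnerProductSpace ℂ K] in
theorem summable_of_tsum_enorm_lt (h : ∑' n, ‖x n‖ₑ * ‖y n‖ₑ < ∞) :
    Summable fun n => ‖x n‖ * ‖y n‖ := by
  have h1 : ∑' n, ‖(‖x n‖ * ‖y n‖ : ℝ)‖ₑ ≠ ∞ := by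
    simpa [enorm_mul] using h.ne
  exact Summable.of_enorm h1

theorem NuclearRep.enorm_apply_le (h : NuclearRep T x y) (v : K) :
    ‖T v‖ₑ ≤ (∑' n, ‖x n‖ₑ * ‖y n‖ₑ) * ‖v‖ₑ := by
  rw [← (h v).tsum_eq, ← ENNReal.tsum_mul_right]
  refine enorm_tsum_le_tsum_enorm.trans (ENNReal.tsum_le_tsum fun n => ?_)
  rw [enorm_smul, mul_comm, mul_assoc]
  gcongr
  rw [← ofReal_norm, ← ofReal_norm, ← ofReal_norm, ← ENNReal.ofReal_mul (norm_nonneg _)]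
  exact ENNReal.ofReal_le_ofReal (norm_inner_le_norm _ _)

theorem NuclearRep.norm_le (h : NuclearRep T x y) (hs : ∑' n, ‖x n‖ₑ * ‖y n‖ₑ < ∞) :
    ‖T‖ ≤ ∑' n, ‖x n‖ * ‖y n‖ := by
  have e : ∑' n, ‖x n‖ * ‖y n‖ = (∑' n, ‖x n‖ₑ * ‖y n‖ₑ).toReal := by
    rw [ENNReal.tsum_toReal_eq]
    · simp
    · intro n; exact (ENNReal.mul_lt_top enorm_lt_top enorm_lt_top).ne
  rw [e]
  refine T.opNorm_le_bound ENNReal.toReal_nonneg fun v => ?_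
  have := ENNReal.toReal_mono (ENNReal.mul_lt_top hs enorm_lt_top).ne (h.enorm_apply_le v)
  simpa [ENNReal.toReal_mul] using this

theorem enorm_le_traceNorm (T : K →L[ℂ] K) : ‖T‖ₑ ≤ traceNorm T := by
  refine le_traceNorm fun x y h => ?_
  by_cases hs : ∑' n, ‖x n‖ₑ * ‖y n‖ₑ < ∞
  · have h1 := h.norm_le hs
    have e : ∑' n, ‖x n‖ * ‖y n‖ = (∑' n, ‖x n‖ₑ * ‖y n‖ₑ).toReal := by
      rw [ENNReal.tsum_toReal_eq]
      · simp
      · intro n; exact (ENNReal.mul_lt_top enorm_lt_top enorm_lt_top).ne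
    rw [← ofReal_norm, ← ENNReal.ofReal_toReal hs.ne, ← e]
    exact ENNReal.ofReal_le_ofReal h1
  · rw [not_lt, top_le_iff] at hs
    rw [hs]; exact le_top

theorem traceNorm_smul_le (c : ℂ) (T : K →L[ℂ] K) : traceNorm (c • T) ≤ ‖c‖ₑ * traceNorm T := by
  rcases eq_or_ne c 0 with rfl | hc
  · have h : NuclearRep ((0 : ℂ) • T) (fun _ => (0 : K)) (fun _ => 0) := fun v => by
      simp
    exact h.traceNorm_le.trans (by simp)
  · have hc' : ‖c‖ₑ ≠ 0 := by simpa using hc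
    rw [← ENNReal.div_le_iff' hc' enorm_ne_top]
    refine le_traceNorm fun x y h => ?_
    rw [ENNReal.div_le_iff' hc' enorm_ne_top, ← ENNReal.tsum_mul_left]
    have h' : NuclearRep (c • T) (fun n => c • x n) y := fun v => by
      have := (h v).const_smul c
      simpa [smul_comm c] using this
    refine h'.traceNorm_le.trans (le_of_eq (tsum_congr fun n => ?_))
    rw [enorm_smul, mul_assoc]

theorem isTraceClass_of_eq_sum {m : ℕ} {f g : Fin m → K}
    (h : ∀ v, T v = ∑ k, inner ℂ (f k) v • g k) : IsTraceClass T := by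
  let x : ℕ → K := fun n => if hn : n < m then g ⟨n, hn⟩ else 0
  let y : ℕ → K := fun n => if hn : n < m then f ⟨n, hn⟩ else 0
  have hx : ∀ k : Fin m, x k = g k := fun k => by simp [x]
  have hy : ∀ k : Fin m, y k = f k := fun k => by simp [y]
  have hrep : NuclearRep T x y := fun v => by
    have := hasSum_sum_of_ne_finset_zero (f := fun n => inner ℂ (y n) v • x n)
      (s := Finset.range m) (L := SummationFilter.unconditional ℕ) fun n hn => by
        simp only [Finset.mem_range] at hn
        simp [x, hn]
    rw [Finset.sum_range] at this
    simpa [hx, hy, ← h] using this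
  refine hrep.traceNorm_le.trans_lt ?_
  rw [tsum_eq_sum (s := Finset.range m) fun n hn => by
    simp only [Finset.mem_range] at hn
    simp [x, hn]]
  exact ENNReal.sum_lt_top.2 fun n _ => ENNReal.mul_lt_top enorm_lt_top enorm_lt_top

variable {ι : Type*} (b : HilbertBasis ι ℂ K)

theorem sum_norm_inner_mul_le (S : Finset ι) (u v : K) :
    ∑ i ∈ S, ‖inner ℂ u (b i)‖ * ‖inner ℂ (b i) v‖ ≤ ‖u‖ * ‖v‖ := by
  have h1 := b.orthonormal.sum_inner_products_le u (s := S)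
  have h2 := b.orthonormal.sum_inner_products_le v (s := S)
  have h3 := Real.sum_mul_le_sqrt_mul_sqrt S (fun i => ‖inner ℂ u (b i)‖)
    (fun i => ‖inner ℂ (b i) v‖)
  refine h3.trans ?_
  gcongr
  · rw [← Real.sqrt_sq (norm_nonneg u)]
    refine Real.sqrt_le_sqrt ?_
    simpa [norm_inner_symm] using h1
  · rw [← Real.sqrt_sq (norm_nonneg v)]
    exact Real.sqrt_le_sqrt h2

theorem sum_enorm_inner_mul_le (S : Finset ι) (u v : K) :
    ∑ i ∈ S, ‖inner ℂ u (b i)‖ₑ * ‖inner ℂ (b i) v‖ₑ ≤ ‖u‖ₑ * ‖v‖ₑ := by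
  have := ENNReal.ofReal_le_ofReal (sum_norm_inner_mul_le b S u v)
  rw [ENNReal.ofReal_sum_of_nonneg fun i _ => by positivity,
    ENNReal.ofReal_mul (norm_nonneg _), ofReal_norm, ofReal_norm] at this
  simpa [ENNReal.ofReal_mul, ofReal_norm] using this

/-- Expand T in a nuclear representation; each rank one term is bounded by Cauchy–Schwarz and
Bessel, uniformly in S. -/
theorem sum_enorm_inner_le (A T : K →L[ℂ] K) (S : Finset ι) :
    ∑ i ∈ S, ‖inner ℂ (b i) (A (T (b i)))‖ₑ ≤ ‖A‖ₑ * traceNorm T := by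
  rcases eq_or_ne A 0 with rfl | hA
  · simp
  have hA' : ‖A‖ₑ ≠ 0 := by
    rw [← ofReal_norm]; exact (ENNReal.ofReal_pos.2 (norm_pos_iff.2 hA)).ne'
  rw [← ENNReal.div_le_iff' hA' enorm_ne_top]
  refine le_traceNorm fun x y h => ?_
  rw [ENNReal.div_le_iff' hA' enorm_ne_top, ← ENNReal.tsum_mul_left]
  have h1 : ∀ i, ‖inner ℂ (b i) (A (T (b i)))‖ₑ ≤
      ∑' n, ‖inner ℂ (y n) (b i)‖ₑ * ‖inner ℂ (b i) (A (x n))‖ₑ := fun i => by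
    have h2 : HasSum (fun n => inner ℂ (y n) (b i) * inner ℂ (b i) (A (x n)))
        (inner ℂ (b i) (A (T (b i)))) := by
      have := ((innerSL ℂ (b i)) ∘L A).hasSum (h (b i))
      simpa [inner_smul_right] using this
    rw [← h2.tsum_eq]
    refine enorm_tsum_le_tsum_enorm.trans (le_of_eq (tsum_congr fun n => enorm_mul _ _))
  refine (Finset.sum_le_sum fun i _ => h1 i).trans ?_
  rw [← Summable.tsum_finsetSum fun i _ => ENNReal.summable]
  refine ENNReal.tsum_le_tsum fun n => (sum_enorm_inner_mul_le b S _ _).trans ?_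
  have : ‖A (x n)‖ₑ ≤ ‖A‖ₑ * ‖x n‖ₑ := by
    rw [← ofReal_norm, ← ofReal_norm, ← ofReal_norm, ← ENNReal.ofReal_mul (norm_nonneg _)]
    exact ENNReal.ofReal_le_ofReal (A.le_opNorm _)
  calc ‖y n‖ₑ * ‖A (x n)‖ₑ ≤ ‖y n‖ₑ * (‖A‖ₑ * ‖x n‖ₑ) := by gcongr
    _ = _ := by ring

theorem sum_norm_inner_le (A : K →L[ℂ] K) (hT : IsTraceClass T) (S : Finset ι) :
    ∑ i ∈ S, ‖inner ℂ (b i) (A (T (b i)))‖ ≤ ‖A‖ * (traceNorm T).toReal := by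
  have := ENNReal.toReal_mono (ENNReal.mul_lt_top enorm_lt_top hT).ne (sum_enorm_inner_le b A T S)
  rw [ENNReal.toReal_sum fun i _ => enorm_ne_top, ENNReal.toReal_mul] at this
  simpa using this

theorem norm_sum_inner_le (A : K →L[ℂ] K) (hT : IsTraceClass T) (S : Finset ι) :
    ‖∑ i ∈ S, inner ℂ (b i) (A (T (b i)))‖ ≤ ‖A‖ * (traceNorm T).toReal :=
  (norm_sum_le _ _).trans (sum_norm_inner_le b A hT S)

/-- Without summability the `tsum` in `trace` would take the default value 0. -/
theorem summable_inner (A : K →L[ℂ] K) (hT : IsTraceClass T) :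
    Summable fun i => inner ℂ (b i) (A (T (b i))) :=
  .of_norm (summable_of_sum_le (fun _ => norm_nonneg _) fun S => sum_norm_inner_le b A hT S)

/-- Compress from one side at a time. The errors have nuclear representations with x_n or y_n
replaced by x_n − P_S x_n or y_n − P_S y_n, and dominated convergence with majorant ‖x_n‖ ‖y_n‖
applies. -/
theorem tendsto_bproj_mul [CompleteSpace K] (hT : IsTraceClass T) :
    Filter.Tendsto (fun S => ‖bproj b S * T * bproj b S - T‖) Filter.atTop (𝓝 0) := by
  obtain ⟨x, y, h, hlt⟩ := exists_nuclearRep hT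
  have hsum := summable_of_tsum_enorm_lt hlt
  have hP := fun S => isStarProjection_bproj b S
  have hle : ∀ S v, ‖v - bproj b S v‖ ≤ ‖v‖ := fun S v => by
    refine le_of_sq_le_sq ?_ (norm_nonneg _)
    rw [starProj_norm_sq (hP S) v]; nlinarith [sq_nonneg ‖bproj b S v‖]
  have hlt' : ∀ u v : ℕ → K, (∀ n, ‖u n‖ ≤ ‖x n‖) → (∀ n, ‖v n‖ ≤ ‖y n‖) →
      ∑' n, ‖u n‖ₑ * ‖v n‖ₑ < ∞ := fun u v hu hv => by
    refine (ENNReal.tsum_le_tsum fun n => ?_).trans_lt hlt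
    rw [← ofReal_norm, ← ofReal_norm, ← ofReal_norm, ← ofReal_norm]
    gcongr
    exacts [hu n, hv n]
  have hl : ∀ S, ‖bproj b S * T - T‖ ≤ ∑' n, ‖x n - bproj b S (x n)‖ * ‖y n‖ := fun S => by
    have hrep : NuclearRep (T - bproj b S * T) (fun n => x n - bproj b S (x n)) y := fun v => by
      have := (h v).sub ((bproj b S).hasSum (h v))
      simpa [smul_sub] using this
    rw [← norm_neg, neg_sub]
    exact hrep.norm_le (hlt' _ _ (fun n => hle S _) fun n => le_rfl)
  have hr : ∀ S, ‖T * bproj b S - T‖ ≤ ∑' n, ‖x n‖ * ‖y n - bproj b S (y n)‖ := fun S => by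
    have hrep : NuclearRep (T - T * bproj b S) x (fun n => y n - bproj b S (y n)) := fun v => by
      have := (h v).sub (h (bproj b S v))
      simpa [← sub_smul, inner_sub_left, starProj_inner (hP S)] using this
    rw [← norm_neg, neg_sub]
    exact hrep.norm_le (hlt' _ _ (fun n => le_rfl) fun n => hle S _)
  have t0 : ∀ v : K, Filter.Tendsto (fun S => ‖v - bproj b S v‖) Filter.atTop (𝓝 0) := fun v => by
    simpa using ((tendsto_const_nhds (x := v)).sub (tendsto_bproj b v)).norm
  have tl : Filter.Tendsto (fun S => ∑' n, ‖x n - bproj b S (x n)‖ * ‖y n‖) Filter.atTop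
      (𝓝 0) := by
    have := tendsto_tsum_of_dominated_convergence (𝓕 := Filter.atTop)
      (f := fun S n => ‖x n - bproj b S (x n)‖ * ‖y n‖) (g := fun _ => (0 : ℝ)) hsum
      (fun n => by simpa using (t0 (x n)).mul_const ‖y n‖)
      (.of_forall fun S n => by
        rw [Real.norm_of_nonneg (by positivity)]; gcongr; exact hle S _)
    simpa using this
  have tr : Filter.Tendsto (fun S => ∑' n, ‖x n‖ * ‖y n - bproj b S (y n)‖) Filter.atTop
      (𝓝 0) := by
    have := tendsto_tsum_of_dominated_convergence (𝓕 := Filter.atTop)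
      (f := fun S n => ‖x n‖ * ‖y n - bproj b S (y n)‖) (g := fun _ => (0 : ℝ)) hsum
      (fun n => by simpa using (t0 (y n)).const_mul ‖x n‖)
      (.of_forall fun S n => by
        rw [Real.norm_of_nonneg (by positivity)]; gcongr; exact hle S _)
    simpa using this
  refine squeeze_zero (fun _ => norm_nonneg _) (fun S => ?_) (by simpa using tr.add tl)
  have e : bproj b S * T * bproj b S - T =
      bproj b S * (T * bproj b S - T) + (bproj b S * T - T) := by noncomm_ring
  rw [e]
  refine (norm_add_le _ _).trans (add_le_add ((norm_mul_le _ _).trans ?_) (hl S))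
  calc _ ≤ 1 * ‖T * bproj b S - T‖ := by gcongr; exact norm_starProj_le (hP S)
    _ ≤ _ := by rw [one_mul]; exact hr S

end TraceClass

section TraceBasis

variable (K : Type*) [NormedAddCommGroup K] [InnerProductSpace ℂ K] [CompleteSpace K]

/-- The Hilbert basis used in the definition of the trace. -/
def traceBasis : HilbertBasis (exists_hilbertBasis ℂ K).choose ℂ K :=
  (exists_hilbertBasis ℂ K).choose_spec.choose

variable {K}

theorem tendsto_sum_trace (A : K →L[ℂ] K) {T : K →L[ℂ] K} (hT : IsTraceClass T) :
    Filter.Tendsto (fun S => ∑ i ∈ S, inner ℂ (traceBasis K i) (A (T (traceBasis K i))))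
      Filter.atTop (𝓝 (trace (A * T))) :=
  (summable_inner (traceBasis K) A hT).hasSum

end TraceBasis

/-! ### Increments of continuous logarithms -/

section ExpWinding

/-- `w` is the increment of a continuous logarithm of `f` along `[0, 1]`. -/
def LogIncrement (f : I → ℂ) (w : ℂ) : Prop :=
  ∃ L : C(I, ℂ), (∀ t, Complex.exp (L t) = f t) ∧ w = L 1 - L 0

/-- The values lie in the discrete set 2πiℤ. -/
theorem constant_of_exp_eq_one {X : Type*} [TopologicalSpace X] [PreconnectedSpace X] {f : X → ℂ}
    (hf : Continuous f) (h : ∀ x, Complex.exp (f x) = 1) (x y : X) : f x = f y := by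
  have hm : ∀ x, ∃ n : ℤ, (n : ℝ) = (f x / (2 * Real.pi * Complex.I)).re ∧
      f x = n * (2 * Real.pi * Complex.I) := fun x => by
    obtain ⟨n, hn⟩ := Complex.exp_eq_one_iff.1 (h x)
    refine ⟨n, ?_, hn⟩
    rw [hn, mul_div_cancel_right₀ _ Complex.two_pi_I_ne_zero]; simp
  choose n hn hn' using hm
  have hc : Continuous n := by
    have h1 : Continuous fun x => (n x : ℝ) := by
      simp only [hn]; fun_prop
    exact Int.isClosedEmbedding_coe_real.isEmbedding.continuous_iff.2 h1
  rw [hn' x, hn' y, (isPreconnected_univ (α := X)).constant hc.continuousOn trivial trivial]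

theorem LogIncrement.unique {f : I → ℂ} {w w' : ℂ} (h : LogIncrement f w) (h' : LogIncrement f w') :
    w = w' := by
  obtain ⟨L, hL, rfl⟩ := h
  obtain ⟨L', hL', rfl⟩ := h'
  have := constant_of_exp_eq_one (f := fun t => L t - L' t) (by fun_prop) (fun t => by
    have h0 : Complex.exp (L' t) ≠ 0 := Complex.exp_ne_zero _
    rw [Complex.exp_sub, hL, ← hL', div_self h0]) 0 1
  linear_combination -this

/-- Lift the homotopy through the covering exp. Since the curves are closed, the increment of the
lift takes values in 2πiℤ and so does not depend on the homotopy parameter. -/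
theorem LogIncrement.of_homotopy {D : I × I → ℂ} (hD : Continuous D) (h0 : ∀ x, D x ≠ 0)
    (hcl : ∀ s, D (s, 0) = D (s, 1)) {f g : I → ℂ} (hf : ∀ t, D (0, t) = f t)
    (hg : ∀ t, D (1, t) = g t) {w : ℂ} (h : LogIncrement f w) : LogIncrement g w := by
  obtain ⟨L, hL, rfl⟩ := h
  have cov := Complex.isCoveringMap_exp
  let H : C(I × I, {z : ℂ // z ≠ 0}) := ⟨fun x => ⟨D x, h0 x⟩, by fun_prop⟩
  have hH0 : ∀ a : I, H (0, a) = ⟨Complex.exp (L a), Complex.exp_ne_zero _⟩ := fun a =>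
    Subtype.ext (by simp [H, hL, hf])
  let G := cov.liftHomotopy H L hH0
  have hG : ∀ x, Complex.exp (G x) = D x := fun x =>
    congrArg Subtype.val (congrFun (cov.liftHomotopy_lifts H L hH0) x)
  have hG0 : ∀ t, G (0, t) = L t := cov.liftHomotopy_zero H L hH0
  refine ⟨⟨fun t => G (1, t), by fun_prop⟩, fun t => by simp [hG, hg], ?_⟩
  have := constant_of_exp_eq_one (f := fun s : I => G (s, 1) - G (s, 0)) (by fun_prop) (fun s => by
    rw [Complex.exp_sub, hG, hG, hcl, div_self (h0 _)]) 0 1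
  simp only [hG0] at this
  exact this

/-- Two nonvanishing closed curves that are close to each other have the same increment. -/
theorem logIncrement_of_hasDeriv {f f' : ℝ → ℂ} (hf : ∀ t ∈ Set.Icc (0 : ℝ) 1, f t ≠ 0)
    (hd : ∀ t ∈ Set.Icc (0 : ℝ) 1, HasDerivWithinAt f (f' t) (Set.Icc 0 1) t)
    (hc : ContinuousOn f' (Set.Icc 0 1)) :
    LogIncrement (fun t => f t) (∫ t in (0 : ℝ)..1, f' t / f t) := by
  have hfc : ContinuousOn f (Set.Icc 0 1) := fun t ht => (hd t ht).continuousWithinAt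
  have hq : ContinuousOn (fun t => f' t / f t) (Set.Icc 0 1) := hc.div hfc hf
  -- A continuous extension of f'/f to the whole line, so that its primitive A is differentiable
  -- everywhere, including the endpoints.
  let q : ℝ → ℂ := Set.IccExtend zero_le_one (fun t : I => f' t / f t)
  have hqc : Continuous q := by
    refine Continuous.Icc_extend' ?_
    exact continuousOn_iff_continuous_domRestrict.1 hq
  have hqe : ∀ t ∈ Set.Icc (0 : ℝ) 1, q t = f' t / f t := fun t ht =>
    Set.IccExtend_of_mem _ _ ht
  let A : ℝ → ℂ := fun t => ∫ s in (0 : ℝ)..t, q s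
  have hA : ∀ t, HasDerivAt A (q t) t := fun t => hqc.integral_hasStrictDerivAt 0 t |>.hasDerivAt
  have hA1 : A 1 = ∫ t in (0 : ℝ)..1, f' t / f t := by
    refine intervalIntegral.integral_congr fun t ht => hqe t ?_
    rwa [Set.uIcc_of_le zero_le_one] at ht
  -- The function f exp(−A) has derivative zero, so log f(0) + A is a logarithm of f.
  have hkd : ∀ t ∈ Set.Icc (0 : ℝ) 1,
      HasDerivWithinAt (fun t => f t * Complex.exp (-A t)) 0 (Set.Icc 0 1) t := fun t ht => by
    have h1 : HasDerivAt (fun t => Complex.exp (-A t)) (Complex.exp (-A t) * (-q t)) t :=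
      (hA t).neg.cexp
    refine ((hd t ht).mul h1.hasDerivWithinAt).congr_deriv ?_
    have := hf t ht
    rw [hqe t ht]
    field_simp
    ring
  have hk := constant_of_derivWithin_zero (f := fun t => f t * Complex.exp (-A t)) (a := 0) (b := 1)
    (fun t ht => (hkd t ht).differentiableWithinAt)
    (fun t ht => (hkd t (Set.Ico_subset_Icc_self ht)).derivWithin
        (uniqueDiffOn_Icc zero_lt_one t (Set.Ico_subset_Icc_self ht)))
  have hf0 := hf 0 (by simp)
  refine ⟨⟨fun t => Complex.log (f 0) + A t, ?_⟩, fun t => ?_, ?_⟩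
  · have : Continuous A := continuous_iff_continuousAt.2 fun t => (hA t).continuousAt
    fun_prop
  · have h1 := hk t t.2
    have hA0 : A 0 = 0 := by simp [A]
    simp only [hA0, neg_zero, Complex.exp_zero, mul_one, Complex.exp_neg] at h1
    simp only [ContinuousMap.coe_mk, Complex.exp_add, Complex.exp_log hf0]
    rw [← h1, mul_assoc, inv_mul_cancel₀ (Complex.exp_ne_zero _), mul_one]
  · simp [hA1]; simp [A]

end ExpWinding

/-! ### Jacobi's formula for the derivative of a determinant -/

section Det

variable {n : Type*} [Fintype n] [DecidableEq n]

/-- Differentiate the Leibniz expansion. The i-th summand is the determinant with column i replaced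
by its derivative, which Cramer's rule expresses through the adjugate. -/
theorem hasDerivWithinAt_det {M M' : ℝ → Matrix n n ℂ} {s : Set ℝ} {t : ℝ}
    (h : ∀ i j, HasDerivWithinAt (fun t => M t i j) (M' t i j) s t) :
    HasDerivWithinAt (fun t => (M t).det) (((M t).adjugate * M' t).trace) s t := by
  have h1 : HasDerivWithinAt (fun t => (M t).det)
      (∑ p : Equiv.Perm n, Equiv.Perm.sign p • ∑ i, (∏ j ∈ Finset.univ.erase i, M t (p j) j) •
        M' t (p i) i) s t := by
    simp only [Matrix.det_apply]
    refine HasDerivWithinAt.fun_sum fun p _ => ?_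
    have h2 := HasDerivWithinAt.finsetProd (u := Finset.univ) (f := fun i t => M t (p i) i)
      (f' := fun i => M' t (p i) i) fun i _ => h (p i) i
    have h3 := h2.const_smul (((Equiv.Perm.sign p : ℤ) : ℝ))
    convert h3 using 1
    · ext x
      simp [Units.smul_def, Finset.prod_apply]
    · simp [Units.smul_def]
  convert h1 using 1
  have h4 : ∀ i, ((M t).updateCol i fun k => M' t k i).det =
      ∑ p : Equiv.Perm n, Equiv.Perm.sign p • ((∏ j ∈ Finset.univ.erase i, M t (p j) j) •
        M' t (p i) i) := fun i => by
    rw [Matrix.det_apply]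
    refine Finset.sum_congr rfl fun p _ => ?_
    rw [← Finset.prod_erase_mul _ _ (Finset.mem_univ i), Matrix.updateCol_self, smul_eq_mul]
    congr 2
    refine Finset.prod_congr rfl fun j hj => ?_
    rw [Matrix.updateCol_ne (Finset.ne_of_mem_erase hj)]
  simp only [Finset.smul_sum]
  rw [Finset.sum_comm, Matrix.trace]
  refine Finset.sum_congr rfl fun i _ => ?_
  rw [← h4, ← Matrix.cramer_apply, Matrix.cramer_eq_adjugate_mulVec]
  rfl

theorem trace_adjugate_mul_div {M N : Matrix n n ℂ} {M' : Matrix n n ℂ} (h : N * M = 1) :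
    (M.adjugate * M').trace / M.det = (N * M').trace := by
  have hd : M.det ≠ 0 := fun h0 => by
    have := congrArg Matrix.det h
    simp [h0] at this
  have hN : M.adjugate = M.det • N := by
    calc M.adjugate = N * M * M.adjugate := by rw [h, one_mul]
      _ = _ := by rw [mul_assoc, Matrix.mul_adjugate]; simp
  rw [hN, Matrix.smul_mul, Matrix.trace_smul, smul_eq_mul, mul_div_cancel_left₀ _ hd]

end Det

/-! ### Finite compressions, their determinants, and comparison with the Möbius transform -/

section Compression

/-- The compression of `A` to the range of the projection `P`, extended by the identity. -/
def compr {R : Type*} [Ring R] (P A : R) : R := (1 - P) + P * A * P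

theorem mul_compr {R : Type*} [Ring R] {P : R} (hPP : P * P = P) (A : R) :
    P * compr P A = compr P A * P := by
  simp only [compr, mul_add, add_mul, mul_sub, sub_mul, mul_one, one_mul, hPP, sub_self, mul_assoc]
  simp only [← mul_assoc, hPP]

theorem compl_mul_compr {R : Type*} [Ring R] {P : R} (hPP : P * P = P) (A : R) :
    (1 - P) * compr P A = 1 - P := by
  have h : (1 - P) * P = 0 := by rw [sub_mul, hPP, one_mul, sub_self]
  have h2 : (1 - P) * (1 - P) = 1 - P := by rw [mul_sub, h, mul_one, sub_zero]
  rw [compr, mul_add, ← mul_assoc, ← mul_assoc, h, h2]; simp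

variable {K : Type*} [NormedAddCommGroup K] [InnerProductSpace ℂ K] {ι : Type*}
  (b : HilbertBasis ι ℂ K) (S : Finset ι)

/-- The matrix of the compression of `A` to the span of the `b i`, `i ∈ S`. -/
def cmat (A : K →L[ℂ] K) : Matrix S S ℂ := Matrix.of fun i j => inner ℂ (b i) (A (b j))

theorem inner_bproj_of_mem {i : ι} (hi : i ∈ S) (x : K) :
    inner ℂ (b i) (bproj b S x) = inner ℂ (b i) x := by
  classical rw [inner_bproj, if_pos hi]

theorem cmat_mul (A B : K →L[ℂ] K) : cmat b S A * cmat b S B = cmat b S (A * bproj b S * B) := by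
  ext i k
  simp only [cmat, Matrix.mul_apply, Matrix.of_apply, mul_apply_eq_comp, bproj_apply, map_sum,
    map_smul, inner_sum, inner_smul_right]
  rw [← Finset.sum_coe_sort S]
  exact Finset.sum_congr rfl fun j _ => mul_comm _ _

theorem cmat_bproj_mul (A : K →L[ℂ] K) : cmat b S (bproj b S * A) = cmat b S A := by
  ext i j
  exact inner_bproj_of_mem b S i.2 _

theorem cmat_mul_bproj (A : K →L[ℂ] K) : cmat b S (A * bproj b S) = cmat b S A := by
  ext i j
  change inner ℂ (b i) (A (bproj b S (b j))) = _
  rw [bproj_of_mem b S j.2]; rfl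

theorem cmat_one [DecidableEq ι] : cmat b S 1 = 1 := by
  ext i j
  change inner ℂ (b i) (b j) = _
  rw [orthonormal_iff_ite.1 b.orthonormal, Matrix.one_apply]
  simp only [Subtype.ext_iff]

theorem cmat_compr [CompleteSpace K] (A : K →L[ℂ] K) :
    cmat b S (compr (bproj b S) A) = cmat b S A := by
  have hPP := (isStarProjection_bproj b S).isIdempotentElem.eq
  rw [← cmat_bproj_mul, ← cmat_mul_bproj, compr, mul_add, add_mul, mul_sub, hPP]
  have h : bproj b S * (bproj b S * A * bproj b S) * bproj b S = bproj b S * A * bproj b S := by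
    rw [← mul_assoc, ← mul_assoc, hPP, mul_assoc (bproj b S * A), hPP]
  rw [h, mul_one, sub_self, zero_mul, zero_add, cmat_mul_bproj, cmat_bproj_mul]

theorem commute_inverse_compr {R : Type*} [Ring R] {P A : R} (hPP : P * P = P)
    (h : IsUnit (compr P A)) : P * Ring.inverse (compr P A) = Ring.inverse (compr P A) * P := by
  have h1 := mul_compr hPP A
  calc P * Ring.inverse (compr P A)
      = Ring.inverse (compr P A) * (compr P A * P) * Ring.inverse (compr P A) := by
        rw [← mul_assoc, Ring.inverse_mul_cancel _ h, one_mul]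
    _ = _ := by rw [← h1, mul_assoc, mul_assoc, Ring.mul_inverse_cancel _ h, mul_one]

/-- The extended compression commutes with the projection, and on such operators taking matrices is
multiplicative. -/
theorem cmat_inverse_mul [CompleteSpace K] [DecidableEq ι] {A : K →L[ℂ] K}
    (h : IsUnit (compr (bproj b S) A)) :
    cmat b S (Ring.inverse (compr (bproj b S) A)) * cmat b S A = 1 := by
  have hPP := (isStarProjection_bproj b S).isIdempotentElem.eq
  rw [← cmat_compr b S A, cmat_mul, mul_assoc, mul_compr hPP, ← mul_assoc,
    Ring.inverse_mul_cancel _ h, one_mul, ← mul_one (bproj b S), cmat_bproj_mul, cmat_one]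

theorem det_cmat_ne_zero [CompleteSpace K] [DecidableEq ι] {A : K →L[ℂ] K}
    (h : IsUnit (compr (bproj b S) A)) : (cmat b S A).det ≠ 0 := fun h0 => by
  have := congrArg Matrix.det (cmat_inverse_mul b S h)
  simp [h0] at this

theorem trace_cmat_inverse_mul [CompleteSpace K] {A B : K →L[ℂ] K}
    (h : IsUnit (compr (bproj b S) A)) :
    (cmat b S (Ring.inverse (compr (bproj b S) A)) * cmat b S B).trace =
      ∑ i ∈ S, inner ℂ (b i) (Ring.inverse (compr (bproj b S) A) (B (b i))) := by
  have hPP := (isStarProjection_bproj b S).isIdempotentElem.eq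
  rw [cmat_mul, ← commute_inverse_compr hPP h, mul_assoc, cmat_bproj_mul, ← Finset.sum_coe_sort S]
  rfl

variable [CompleteSpace K]

/-- Write X = g(1 − g*(g − X)) and use the Neumann series. -/
theorem isUnit_of_norm_sub_lt {g X : K →L[ℂ] K} (hg : g ∈ unitary (K →L[ℂ] K))
    (h : ‖g - X‖ < 1) : IsUnit X := by
  have h1 : ‖star g * (g - X)‖ < 1 := by
    refine (norm_mul_le _ _).trans_lt ?_
    have := norm_unitary_le (Unitary.star_mem hg)
    calc _ ≤ 1 * ‖g - X‖ := by gcongr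
      _ < 1 := by simpa
  have e : X = g * (1 - star g * (g - X)) := by
    rw [mul_sub, ← mul_assoc, (Unitary.mem_iff.1 hg).2]; noncomm_ring
  rw [e]
  exact (Unitary.isUnit_coe (U := ⟨g, hg⟩)).mul (isUnit_one_sub_of_norm_lt_one h1)

/-- From X⁻¹ − g* = X⁻¹(g − X)g* one gets ‖X⁻¹‖ ≤ 1 + ‖X⁻¹‖/4, hence ‖X⁻¹‖ ≤ 2; inserting this again
gives the second estimate. -/
theorem norm_inverse_sub_star_le {g X : K →L[ℂ] K} (hg : g ∈ unitary (K →L[ℂ] K))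
    (h : ‖g - X‖ ≤ 1 / 4) :
    ‖Ring.inverse X‖ ≤ 2 ∧ ‖Ring.inverse X - star g‖ ≤ 2 * ‖g - X‖ := by
  have hX : IsUnit X := isUnit_of_norm_sub_lt hg (by linarith)
  have e : Ring.inverse X - star g = Ring.inverse X * (g - X) * star g := by
    rw [mul_sub, sub_mul, Ring.inverse_mul_cancel _ hX, mul_assoc, (Unitary.mem_iff.1 hg).2]; simp
  have hs := norm_unitary_le (Unitary.star_mem hg)
  have h1 : ‖Ring.inverse X - star g‖ ≤ ‖Ring.inverse X‖ * ‖g - X‖ := by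
    rw [e]
    calc _ ≤ ‖Ring.inverse X‖ * ‖g - X‖ * ‖star g‖ :=
          (norm_mul_le _ _).trans (by gcongr; exact norm_mul_le _ _)
      _ ≤ ‖Ring.inverse X‖ * ‖g - X‖ * 1 := by gcongr
      _ = _ := mul_one _
  have h2 : ‖Ring.inverse X‖ ≤ ‖Ring.inverse X - star g‖ + ‖star g‖ := by
    simpa using norm_add_le (Ring.inverse X - star g) (star g)
  have h3 : ‖Ring.inverse X‖ ≤ 2 := by
    have := norm_nonneg (Ring.inverse X)
    nlinarith
  exact ⟨h3, h1.trans (by gcongr)⟩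

/-- Let X be the extended compression, Q = 1 − P and Z = (1 + Qg)⁻¹. As QX = Q, the transform minus
X equals −PgZQ(g − X)P, so it is enough to have ‖Z‖ ≤ 2. This follows from 1 + Qg = (1 + Q) + Q(g −
X), where 1 + Q does not decrease norms and the last term has norm at most 1/4. -/
theorem norm_mob_sub_compr_le {P g : K →L[ℂ] K} (hP : IsStarProjection P)
    (hg : g ∈ unitary (K →L[ℂ] K)) (hu : IsUnit (1 + (1 - P) * g))
    (h : ‖g - compr P g‖ ≤ 1 / 4) : ‖mob P g 1 - compr P g‖ ≤ 2 * ‖g - compr P g‖ := by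
  have hPP := hP.isIdempotentElem.eq
  set X := compr P g with hX
  set Z := Ring.inverse (1 + (1 - P) * g) with hZ
  have hQX : (1 - P) * X = 1 - P := compl_mul_compr hPP g
  have hPn := norm_starProj_le hP
  have hQn := norm_starProj_le hP.one_sub
  have hgn := norm_unitary_le hg
  have hZ1 : (1 + (1 - P) * g) * Z = 1 := Ring.mul_inverse_cancel _ hu
  have hZn : ‖Z‖ ≤ 2 := by
    have hre : ∀ w, 0 ≤ RCLike.re (inner ℂ ((1 - P) w) w) := fun w => by
      change 0 ≤ (inner ℂ ((1 - P) w) w).re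
      rw [re_inner_starProj hP.one_sub]; positivity
    refine Z.opNorm_le_bound (by norm_num) fun w => ?_
    have e1 : w = Z w + (1 - P) (Z w) + (1 - P) ((g - X) (Z w)) := by
      have e2 : (1 + (1 - P) * g) = 1 + (1 - P) + (1 - P) * (g - X) := by
        rw [mul_sub, hQX]; noncomm_ring
      have := congrArg (fun T : K →L[ℂ] K => T w) hZ1
      rw [e2] at this
      exact this.symm
    have e3 : ‖Z w‖ ≤ ‖Z w + (1 - P) (Z w)‖ := by
      refine le_of_sq_le_sq ?_ (norm_nonneg _)
      rw [@norm_add_sq ℂ, ← inner_conj_symm, RCLike.conj_re]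
      nlinarith [hre (Z w), sq_nonneg ‖(1 - P) (Z w)‖]
    have e4 : ‖(1 - P) ((g - X) (Z w))‖ ≤ 1 / 4 * ‖Z w‖ := by
      calc _ ≤ ‖1 - P‖ * (‖g - X‖ * ‖Z w‖) :=
            ((1 - P).le_opNorm _).trans (by gcongr; exact (g - X).le_opNorm _)
        _ ≤ 1 * (1 / 4 * ‖Z w‖) := by gcongr
        _ = _ := one_mul _
    have e5 : ‖Z w + (1 - P) (Z w)‖ ≤ ‖w‖ + ‖(1 - P) ((g - X) (Z w))‖ := by
      rw [eq_sub_of_add_eq e1.symm]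
      exact norm_sub_le _ _
    nlinarith [norm_nonneg (Z w), norm_nonneg w]
  have e : mob P g 1 - X = -(P * g * (Z * ((1 - P) * ((g - X) * P)))) := by
    have e1 : (1 + (1 - P) * g) * P = P + (1 - P) * ((g - X) * P) := by
      have : (1 - P) * (X * P) = 0 := by
        rw [← mul_assoc, hQX, sub_mul, hPP, one_mul, sub_self]
      rw [sub_mul g X P, mul_sub, this]; noncomm_ring
    have e2 : P - Z * P = Z * ((1 - P) * ((g - X) * P)) := by
      have : Z * ((1 + (1 - P) * g) * P) = P := by
        rw [← mul_assoc, Ring.inverse_mul_cancel _ hu, one_mul]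
      rw [e1, mul_add] at this
      rw [eq_sub_of_add_eq' this]
    rw [← e2, mob_one, hX, compr, ← hZ]; noncomm_ring
  rw [e, norm_neg]
  calc ‖P * g * (Z * ((1 - P) * ((g - X) * P)))‖
      ≤ ‖P‖ * ‖g‖ * (‖Z‖ * (‖1 - P‖ * (‖g - X‖ * ‖P‖))) := by
        refine (norm_mul_le _ _).trans ?_
        gcongr
        · exact norm_mul_le _ _
        refine (norm_mul_le _ _).trans ?_
        gcongr
        refine (norm_mul_le _ _).trans ?_
        gcongr
        exact norm_mul_le _ _
    _ ≤ 1 * 1 * (2 * (1 * (‖g - X‖ * 1))) := by gcongr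
    _ = _ := by ring

end Compression

/-! ### C¹ loops in the trace norm -/

section TraceLoop

variable {K : Type*} [NormedAddCommGroup K] [InnerProductSpace ℂ K]

/-- Interleave nuclear representations of the two operators at even and odd indices. -/
theorem traceNorm_add_le (T T' : K →L[ℂ] K) : traceNorm (T + T') ≤ traceNorm T + traceNorm T' := by
  by_cases hT : traceNorm T < ∞
  swap
  · rw [not_lt, top_le_iff] at hT; simp [hT]
  by_cases hT' : traceNorm T' < ∞
  swap
  · rw [not_lt, top_le_iff] at hT'; simp [hT']
  rw [← tsub_le_iff_right]
  refine le_traceNorm fun x y h => ?_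
  rw [tsub_le_iff_left, ← tsub_le_iff_right]
  refine le_traceNorm fun x' y' h' => ?_
  rw [tsub_le_iff_left]
  let z : ℕ → K := fun n => if Even n then x (n / 2) else x' (n / 2)
  let w : ℕ → K := fun n => if Even n then y (n / 2) else y' (n / 2)
  have z0 : ∀ n, z (2 * n) = x n := fun n => by simp [z]
  have z1 : ∀ n, z (2 * n + 1) = x' n := fun n => by
    have : (2 * n + 1) / 2 = n := by omega
    simp [z, this]
  have w0 : ∀ n, w (2 * n) = y n := fun n => by simp [w]
  have w1 : ∀ n, w (2 * n + 1) = y' n := fun n => by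
    have : (2 * n + 1) / 2 = n := by omega
    simp [w, this]
  have hrep : NuclearRep (T + T') z w := fun v => by
    refine HasSum.even_add_odd (m := T v) (m' := T' v) ?_ ?_
    · simpa only [z0, w0] using h v
    · simpa only [z1, w1] using h' v
  refine hrep.traceNorm_le.trans (le_of_eq ?_)
  rw [← tsum_even_add_odd ENNReal.summable ENNReal.summable]
  simp only [z0, z1, w0, w1]

theorem IsTraceClass.add {T T' : K →L[ℂ] K} (h : IsTraceClass T) (h' : IsTraceClass T') :
    IsTraceClass (T + T') :=
  (traceNorm_add_le T T').trans_lt (ENNReal.add_lt_top.2 ⟨h, h'⟩)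

theorem IsTraceClass.smul {T : K →L[ℂ] K} (h : IsTraceClass T) (c : ℂ) : IsTraceClass (c • T) :=
  (traceNorm_smul_le c T).trans_lt (ENNReal.mul_lt_top enorm_lt_top h)

theorem IsTraceClass.sub {T T' : K →L[ℂ] K} (h : IsTraceClass T) (h' : IsTraceClass T') :
    IsTraceClass (T - T') := by
  have := h.add (h'.smul (-1))
  rwa [neg_one_smul, ← sub_eq_add_neg] at this

theorem norm_le_toReal_traceNorm {T : K →L[ℂ] K} (hT : IsTraceClass T) :
    ‖T‖ ≤ (traceNorm T).toReal := by
  have := ENNReal.toReal_mono hT.ne (enorm_le_traceNorm T)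
  simpa using this

variable [CompleteSpace K] {g g' : ℝ → K →L[ℂ] K}

theorem nhdsWithin_Icc_diff_neBot {t : ℝ} (ht : t ∈ Set.Icc (0 : ℝ) 1) :
    (𝓝[Set.Icc 0 1 \ {t}] t).NeBot := by
  rw [← accPt_principal_iff_nhdsWithin]
  exact (uniqueDiffOn_Icc (zero_lt_one' ℝ) t ht).accPt

/-- Some difference quotient is at finite trace norm distance from the derivative, and difference
quotients are trace class. -/
theorem IsC1TraceLoop.isTraceClass_deriv (h : IsC1TraceLoop g g') {t : ℝ}
    (ht : t ∈ Set.Icc (0 : ℝ) 1) : IsTraceClass (g' t) := by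
  have hne := nhdsWithin_Icc_diff_neBot ht
  obtain ⟨s, hs, hs1⟩ := (((h.hasDeriv t ht).eventually_lt_const (u := ∞) (by simp)).and
    self_mem_nhdsWithin).exists
  have h1 : IsTraceClass (((s - t)⁻¹ : ℂ) • (g s - g t)) := by
    have := ((h.traceClass s hs1.1).sub (h.traceClass t ht)).smul ((s - t)⁻¹ : ℂ)
    simpa using this
  have := h1.sub (T' := ((s - t)⁻¹ : ℂ) • (g s - g t) - g' t) hs
  simpa using this

omit [CompleteSpace K] in
theorem tendsto_norm_of_traceNorm {α : Type*} {l : Filter α} {T : α → K →L[ℂ] K}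
    (h : Filter.Tendsto (fun x => traceNorm (T x)) l (𝓝 0)) : Filter.Tendsto T l (𝓝 0) := by
  rw [tendsto_zero_iff_norm_tendsto_zero]
  have h1 : Filter.Tendsto (fun x => (traceNorm (T x)).toReal) l (𝓝 0) := by
    simpa [Function.comp_def] using (ENNReal.tendsto_toReal ENNReal.zero_ne_top).comp h
  refine squeeze_zero' (.of_forall fun _ => norm_nonneg _) ?_ h1
  filter_upwards [h.eventually_lt_const (u := ∞) (by simp)] with x hx
  exact norm_le_toReal_traceNorm hx

theorem IsC1TraceLoop.hasDerivWithinAt (h : IsC1TraceLoop g g') {t : ℝ}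
    (ht : t ∈ Set.Icc (0 : ℝ) 1) : HasDerivWithinAt g (g' t) (Set.Icc 0 1) t := by
  rw [hasDerivWithinAt_iff_tendsto_slope]
  have h1 := (tendsto_norm_of_traceNorm (h.hasDeriv t ht)).add_const (g' t)
  simp only [sub_add_cancel, zero_add] at h1
  refine h1.congr fun s => ?_
  rw [slope_def_module, ← Complex.ofReal_sub, ← Complex.ofReal_inv, Complex.coe_smul]

theorem IsC1TraceLoop.continuousOn (h : IsC1TraceLoop g g') : ContinuousOn g (Set.Icc 0 1) :=
  fun _ ht => (h.hasDerivWithinAt ht).continuousWithinAt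

theorem IsC1TraceLoop.continuousOn_deriv (h : IsC1TraceLoop g g') :
    ContinuousOn g' (Set.Icc 0 1) := fun t ht => by
  have h1 := (tendsto_norm_of_traceNorm (h.contDeriv t ht)).add_const (g' t)
  simpa [ContinuousWithinAt] using h1

/-- At a single t this is `tendsto_bproj_mul` for g(t) − 1. The error changes by at most twice the
change of g, so compactness of [0, 1] makes the estimate uniform. -/
theorem IsC1TraceLoop.eventually_norm_sub_compr (h : IsC1TraceLoop g g') {ι : Type*}
    (b : HilbertBasis ι ℂ K) {δ : ℝ} (hδ : 0 < δ) :
    ∀ᶠ S in Filter.atTop, ∀ t ∈ Set.Icc (0 : ℝ) 1, ‖g t - compr (bproj b S) (g t)‖ < δ := by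
  have hn := fun S => norm_starProj_le (isStarProjection_bproj b S)
  refine isCompact_Icc.induction_on (p := fun s => ∀ᶠ S in Filter.atTop, ∀ t ∈ s,
      ‖g t - compr (bproj b S) (g t)‖ < δ) ?_ ?_ ?_ ?_
  · simp
  · intro s t hst ht
    filter_upwards [ht] with S hS x hx using hS x (hst hx)
  · intro s t hs ht
    filter_upwards [hs, ht] with S h1 h2 x hx using hx.elim (h1 x) (h2 x)
  intro t ht
  refine ⟨{s | ‖g s - g t‖ < δ / 4}, ?_, ?_⟩
  · have : ContinuousWithinAt (fun s => ‖g s - g t‖) (Set.Icc 0 1) t :=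
      ((h.continuousOn t ht).sub continuousWithinAt_const).norm
    refine this.eventually_lt_const ?_
    simp; linarith
  · filter_upwards [(tendsto_bproj_mul b (h.traceClass t ht)).eventually_lt_const
      (u := δ / 4) (by linarith)] with S hS s hs
    have hPP := (isStarProjection_bproj b S).isIdempotentElem.eq
    have e : g s - compr (bproj b S) (g s) = (g s - g t) -
        (bproj b S * (g t - 1) * bproj b S - (g t - 1)) - bproj b S * (g s - g t) * bproj b S := by
      simp only [compr, mul_sub, sub_mul, mul_one, hPP]; abel
    have h3 : ‖bproj b S * (g s - g t) * bproj b S‖ ≤ ‖g s - g t‖ := by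
      calc _ ≤ ‖bproj b S‖ * ‖g s - g t‖ * ‖bproj b S‖ :=
            (norm_mul_le _ _).trans (by gcongr; exact norm_mul_le _ _)
        _ ≤ 1 * ‖g s - g t‖ * 1 := by gcongr <;> exact hn S
        _ = _ := by ring
    rw [e]
    have h4 := norm_sub_le (g s - g t - (bproj b S * (g t - 1) * bproj b S - (g t - 1)))
      (bproj b S * (g s - g t) * bproj b S)
    have h5 := norm_sub_le (g s - g t) (bproj b S * (g t - 1) * bproj b S - (g t - 1))
    have hs' : ‖g s - g t‖ < δ / 4 := hs
    linarith

theorem norm_trace_sub_le {A B T T' : K →L[ℂ] K} (hT : IsTraceClass T) (hT' : IsTraceClass T') :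
    ‖trace (A * T) - trace (B * T')‖ ≤
      ‖A‖ * (traceNorm (T - T')).toReal + ‖A - B‖ * (traceNorm T').toReal := by
  refine le_of_tendsto ((tendsto_sum_trace A hT).sub (tendsto_sum_trace B hT')).norm
    (.of_forall fun S => ?_)
  have e : ∑ i ∈ S, inner ℂ (traceBasis K i) (A (T (traceBasis K i))) -
      ∑ i ∈ S, inner ℂ (traceBasis K i) (B (T' (traceBasis K i))) =
      ∑ i ∈ S, inner ℂ (traceBasis K i) (A ((T - T') (traceBasis K i))) +
      ∑ i ∈ S, inner ℂ (traceBasis K i) ((A - B) (T' (traceBasis K i))) := by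
    rw [← Finset.sum_sub_distrib, ← Finset.sum_add_distrib]
    refine Finset.sum_congr rfl fun i _ => ?_
    simp only [sub_apply, map_sub, inner_sub_right]; ring
  rw [e]
  exact (norm_add_le _ _).trans (add_le_add (norm_sum_inner_le _ _ (hT.sub hT') S)
    (norm_sum_inner_le _ _ hT' S))

theorem IsC1TraceLoop.tendsto_toReal (h : IsC1TraceLoop g g') {t : ℝ}
    (ht : t ∈ Set.Icc (0 : ℝ) 1) :
    Filter.Tendsto (fun s => (traceNorm (g' s - g' t)).toReal) (𝓝[Set.Icc 0 1] t) (𝓝 0) := by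
  simpa [Function.comp_def] using (ENNReal.tendsto_toReal ENNReal.zero_ne_top).comp (h.contDeriv t ht)

theorem IsC1TraceLoop.tendsto_bound (h : IsC1TraceLoop g g') {t : ℝ}
    (ht : t ∈ Set.Icc (0 : ℝ) 1) :
    Filter.Tendsto (fun s => (traceNorm (g' s - g' t)).toReal +
      ‖g s - g t‖ * (traceNorm (g' t)).toReal) (𝓝[Set.Icc 0 1] t) (𝓝 0) := by
  have h2 : Filter.Tendsto (fun s => ‖g s - g t‖) (𝓝[Set.Icc 0 1] t) (𝓝 0) := by
    have := ((h.continuousOn t ht).sub (continuousWithinAt_const (b := g t))).norm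
    simpa [ContinuousWithinAt] using this
  simpa using (h.tendsto_toReal ht).add (h2.mul_const (traceNorm (g' t)).toReal)

theorem IsC1TraceLoop.norm_trace_sub_le (h : IsC1TraceLoop g g') {s t : ℝ}
    (hs : s ∈ Set.Icc (0 : ℝ) 1) (ht : t ∈ Set.Icc (0 : ℝ) 1) :
    ‖trace (star (g s) * g' s) - trace (star (g t) * g' t)‖ ≤
      (traceNorm (g' s - g' t)).toReal + ‖g s - g t‖ * (traceNorm (g' t)).toReal := by
  refine (Maslov.norm_trace_sub_le (h.isTraceClass_deriv hs) (h.isTraceClass_deriv ht)).trans ?_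
  rw [← star_sub, norm_star, norm_star]
  gcongr
  exact mul_le_of_le_one_left ENNReal.toReal_nonneg (norm_unitary_le (h.unitary s hs))

theorem IsC1TraceLoop.continuousOn_trace (h : IsC1TraceLoop g g') :
    ContinuousOn (fun t => trace (star (g t) * g' t)) (Set.Icc 0 1) := fun t ht => by
  rw [ContinuousWithinAt, tendsto_iff_norm_sub_tendsto_zero]
  refine squeeze_zero' (.of_forall fun _ => norm_nonneg _) ?_ (h.tendsto_bound ht)
  filter_upwards [self_mem_nhdsWithin] with s hs
  exact h.norm_trace_sub_le hs ht

/-- The finite sum is the logarithmic derivative of the determinant of the compression. It converges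
uniformly because the inverse of the compression is close to g* in operator norm, g' is trace class,
and both depend continuously on t. -/
theorem IsC1TraceLoop.eventually_norm_sum_sub (h : IsC1TraceLoop g g') {ε : ℝ} (hε : 0 < ε) :
    ∀ᶠ S in Filter.atTop, ∀ t ∈ Set.Icc (0 : ℝ) 1,
      ‖∑ i ∈ S, inner ℂ (traceBasis K i)
          (Ring.inverse (compr (bproj (traceBasis K) S) (g t)) (g' t (traceBasis K i))) -
        trace (star (g t) * g' t)‖ < ε := by
  refine isCompact_Icc.induction_on (p := fun s => ∀ᶠ S in Filter.atTop, ∀ t ∈ s,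
      ‖∑ i ∈ S, inner ℂ (traceBasis K i)
          (Ring.inverse (compr (bproj (traceBasis K) S) (g t)) (g' t (traceBasis K i))) -
        trace (star (g t) * g' t)‖ < ε) ?_ ?_ ?_ ?_
  · simp
  · intro s t hst ht
    filter_upwards [ht] with S hS x hx using hS x (hst hx)
  · intro s t hs ht
    filter_upwards [hs, ht] with S h1 h2 x hx using hx.elim (h1 x) (h2 x)
  intro t ht
  set c := (traceNorm (g' t)).toReal with hc
  have hc0 : 0 ≤ c := ENNReal.toReal_nonneg
  have hT := h.isTraceClass_deriv ht
  refine ⟨{s | s ∈ Set.Icc (0 : ℝ) 1 ∧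
    (traceNorm (g' s - g' t)).toReal + ‖g s - g t‖ * c < ε / 8}, ?_, ?_⟩
  · filter_upwards [self_mem_nhdsWithin, (h.tendsto_bound ht).eventually_lt_const
      (u := ε / 8) (by linarith)] with s hs hs' using ⟨hs, hs'⟩
  -- The bound 1/4 is what `norm_inverse_sub_star_le` needs; the other one makes the error of the
  -- inverse, at most twice the distance, contribute at most ε/8 after multiplication by c. The
  -- summand 1 covers c = 0.
  have hδ : 0 < min (1 / 4) (ε / (16 * (c + 1))) := by positivity
  filter_upwards [h.eventually_norm_sub_compr (traceBasis K) hδ,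
    (tendsto_sum_trace (star (g t)) hT).eventually (Metric.ball_mem_nhds _ (by positivity : 0 < ε / 8))]
    with S hS hS2 s hs
  obtain ⟨hs, hsb⟩ := hs
  have hEs := hS s hs
  obtain ⟨hR, hR'⟩ := norm_inverse_sub_star_le (h.unitary s hs) (hEs.le.trans (min_le_left _ _))
  set R := Ring.inverse (compr (bproj (traceBasis K) S) (g s))
  have hsT := h.isTraceClass_deriv hs
  have e : ∑ i ∈ S, inner ℂ (traceBasis K i) (R (g' s (traceBasis K i))) -
        trace (star (g s) * g' s) =
      ∑ i ∈ S, inner ℂ (traceBasis K i) (R ((g' s - g' t) (traceBasis K i))) +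
      ∑ i ∈ S, inner ℂ (traceBasis K i) ((R - star (g t)) (g' t (traceBasis K i))) +
      (∑ i ∈ S, inner ℂ (traceBasis K i) ((star (g t)) (g' t (traceBasis K i))) -
        trace (star (g t) * g' t)) - (trace (star (g s) * g' s) - trace (star (g t) * g' t)) := by
    simp only [sub_apply, map_sub, inner_sub_right, Finset.sum_sub_distrib]; ring
  have b1 := norm_sum_inner_le (traceBasis K) R (hsT.sub hT) S
  have b2 := norm_sum_inner_le (traceBasis K) (R - star (g t)) hT S
  have b4 := h.norm_trace_sub_le hs ht
  rw [dist_eq_norm] at hS2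
  have b5 : ‖R - star (g t)‖ ≤ 2 * (ε / (16 * (c + 1))) + ‖g s - g t‖ := by
    have : ‖R - star (g t)‖ ≤ ‖R - star (g s)‖ + ‖star (g s) - star (g t)‖ :=
      norm_sub_le_norm_sub_add_norm_sub _ _ _
    rw [← star_sub, norm_star] at this
    have := hEs.le.trans (min_le_right _ _)
    linarith
  have b6 : ε / (16 * (c + 1)) * c ≤ ε / 16 := by
    rw [div_mul_eq_mul_div, div_le_div_iff₀ (by positivity) (by positivity)]
    nlinarith
  have b7 : ‖R - star (g t)‖ * c ≤ ε / 8 + ‖g s - g t‖ * c := by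
    calc _ ≤ (2 * (ε / (16 * (c + 1))) + ‖g s - g t‖) * c := by gcongr
      _ ≤ _ := by nlinarith
  have b8 : ‖R‖ * (traceNorm (g' s - g' t)).toReal ≤ 2 * (traceNorm (g' s - g' t)).toReal := by
    gcongr
  have b9 : 0 ≤ ‖g s - g t‖ * c := by positivity
  have b10 : 0 ≤ (traceNorm (g' s - g' t)).toReal := ENNReal.toReal_nonneg
  rw [e]
  refine (norm_sub_le _ _).trans_lt ?_
  refine (add_le_add_left (norm_add₃_le) _).trans_lt ?_
  linarith

end TraceLoop

/-! ### Homotopy invariance of the winding integral -/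

section Uniqueness

variable {K : Type*} [NormedAddCommGroup K] [InnerProductSpace ℂ K] {ι : Type*}
  (b : HilbertBasis ι ℂ K) (S : Finset ι)

theorem continuous_cmat : Continuous (cmat b S) := by
  refine continuous_matrix fun i j => ?_
  simp only [cmat, Matrix.of_apply]
  fun_prop

theorem cmat_add_smul (A B : K →L[ℂ] K) (c d : ℂ) :
    cmat b S (c • A + d • B) = c • cmat b S A + d • cmat b S B := by
  ext i j
  simp [cmat]

open Classical in
/-- The determinant of the compression of `A` to the span of the `b i`, `i ∈ S`. -/
def cdet (A : K →L[ℂ] K) : ℂ := (cmat b S A).det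

theorem continuous_cdet : Continuous (cdet b S) := by
  classical
  exact (continuous_cmat b S).matrix_det

variable [CompleteSpace K] {g g' : ℝ → K →L[ℂ] K}

theorem cdet_compr (A : K →L[ℂ] K) : cdet b S (compr (bproj b S) A) = cdet b S A := by
  rw [cdet, cmat_compr, cdet]

theorem cdet_ne_zero {A : K →L[ℂ] K} (h : IsUnit (compr (bproj b S) A)) : cdet b S A ≠ 0 := by
  classical
  exact det_cmat_ne_zero b S h

-- Near a unitary the compression is invertible, so its determinant does not vanish, and by Jacobi's
-- formula the integrand is the logarithmic derivative of this determinant.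
open Classical in
theorem IsC1TraceLoop.logIncrement (h : IsC1TraceLoop g g')
    (hE : ∀ t ∈ Set.Icc (0 : ℝ) 1, ‖g t - compr (bproj b S) (g t)‖ < 1 / 4) :
    LogIncrement (fun t => cdet b S (g t))
      (∫ t in (0 : ℝ)..1, ∑ i ∈ S, inner ℂ (b i)
          (Ring.inverse (compr (bproj b S) (g t)) (g' t (b i)))) ∧
    ContinuousOn (fun t => ∑ i ∈ S, inner ℂ (b i)
          (Ring.inverse (compr (bproj b S) (g t)) (g' t (b i)))) (Set.Icc 0 1) := by
  have hu : ∀ t ∈ Set.Icc (0 : ℝ) 1, IsUnit (compr (bproj b S) (g t)) := fun t ht =>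
    isUnit_of_norm_sub_lt (h.unitary t ht) ((hE t ht).trans (by norm_num))
  have hne : ∀ t ∈ Set.Icc (0 : ℝ) 1, cdet b S (g t) ≠ 0 := fun t ht =>
    cdet_ne_zero b S (hu t ht)
  have hd : ∀ t ∈ Set.Icc (0 : ℝ) 1, HasDerivWithinAt (fun t => cdet b S (g t))
      (((cmat b S (g t)).adjugate * cmat b S (g' t)).trace) (Set.Icc 0 1) t := fun t ht => by
    refine hasDerivWithinAt_det (M' := fun t => cmat b S (g' t)) fun i j => ?_
    let l : (K →L[ℂ] K) →L[ℂ] ℂ := (innerSL ℂ (b i)) ∘L (ContinuousLinearMap.apply ℂ K (b j))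
    exact (l.restrictScalars ℝ).hasFDerivAt.comp_hasDerivWithinAt t (h.hasDerivWithinAt ht)
  have hc1 := continuousOn_iff_continuous_domRestrict.1 h.continuousOn
  have hc2 := continuousOn_iff_continuous_domRestrict.1 h.continuousOn_deriv
  have hm1 := (continuous_cmat b S).comp hc1
  have hm2 := (continuous_cmat b S).comp hc2
  have hc : ContinuousOn (fun t => ((cmat b S (g t)).adjugate * cmat b S (g' t)).trace)
      (Set.Icc 0 1) := by
    rw [continuousOn_iff_continuous_domRestrict]
    exact (hm1.matrix_adjugate.matrix_mul hm2).matrix_trace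
  have hcd : ContinuousOn (fun t => cdet b S (g t)) (Set.Icc 0 1) := by
    rw [continuousOn_iff_continuous_domRestrict]
    exact (continuous_cdet b S).comp hc1
  have e : ∀ t ∈ Set.Icc (0 : ℝ) 1, ((cmat b S (g t)).adjugate * cmat b S (g' t)).trace /
      cdet b S (g t) = ∑ i ∈ S, inner ℂ (b i)
          (Ring.inverse (compr (bproj b S) (g t)) (g' t (b i))) := fun t ht => by
    rw [cdet, trace_adjugate_mul_div (cmat_inverse_mul b S (hu t ht)),
      trace_cmat_inverse_mul b S (hu t ht)]
  refine ⟨?_, (hc.div hcd hne).congr fun t ht => (e t ht).symm⟩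
  have := logIncrement_of_hasDeriv hne hd hc
  rwa [intervalIntegral.integral_congr (g := fun t => ∑ i ∈ S, inner ℂ (b i)
          (Ring.inverse (compr (bproj b S) (g t)) (g' t (b i)))) fun t ht => e t (by
            rwa [Set.uIcc_of_le zero_le_one] at ht)] at this

theorem IsC1TraceLoop.eventually_logIncrement (h : IsC1TraceLoop g g') {ε : ℝ} (hε : 0 < ε) :
    ∀ᶠ S in Filter.atTop, (∀ t ∈ Set.Icc (0 : ℝ) 1,
        ‖g t - compr (bproj (traceBasis K) S) (g t)‖ < 1 / 4) ∧ ∃ w : ℂ,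
      LogIncrement (fun t => cdet (traceBasis K) S (g t)) w ∧
      ‖w - ∫ t in (0 : ℝ)..1, trace (star (g t) * g' t)‖ ≤ ε := by
  filter_upwards [h.eventually_norm_sub_compr (traceBasis K) (by norm_num : (0 : ℝ) < 1 / 4),
    h.eventually_norm_sum_sub hε] with S hS hS2
  obtain ⟨h1, h2⟩ := h.logIncrement (traceBasis K) S hS
  refine ⟨hS, _, h1, ?_⟩
  rw [← intervalIntegral.integral_sub]
  · refine (intervalIntegral.norm_integral_le_of_norm_le_const fun t ht => (hS2 t ?_).le).trans
      (by simp)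
    rw [Set.uIoc_of_le zero_le_one] at ht
    exact Set.Ioc_subset_Icc_self ht
  · exact ContinuousOn.intervalIntegrable (by rwa [Set.uIcc_of_le zero_le_one])
  · exact ContinuousOn.intervalIntegrable
      (by rw [Set.uIcc_of_le zero_le_one]; exact h.continuousOn_trace)

theorem isUnit_of_mem_unitary {U : K →L[ℂ] K} (hU : U ∈ unitary (K →L[ℂ] K)) : IsUnit U :=
  Unitary.isUnit_coe (U := ⟨U, hU⟩)

-- The compression of a unitary can be singular, but the Möbius transform at r = 1 is both unitary
-- and an extended compression. Its determinant is therefore available along a whole homotopy in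
-- UFred.
variable {b S} in
theorem cdet_mob_ne_zero {U : K →L[ℂ] K} (hU : U ∈ unitary (K →L[ℂ] K))
    (hu : IsUnit (1 + (1 - bproj b S) * U)) : cdet b S (mob (bproj b S) U 1) ≠ 0 := by
  have hm := mob_mem_unitary (r := 1) (isStarProjection_bproj b S) hU (by simp) (by simpa using hu)
  have e : mob (bproj b S) U 1 = compr (bproj b S) (U * Ring.inverse (1 + (1 - bproj b S) * U)) :=
    mob_one
  rw [e, cdet_compr]
  exact cdet_ne_zero b S (e ▸ isUnit_of_mem_unitary hm)

/-- Join g to its transform by a straight segment. The transform is unitary and at distance less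
than 1 from the compression of g, so the compressions along the segment remain invertible. -/
theorem LogIncrement.mob (h : IsC1TraceLoop g g')
    (hE : ∀ t ∈ Set.Icc (0 : ℝ) 1, ‖g t - compr (bproj b S) (g t)‖ < 1 / 4)
    (hu : ∀ t ∈ Set.Icc (0 : ℝ) 1, IsUnit (1 + (1 - bproj b S) * g t)) {w : ℂ}
    (hw : LogIncrement (fun t => cdet b S (g t)) w) :
    LogIncrement (fun t => cdet b S (mob (bproj b S) (g t) 1)) w := by
  have hP := isStarProjection_bproj b S
  have hgc : Continuous fun t : I => g t := continuousOn_iff_continuous_domRestrict.1 h.continuousOn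
  have hmc : Continuous fun t : I => Maslov.mob (bproj b S) (g t) 1 :=
    continuous_mob _ hgc continuous_const fun t => by simpa using hu t t.2
  refine LogIncrement.of_homotopy (D := fun x => cdet b S (((x.1 : ℝ) : ℂ) •
    Maslov.mob (bproj b S) (g x.2) 1 + (1 - ((x.1 : ℝ) : ℂ)) • g x.2)) ?_ ?_ ?_ ?_ ?_ hw
  · refine (continuous_cdet b S).comp ?_
    have h1 := hgc.comp (continuous_snd (X := I))
    have h2 := hmc.comp (continuous_snd (X := I))
    have h3 : Continuous fun x : I × I => ((x.1 : ℝ) : ℂ) := by fun_prop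
    exact (h3.smul h2).add ((continuous_const.sub h3).smul h1)
  · rintro ⟨s, t⟩
    set M := Maslov.mob (bproj b S) (g t) 1 with hM
    set X := compr (bproj b S) (g t) with hX
    have e : M = compr (bproj b S) (g t * Ring.inverse (1 + (1 - bproj b S) * g t)) := mob_one
    have hMu := mob_mem_unitary (r := 1) hP (h.unitary t t.2) (by simp) (by simpa using hu t t.2)
    have hd := norm_mob_sub_compr_le hP (h.unitary t t.2) (hu t t.2) (hE t t.2).le
    have e1 : cdet b S (((s : ℝ) : ℂ) • M + (1 - ((s : ℝ) : ℂ)) • g t) = cdet b S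
        (((s : ℝ) : ℂ) • (g t * Ring.inverse (1 + (1 - bproj b S) * g t)) +
          (1 - ((s : ℝ) : ℂ)) • g t) := by
      rw [cdet, cdet, cmat_add_smul, e, cmat_compr, cmat_add_smul]
    have e2 : compr (bproj b S) (((s : ℝ) : ℂ) •
        (g t * Ring.inverse (1 + (1 - bproj b S) * g t)) + (1 - ((s : ℝ) : ℂ)) • g t) =
        M - (1 - ((s : ℝ) : ℂ)) • (M - X) := by
      rw [e, hX]
      simp only [compr, mul_add, add_mul, Algebra.mul_smul_comm, Algebra.smul_mul_assoc]
      module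
    change cdet b S (((s : ℝ) : ℂ) • M + (1 - ((s : ℝ) : ℂ)) • g t) ≠ 0
    rw [e1]
    refine cdet_ne_zero b S ?_
    rw [e2]
    refine isUnit_of_norm_sub_lt hMu ?_
    rw [sub_sub_cancel, norm_smul]
    have h1 : ‖(1 - ((s : ℝ) : ℂ))‖ ≤ 1 := by
      rw [← Complex.ofReal_one, ← Complex.ofReal_sub, Complex.norm_real, Real.norm_eq_abs, abs_le]
      exact ⟨by linarith [s.2.2], by linarith [s.2.1]⟩
    have h2 := hE t t.2
    have h3 := norm_nonneg (M - X)
    nlinarith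
  · intro s
    simp [h.closed]
  · intro t; simp
  · intro t; simp

/-- Two loops in `1 + (trace class)` that are homotopic through closed paths in `UFred K` have the
same winding integral. -/
theorem integral_trace_eq {a a' : UFred K} {v : Path a a} {v' : Path a' a'}
    {h h' : ℝ → K →L[ℂ] K} (hg : IsC1TraceLoop g g') (hh : IsC1TraceLoop h h')
    (hv : ∀ t : I, (v t : K →L[ℂ] K) = g t) (hv' : ∀ t : I, (v' t : K →L[ℂ] K) = h t)
    (hom : ContinuousMap.HomotopicWith v.toContinuousMap v'.toContinuousMap (fun f => f 0 = f 1)) :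
    ∫ t in (0 : ℝ)..1, trace (star (g t) * g' t) =
      ∫ t in (0 : ℝ)..1, trace (star (h t) * h' t) := by
  obtain ⟨F⟩ := hom
  let U : I × I → K →L[ℂ] K := fun x => F x
  have hUc : Continuous U := continuous_subtype_val.comp F.continuous
  have hU : ∀ x, U x ∈ UFred K := fun x => (F x).2
  have hU0 : ∀ t : I, U (0, t) = g t := fun t => by
    have : F (0, t) = v t := F.apply_zero t
    rw [← hv, ← this]
  have hU1 : ∀ t : I, U (1, t) = h t := fun t => by
    have : F (1, t) = v' t := F.apply_one t
    rw [← hv', ← this]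
  have hUcl : ∀ s, U (s, 0) = U (s, 1) := fun s => congrArg Subtype.val (F.prop s)
  rw [← sub_eq_zero, ← norm_eq_zero]
  refine le_antisymm (le_of_forall_pos_le_add fun ε hε => ?_) (norm_nonneg _)
  -- One finite set S serves both loops and the homotopy between them. The two integrals are then
  -- within ε/2 of increments w and w', which coincide since the determinants of the transforms
  -- never vanish on the homotopy.
  obtain ⟨S, ⟨hE, w, hw, hwn⟩, ⟨hE', w', hw', hwn'⟩, hu⟩ :=
    ((hg.eventually_logIncrement (half_pos hε)).and
      ((hh.eventually_logIncrement (half_pos hε)).and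
        (eventually_isUnit_one_add (traceBasis K) hUc hU))).exists
  have hug : ∀ t ∈ Set.Icc (0 : ℝ) 1, IsUnit (1 + (1 - bproj (traceBasis K) S) * g t) :=
    fun t ht => hU0 ⟨t, ht⟩ ▸ hu (0, ⟨t, ht⟩)
  have huh : ∀ t ∈ Set.Icc (0 : ℝ) 1, IsUnit (1 + (1 - bproj (traceBasis K) S) * h t) :=
    fun t ht => hU1 ⟨t, ht⟩ ▸ hu (1, ⟨t, ht⟩)
  have m1 := LogIncrement.mob (traceBasis K) S hg hE hug hw
  have m2 := LogIncrement.mob (traceBasis K) S hh hE' huh hw'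
  have m3 : LogIncrement (fun t : I => cdet (traceBasis K) S
      (mob (bproj (traceBasis K) S) (h t) 1)) w := by
    refine LogIncrement.of_homotopy (D := fun x => cdet (traceBasis K) S
      (mob (bproj (traceBasis K) S) (U x) 1)) ?_ ?_ ?_ ?_ ?_ m1
    · refine (continuous_cdet _ S).comp ?_
      exact continuous_mob _ hUc continuous_const fun x => by simpa using hu x
    · exact fun x => cdet_mob_ne_zero (hU x).1 (hu x)
    · intro s; simp only [hUcl]
    · intro t; simp only [hU0]
    · intro t; simp only [hU1]
  have hww : w = w' := m3.unique m2
  subst hww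
  rw [zero_add]
  calc _ = ‖(w - ∫ t in (0 : ℝ)..1, trace (star (h t) * h' t)) -
        (w - ∫ t in (0 : ℝ)..1, trace (star (g t) * g' t))‖ := by congr 1; ring
    _ ≤ ε / 2 + ε / 2 := (norm_sub_le _ _).trans (add_le_add hwn' hwn)
    _ = ε := add_halves ε

theorem HasLoopWinding.unique {a a' : UFred K} {u : Path a a} {u' : Path a' a'} {m n : ℤ}
    (h : HasLoopWinding u m) (h' : HasLoopWinding u' n)
    (hom : ContinuousMap.HomotopicWith u.toContinuousMap u'.toContinuousMap (fun f => f 0 = f 1)) :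
    m = n := by
  obtain ⟨_, v, g, g', hg, hv, h1, h2⟩ := h
  obtain ⟨_, w, k, k', hk, hw, h3, h4⟩ := h'
  have := integral_trace_eq hg hk hv hw (h1.symm.trans (hom.trans h3))
  rw [this, ← h4] at h2
  exact_mod_cast h2

theorem HasLoopWinding.congr {a a' : UFred K} {u : Path a a} {u' : Path a' a'} {m : ℤ}
    (h : HasLoopWinding u m)
    (hom : ContinuousMap.HomotopicWith u.toContinuousMap u'.toContinuousMap (fun f => f 0 = f 1)) :
    HasLoopWinding u' m := by
  obtain ⟨c, v, g, g', hg, hv, h1, h2⟩ := h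
  exact ⟨c, v, g, g', hg, hv, hom.symm.trans h1, h2⟩

end Uniqueness

/-! ### Unitaries carrying one unit vector to another -/

section Rotation

variable {K : Type*} [NormedAddCommGroup K] [InnerProductSpace ℂ K]

open InnerProductSpace (rankOne)

/-- If ⟨b, a⟩ = −1 then ‖a + b‖² = 0. -/
theorem one_add_inner_ne_zero {a b : K} (ha : ‖a‖ = 1) (hb : ‖b‖ = 1) (h : b ≠ -a) :
    1 + inner ℂ b a ≠ 0 := fun h0 => h <| by
  have h1 : inner ℂ b a = -1 := by linear_combination h0
  rw [← add_eq_zero_iff_eq_neg, ← norm_eq_zero, ← sq_eq_zero_iff, @norm_add_sq ℂ, h1, ha, hb]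
  simp; norm_num

/-- For unit vectors `a` and `b ≠ -a`, a unitary operator that maps `a` to `b` and fixes the vectors
orthogonal to `a` and `b`. -/
def rot (a b : K) : K →L[ℂ] K :=
  (1 - (1 + inner ℂ b a)⁻¹ • rankOne ℂ (a + b) (a + b)) * (1 - (2 : ℂ) • rankOne ℂ a a)

theorem inner_self_eq_one {a : K} (ha : ‖a‖ = 1) : inner ℂ a a = 1 := by
  rw [inner_self_eq_norm_sq_to_K, ha]; simp

theorem rot_self {a : K} (ha : ‖a‖ = 1) : rot a a = 1 := by
  ext x
  have h := inner_self_eq_one ha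
  simp only [rot, h, mul_apply_eq_comp, sub_apply, one_apply_eq_self, smul_apply,
    InnerProductSpace.rankOne_apply, inner_add_left, inner_sub_right, inner_smul_right]
  module

theorem rot_apply_left {a b : K} (ha : ‖a‖ = 1) (hb : ‖b‖ = 1) (h : b ≠ -a) : rot a b a = b := by
  have h0 := one_add_inner_ne_zero ha hb h
  have h1 := inner_self_eq_one ha
  simp only [rot, mul_apply_eq_comp, sub_apply, one_apply_eq_self, smul_apply,
    InnerProductSpace.rankOne_apply, inner_add_left, inner_sub_right, inner_smul_right, h1]
  have e : (1 + inner ℂ b a)⁻¹ • (1 + inner ℂ b a - 2 * (1 * (1 + inner ℂ b a))) • (a + b) =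
      -(a + b) := by
    rw [smul_smul, ← neg_one_smul ℂ (a + b)]
    congr 1
    field_simp
    ring
  rw [e]
  module

theorem rot_apply_of_inner_eq_zero {a b x : K} (ha : inner ℂ a x = 0) (hb : inner ℂ b x = 0) :
    rot a b x = x := by
  simp [rot, ha, hb]

/-- Since (cc*)² = ‖c‖² cc*, the product with the adjoint is 1 − (z + z̄ − |z|²‖c‖²) cc*. Both
factors of `rot` have this form. -/
theorem one_sub_smul_rankOne_mem_unitary [CompleteSpace K] {c : K} {z : ℂ}
    (h : z + (starRingEnd ℂ) z = z * (starRingEnd ℂ) z * (‖c‖ : ℂ) ^ 2) :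
    1 - z • rankOne ℂ c c ∈ unitary (K →L[ℂ] K) := by
  have hs : star (1 - z • rankOne ℂ c c) = 1 - (starRingEnd ℂ) z • rankOne ℂ c c := by
    rw [star_sub, star_one, star_smul, ContinuousLinearMap.star_eq_adjoint,
      InnerProductSpace.adjoint_rankOne]; rfl
  have hm : rankOne ℂ c c * rankOne ℂ c c = (‖c‖ : ℂ) ^ 2 • rankOne ℂ c c := by
    rw [ContinuousLinearMap.mul_def, InnerProductSpace.rankOne_comp_rankOne,
      inner_self_eq_norm_sq_to_K]; rfl
  rw [Unitary.mem_iff, hs]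
  constructor
  · simp only [mul_sub, sub_mul, mul_one, one_mul, Algebra.mul_smul_comm, Algebra.smul_mul_assoc, hm]
    trans (1 : K →L[ℂ] K) - (z + (starRingEnd ℂ) z - z * (starRingEnd ℂ) z * (‖c‖ : ℂ) ^ 2) •
      rankOne ℂ c c
    · module
    · rw [h, sub_self, zero_smul, sub_zero]
  · simp only [mul_sub, sub_mul, mul_one, one_mul, Algebra.mul_smul_comm, Algebra.smul_mul_assoc, hm]
    trans (1 : K →L[ℂ] K) - (z + (starRingEnd ℂ) z - z * (starRingEnd ℂ) z * (‖c‖ : ℂ) ^ 2) •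
      rankOne ℂ c c
    · module
    · rw [h, sub_self, zero_smul, sub_zero]

theorem rot_mem_unitary [CompleteSpace K] {a b : K} (ha : ‖a‖ = 1) (hb : ‖b‖ = 1) (h : b ≠ -a) :
    rot a b ∈ unitary (K →L[ℂ] K) := by
  have h0 := one_add_inner_ne_zero ha hb h
  refine mul_mem (one_sub_smul_rankOne_mem_unitary ?_) (one_sub_smul_rankOne_mem_unitary ?_)
  · have h0' : 1 + inner ℂ a b ≠ 0 := by
      have := (map_ne_zero (starRingEnd ℂ)).2 h0
      simpa using this
    have hn : ((‖a + b‖ : ℝ) : ℂ) ^ 2 = (1 + inner ℂ a b) + (1 + inner ℂ b a) := by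
      have := inner_self_eq_norm_sq_to_K (𝕜 := ℂ) (a + b)
      simp only [inner_add_left, inner_add_right, inner_self_eq_one ha, inner_self_eq_one hb] at this
      rw [show ((‖a + b‖ : ℝ) : ℂ) ^ 2 = (RCLike.ofReal ‖a + b‖ : ℂ) ^ 2 from rfl, ← this]; ring
    rw [hn]
    simp only [map_inv₀, map_add, map_one, inner_conj_symm]
    field_simp
  · simp [ha, Complex.conj_ofNat]; norm_num

theorem continuous_rot {X : Type*} [TopologicalSpace X] {a b : X → K} (ha : Continuous a)
    (hb : Continuous b) (ha1 : ∀ x, ‖a x‖ = 1) (hb1 : ∀ x, ‖b x‖ = 1) (h : ∀ x, b x ≠ -a x) :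
    Continuous fun x => rot (a x) (b x) := by
  have h0 : Continuous fun x => (1 + inner ℂ (b x) (a x))⁻¹ :=
    (by fun_prop : Continuous fun x => 1 + inner ℂ (b x) (a x)).inv₀
      fun x => one_add_inner_ne_zero (ha1 x) (hb1 x) (h x)
  have h1 : ∀ c : X → K, Continuous c → Continuous fun x => rankOne ℂ (c x) (c x) := fun c hc => by
    have : Continuous fun y : K => innerSL ℂ y := (innerSL ℂ (E := K)).continuous
    exact ((ContinuousLinearMap.smulRightL ℂ K K).continuous₂.comp
      ((this.comp hc).prodMk hc))
  unfold rot
  exact (continuous_const.sub (h0.smul (h1 _ (ha.add hb)))).mul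
    (continuous_const.sub ((h1 _ ha).const_smul (2 : ℂ)))

/-- The normalization of a point on the segment from `a` to `b`. -/
def seg (a b : K) (s : ℝ) : K := (‖(1 - s) • a + s • b‖⁻¹ : ℝ) • ((1 - s) • a + s • b)

variable {a b : K} {s : ℝ}

theorem seg_ne_zero (ha : ‖a‖ = 1) (hb : ‖b‖ = 1) (h : b ≠ -a) : (1 - s) • a + s • b ≠ 0 := by
  intro h0
  have h1 : s • b = (s - 1) • a := by
    rw [← sub_eq_zero, ← h0]; module
  have h2 : |s| = |s - 1| := by
    have := congrArg norm h1
    simpa [norm_smul, ha, hb] using this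
  have hs : s = 1 / 2 := by
    rcases abs_eq_abs.1 h2 with h3 | h3 <;> linarith
  subst hs
  apply h
  have h4 : (2 : ℝ) • ((1 / 2 : ℝ) • b) = (2 : ℝ) • ((1 / 2 - 1 : ℝ) • a) := by rw [h1]
  rw [smul_smul, smul_smul] at h4
  norm_num at h4
  exact h4

theorem norm_seg (ha : ‖a‖ = 1) (hb : ‖b‖ = 1) (h : b ≠ -a) : ‖seg a b s‖ = 1 := by
  rw [seg, norm_smul, norm_inv, norm_norm, inv_mul_cancel₀ (norm_ne_zero_iff.2 (seg_ne_zero ha hb h))]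

theorem seg_zero (ha : ‖a‖ = 1) : seg a b 0 = a := by simp [seg, ha]

theorem seg_one (hb : ‖b‖ = 1) : seg a b 1 = b := by simp [seg, hb]

/-- If the normalized point is −a, then sb = −(c + 1 − s)a with c > 0 the norm of the unnormalized
point. Comparing norms gives s = c + 1 − s, hence b = −a. -/
theorem seg_ne_neg (ha : ‖a‖ = 1) (hb : ‖b‖ = 1) (h : b ≠ -a) (hs : s ∈ Set.Icc (0 : ℝ) 1) :
    seg a b s ≠ -a := by
  intro h0
  set c := ‖(1 - s) • a + s • b‖ with hc
  have hc0 : 0 < c := norm_pos_iff.2 (seg_ne_zero ha hb h)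
  have h1 : (1 - s) • a + s • b = -(c • a) := by
    have : c • seg a b s = -(c • a) := by rw [h0, smul_neg]
    rwa [seg, ← hc, smul_smul, mul_inv_cancel₀ hc0.ne', one_smul] at this
  have h2 : s • b = -((c + (1 - s)) • a) := by
    rw [add_smul, neg_add, ← h1]; module
  have h3 : s = c + (1 - s) := by
    have := congrArg norm h2
    rw [norm_neg, norm_smul, norm_smul, ha, hb, Real.norm_of_nonneg hs.1,
      Real.norm_of_nonneg (by linarith [hs.2])] at this
    simpa using this
  rw [← h3, ← smul_neg] at h2
  have hs0 : s ≠ 0 := by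
    rintro rfl
    linarith
  exact h (smul_right_injective K hs0 h2)

theorem inner_seg {x : K} (ha : inner ℂ x a = 0) (hb : inner ℂ x b = 0) :
    inner ℂ x (seg a b s) = 0 := by
  simp [seg, ha, hb]

theorem continuous_seg {X : Type*} [TopologicalSpace X] {a b : X → K} {s : X → ℝ}
    (ha : Continuous a) (hb : Continuous b) (hs : Continuous s) (ha1 : ∀ x, ‖a x‖ = 1)
    (hb1 : ∀ x, ‖b x‖ = 1) (h : ∀ x, b x ≠ -a x) : Continuous fun x => seg (a x) (b x) (s x) := by
  have h1 : Continuous fun x => (1 - s x) • a x + s x • b x := by fun_prop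
  exact (h1.norm.inv₀ fun x => norm_ne_zero_iff.2 (seg_ne_zero (ha1 x) (hb1 x) (h x))).smul h1

end Rotation

/-! ### Polygonal approximation of curves -/

section Polygon

variable {K : Type*} [NormedAddCommGroup K] [NormedSpace ℝ K]

/-- A continuous curve is uniformly close to a polygon. -/
theorem exists_polygon (v : C(I, K)) {ε : ℝ} (hε : 0 < ε) :
    ∃ (s : Finset (I × I)) (c : C(I, K)), (∀ t, ‖c t - v t‖ < ε) ∧
      c 0 = v 0 ∧ c 1 = v 1 ∧ ∀ t, ∃ p ∈ s, ∃ r₁ r₂ : ℝ, c t = r₁ • v p.1 + r₂ • v p.2 := by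
  classical
  obtain ⟨δ, hδ, huc⟩ := Metric.uniformContinuous_iff.1
    (CompactSpace.uniformContinuous_of_continuous v.continuous) ε hε
  obtain ⟨N, hN⟩ := exists_nat_gt δ⁻¹
  have hN0 : (0 : ℝ) < N := (inv_pos.2 hδ).trans hN
  let q : ℕ → I := fun k => Set.projIcc 0 1 zero_le_one ((k : ℝ) / N)
  -- Linear interpolation written as a sum of hat functions, which makes continuity automatic. The
  -- index N + 1 occurs as right neighbour of N when t = 1; its node is clamped to 1.
  let c : C(I, K) := ⟨fun t => ∑ k ∈ Finset.range (N + 2),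
    max 0 (1 - |N * (t : ℝ) - k|) • v (q k), by fun_prop⟩
  have key : ∀ t : I, c t = (1 - (N * (t : ℝ) - ⌊N * (t : ℝ)⌋₊)) • v (q ⌊N * (t : ℝ)⌋₊) +
      (N * (t : ℝ) - ⌊N * (t : ℝ)⌋₊) • v (q (⌊N * (t : ℝ)⌋₊ + 1)) := fun t => by
    set k := ⌊N * (t : ℝ)⌋₊ with hk
    have h0 : 0 ≤ N * (t : ℝ) := mul_nonneg hN0.le t.2.1
    have h1 : (k : ℝ) ≤ N * (t : ℝ) := Nat.floor_le h0
    have h2 : N * (t : ℝ) < k + 1 := Nat.lt_floor_add_one _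
    have hkN : k ≤ N := by
      have : (k : ℝ) ≤ N := h1.trans (mul_le_of_le_one_right hN0.le t.2.2)
      exact_mod_cast this
    change ∑ k ∈ Finset.range (N + 2), max 0 (1 - |N * (t : ℝ) - k|) • v (q k) = _
    rw [Finset.sum_eq_add k (k + 1) (by omega)]
    · congr 2
      · rw [abs_of_nonneg (by linarith), max_eq_right (by linarith)]
      · push_cast
        rw [abs_of_nonpos (by linarith), max_eq_right (by linarith)]
        ring
    · intro m _ hm
      have : 1 ≤ |N * (t : ℝ) - m| := by
        rcases lt_or_gt_of_ne hm.1 with h | h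
        · have : (m : ℝ) + 1 ≤ k := by exact_mod_cast h
          rw [abs_of_nonneg (by linarith)]; linarith
        · have : k + 2 ≤ m := by have := hm.2; omega
          have : (k : ℝ) + 2 ≤ m := by exact_mod_cast this
          rw [abs_of_nonpos (by linarith)]; linarith
      rw [max_eq_left (by linarith), zero_smul]
    · intro h; exact absurd (Finset.mem_range.2 (by omega)) h
    · intro h; exact absurd (Finset.mem_range.2 (by omega)) h
  have hq : ∀ (t : I) (m : ℕ), |N * (t : ℝ) - m| ≤ 1 → ‖v (q m) - v t‖ < ε := fun t m hm => by
    rw [← dist_eq_norm]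
    refine huc ?_
    have h1 : dist (q m) t ≤ |(m : ℝ) / N - t| := by
      have e : t = Set.projIcc 0 1 zero_le_one (t : ℝ) := (Set.projIcc_val _ t).symm
      conv_lhs => rw [e]
      rw [← Real.dist_eq]
      exact (LipschitzWith.projIcc (zero_le_one' ℝ)).dist_le_mul _ _ |>.trans (by simp)
    refine h1.trans_lt ?_
    have h2 : (m : ℝ) / N - t = -(N * t - m) / N := by field_simp; ring
    rw [h2, abs_div, abs_neg, abs_of_pos hN0, div_lt_iff₀ hN0]
    have : 1 < δ * N := by
      rw [inv_lt_iff_one_lt_mul₀ hδ] at hN; linarith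
    linarith
  refine ⟨(Finset.range (N + 1)).image fun k => (q k, q (k + 1)), c, fun t => ?_, ?_, ?_, fun t => ?_⟩
  · rw [key]
    set k := ⌊N * (t : ℝ)⌋₊ with hk
    have h0 : 0 ≤ N * (t : ℝ) := mul_nonneg hN0.le t.2.1
    have h1 : (k : ℝ) ≤ N * (t : ℝ) := Nat.floor_le h0
    have h2 : N * (t : ℝ) < k + 1 := Nat.lt_floor_add_one _
    set x := N * (t : ℝ) - k with hx
    have e : (1 - x) • v (q k) + x • v (q (k + 1)) - v t =
        (1 - x) • (v (q k) - v t) + x • (v (q (k + 1)) - v t) := by module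
    rw [e]
    have n1 := hq t k (by rw [abs_le]; constructor <;> linarith)
    have n2 := hq t (k + 1) (by push_cast; rw [abs_le]; constructor <;> linarith)
    refine (norm_add_le _ _).trans_lt ?_
    rw [norm_smul, norm_smul, Real.norm_of_nonneg (by linarith), Real.norm_of_nonneg (by linarith)]
    rcases (show 0 ≤ x by linarith).eq_or_lt with h | h
    · rw [← h]; simpa using n1
    · nlinarith
  · rw [key]; simp [q]
  · rw [key]
    have : (⌊N * ((1 : I) : ℝ)⌋₊) = N := by simp
    rw [this]; simp [q, hN0.ne']
  · refine ⟨_, Finset.mem_image_of_mem _ (Finset.mem_range.2 (?_ : ⌊N * (t : ℝ)⌋₊ < N + 1)), _, _, key t⟩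
    have h1 : (⌊N * (t : ℝ)⌋₊ : ℝ) ≤ N :=
      (Nat.floor_le (mul_nonneg hN0.le t.2.1)).trans (mul_le_of_le_one_right hN0.le t.2.2)
    have : ⌊N * (t : ℝ)⌋₊ ≤ N := by exact_mod_cast h1
    omega

end Polygon

/-! ### A point off finitely many real planes -/

section Avoid

variable {K : Type*} [NormedAddCommGroup K] [InnerProductSpace ℂ K]

/-- A complex plane is not covered by finitely many real planes. -/
theorem exists_notMem_real_planes {e₁ e₂ : K} (h₁ : ‖e₁‖ = 1) (h₂ : ‖e₂‖ = 1)
    (h : inner ℂ e₁ e₂ = 0) (s : Finset (K × K)) :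
    ∃ w₁ w₂ : ℂ, ‖w₁ • e₁ + w₂ • e₂‖ = 1 ∧
      ∀ p ∈ s, ∀ r₁ r₂ : ℝ, w₁ • e₁ + w₂ • e₂ ≠ r₁ • p.1 + r₂ • p.2 := by
  classical
  let f : (ℂ × ℂ) →ₗ[ℝ] K :=
    { toFun := fun z => z.1 • e₁ + z.2 • e₂
      map_add' := fun x y => by simp only [Prod.fst_add, Prod.snd_add]; module
      map_smul' := fun r x => by
        simp only [Prod.smul_fst, Prod.smul_snd, RingHom.id_apply, smul_assoc, smul_add] }
  have hinj : ∀ z, f z = 0 → z = 0 := fun z hz => by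
    have hz' : z.1 • e₁ + z.2 • e₂ = 0 := hz
    have h' : inner ℂ e₂ e₁ = 0 := by rw [← inner_conj_symm, h, map_zero]
    have c1 := congrArg (fun x => inner ℂ e₁ x) hz'
    have c2 := congrArg (fun x => inner ℂ e₂ x) hz'
    simp only [inner_add_right, inner_smul_right, h, h', inner_self_eq_one h₁,
      inner_self_eq_one h₂, inner_zero_right] at c1 c2
    exact Prod.ext (by simpa using c1) (by simpa using c2)
  have hf : Function.Injective f := (injective_iff_map_eq_zero f).2 hinj
  let W : K × K → Subspace ℝ (ℂ × ℂ) := fun p => (Submodule.span ℝ {p.1, p.2}).comap f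
  -- A real vector space is not a finite union of proper subspaces, and each plane pulls back to
  -- dimension at most 2 in ℂ² of real dimension 4. The zero subspace is added so that the point
  -- found can be normalized.
  have hW : ⊤ ∉ insert ⊥ (s.image W) := by
    rw [Finset.mem_insert, not_or]
    constructor
    · exact top_ne_bot
    rw [Finset.mem_image]
    rintro ⟨p, _, hp⟩
    have hfin : FiniteDimensional ℝ (Submodule.span ℝ {p.1, p.2}) :=
      FiniteDimensional.span_of_finite ℝ (by simp)
    let g : (ℂ × ℂ) →ₗ[ℝ] Submodule.span ℝ {p.1, p.2} := f.codRestrict _ fun z => by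
      have : z ∈ W p := by rw [hp]; trivial
      exact this
    have hg : Function.Injective g := fun x y hxy => hf (congrArg Subtype.val hxy)
    have h1 := LinearMap.finrank_le_finrank_of_injective hg
    have h2 : Module.finrank ℝ (Submodule.span ℝ ({p.1, p.2} : Set K)) ≤ 2 := by
      have := finrank_span_finset_le_card (R := ℝ) ({p.1, p.2} : Finset K)
      simp only [Finset.coe_insert, Finset.coe_singleton] at this
      exact this.trans Finset.card_le_two
    have h3 : Module.finrank ℝ (ℂ × ℂ) = 4 := by simp [Complex.finrank_real_complex]
    omega
  have := Subspace.biUnion_ne_univ_of_top_notMem hW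
  obtain ⟨z, hz⟩ := (Set.ne_univ_iff_exists_notMem _).1 this
  simp only [Set.mem_iUnion, not_exists, Finset.mem_insert, Finset.mem_image] at hz
  have hz0 : f z ≠ 0 := fun h0 => hz ⊥ (Or.inl rfl) (by simpa using hinj z h0)
  have hn : ‖f z‖ ≠ 0 := norm_ne_zero_iff.2 hz0
  have e : ((‖f z‖⁻¹ : ℝ) : ℂ) • z.1 • e₁ + ((‖f z‖⁻¹ : ℝ) : ℂ) • z.2 • e₂ = ‖f z‖⁻¹ • f z := by
    change _ = ‖f z‖⁻¹ • (z.1 • e₁ + z.2 • e₂)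
    rw [smul_add, Complex.coe_smul, Complex.coe_smul]
  refine ⟨((‖f z‖⁻¹ : ℝ) : ℂ) * z.1, ((‖f z‖⁻¹ : ℝ) : ℂ) * z.2, ?_, fun p hp r₁ r₂ h0 => ?_⟩
  · rw [mul_smul, mul_smul, e, norm_smul, norm_inv, norm_norm, inv_mul_cancel₀ hn]
  · rw [mul_smul, mul_smul, e] at h0
    refine hz (W p) (Or.inr ⟨p, hp, rfl⟩) ?_
    change f z ∈ Submodule.span ℝ {p.1, p.2}
    rw [Submodule.mem_span_pair]
    refine ⟨‖f z‖ * r₁, ‖f z‖ * r₂, ?_⟩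
    rw [mul_smul, mul_smul, ← smul_add, ← h0, smul_smul, mul_inv_cancel₀ hn, one_smul]

end Avoid

/-- Homotopy through closed paths. -/
abbrev ClosedHomotopic {X : Type*} [TopologicalSpace X] (f g : C(I, X)) : Prop :=
  ContinuousMap.HomotopicWith f g (fun f => f 0 = f 1)

theorem closedHomotopic_of_map {X : Type*} [TopologicalSpace X] {f g : C(I, X)} (F : I × I → X)
    (hF : Continuous F) (h0 : ∀ t, F (0, t) = f t) (h1 : ∀ t, F (1, t) = g t)
    (hc : ∀ s, F (s, 0) = F (s, 1)) : ClosedHomotopic f g :=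
  ⟨⟨⟨⟨F, hF⟩, h0, h1⟩, hc⟩⟩

/-! ### Loops of finite unitary matrices, one basis vector at a time -/

section Finite

variable {K : Type*} [NormedAddCommGroup K] [InnerProductSpace ℂ K] [CompleteSpace K] {ι : Type*}
  (b : HilbertBasis ι ℂ K) (S : Finset ι)

open InnerProductSpace (rankOne)

/-- Unitary operators fixing the members of the Hilbert basis `b` outside `S`. -/
def UFin : Set (K →L[ℂ] K) := {U | U ∈ unitary (K →L[ℂ] K) ∧ ∀ i ∉ S, U (b i) = b i}

variable {b S}

omit [CompleteSpace K] in
theorem clm_ext_basis {A B : K →L[ℂ] K} (h : ∀ i, A (b i) = B (b i)) : A = B := by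
  refine ContinuousLinearMap.ext_on (s := Set.range b) ?_ (by rintro _ ⟨i, rfl⟩; exact h i)
  rw [Submodule.dense_iff_topologicalClosure_eq_top]
  exact b.dense_span

theorem mul_mem_UFin {U V : K →L[ℂ] K} (hU : U ∈ UFin b S) (hV : V ∈ UFin b S) :
    U * V ∈ UFin b S :=
  ⟨mul_mem hU.1 hV.1, fun i hi => by rw [mul_apply_eq_comp, hV.2 i hi, hU.2 i hi]⟩

theorem star_mem_UFin {U : K →L[ℂ] K} (hU : U ∈ UFin b S) : star U ∈ UFin b S :=
  ⟨Unitary.star_mem hU.1, fun i hi => by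
    have := congrArg (fun T : K →L[ℂ] K => T (b i)) (Unitary.mem_iff.1 hU.1).1
    simpa [hU.2 i hi] using this⟩

theorem inner_apply_of_mem_UFin {U : K →L[ℂ] K} (hU : U ∈ UFin b S) {i : ι} (hi : i ∉ S) (x : K) :
    inner ℂ (b i) (U x) = inner ℂ (b i) x := by
  conv_lhs => rw [← hU.2 i hi]
  exact unitary_inner_map hU.1 _ _

theorem UFin_subset_UFred : UFin b S ⊆ UFred K := fun U hU => by
  refine mem_UFred_of_finiteRange hU.1 ?_
  have : U - 1 = (U - 1) * bproj b S := by
    refine clm_ext_basis (b := b) fun i => ?_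
    by_cases hi : i ∈ S
    · rw [mul_apply_eq_comp, bproj_of_mem b S hi]
    · rw [mul_apply_eq_comp, bproj_of_notMem b S hi]
      simp [hU.2 i hi]
  rw [this]
  exact (hasFiniteRange_bproj b S).comp_left _

theorem rot_mem_UFin {x y : K} (hx : ‖x‖ = 1) (hy : ‖y‖ = 1) (h : y ≠ -x)
    (hxS : ∀ i ∉ S, inner ℂ (b i) x = 0) (hyS : ∀ i ∉ S, inner ℂ (b i) y = 0) :
    rot x y ∈ UFin b S := by
  refine ⟨rot_mem_unitary hx hy h, fun i hi => rot_apply_of_inner_eq_zero ?_ ?_⟩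
  · rw [← inner_conj_symm, hxS i hi, map_zero]
  · rw [← inner_conj_symm, hyS i hi, map_zero]

omit [CompleteSpace K] in
theorem mob_apply_of_fixed {P U : K →L[ℂ] K} {r : ℝ} {x : K}
    (hu : IsUnit (1 + (r : ℂ) • ((1 - P) * U))) (hP : P x = x) (hU : U x = x) :
    mob P U r x = x := by
  have hD : mobD P r x = x := by simp [mobD, hP]
  have hZ : Ring.inverse (1 + (r : ℂ) • ((1 - P) * U)) x = x := by
    have h1 : (1 + (r : ℂ) • ((1 - P) * U)) x = x := by simp [hU, hP]
    have := congrArg (fun T : K →L[ℂ] K => T x) (Ring.inverse_mul_cancel _ hu)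
    rw [mul_apply_eq_comp, h1] at this
    exact this
  simp only [mob, add_apply, mul_apply_eq_comp, smul_apply, sub_apply, one_apply_eq_self, hD, hZ,
    hP, hU, sub_self, smul_zero, zero_add]

/-- A loop that never maps the unit vector `b j` to `-b j` contracts to a loop fixing `b j`. -/
theorem exists_homotopic_fixing {j : ι} (hj : j ∈ S) [DecidableEq ι] (u : C(I, UFin b S))
    (hu : u 0 = u 1) (hne : ∀ t, (u t : K →L[ℂ] K) (b j) ≠ -b j) :
    ∃ u' : C(I, UFin b S), ClosedHomotopic u u' ∧ ∀ t, (u' t : K →L[ℂ] K) ∈ UFin b (S.erase j) := by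
  set P : K →L[ℂ] K := 1 - rankOne ℂ (b j) (b j) with hPdef
  have hb : ∀ i, ‖b i‖ = 1 := b.orthonormal.norm_eq_one
  have hP : IsStarProjection P := by
    refine IsStarProjection.one_sub ⟨?_, ?_⟩
    · exact InnerProductSpace.isIdempotentElem_rankOne_self (hb j)
    · rw [isSelfAdjoint_iff, ContinuousLinearMap.star_eq_adjoint, InnerProductSpace.adjoint_rankOne]
  have hPj : P (b j) = 0 := by simp [hPdef, hb j]
  have hPi : ∀ i, i ≠ j → P (b i) = b i := fun i hi => by
    simp [hPdef, b.orthonormal.2 (Ne.symm hi)]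
  -- Here 1 − P = b_j b_j*. After swapping factors this concerns 1 + R with R = (u b_j) b_j* and R²
  -- = ⟨b_j, u b_j⟩ R, which is invertible because 1 + ⟨b_j, u b_j⟩ ≠ 0.
  have hunit : ∀ t, IsUnit (1 + (1 - P) * (u t : K →L[ℂ] K)) := fun t => by
    have hz : 1 + inner ℂ (b j) ((u t : K →L[ℂ] K) (b j)) ≠ 0 := by
      have h1 : (‖(u t : K →L[ℂ] K) (b j)‖ : ℝ) = 1 := by rw [unitary_norm_map (u t).2.1, hb]
      refine one_add_inner_ne_zero h1 (hb j) fun h => hne t ?_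
      exact (neg_eq_iff_eq_neg.2 h).symm
    have h2 : (1 + (1 - P) * (u t : K →L[ℂ] K)) =
        1 + rankOne ℂ (b j) (b j) * (u t : K →L[ℂ] K) := by rw [hPdef, sub_sub_cancel]
    rw [h2]
    refine isUnit_one_add_mul_swap ?_
    have h3 : ∀ w : ℂ, (1 + (u t : K →L[ℂ] K) * rankOne ℂ (b j) (b j)) *
        (1 + w • ((u t : K →L[ℂ] K) * rankOne ℂ (b j) (b j))) = 1 +
        (1 + w + w * inner ℂ (b j) ((u t : K →L[ℂ] K) (b j))) •
          ((u t : K →L[ℂ] K) * rankOne ℂ (b j) (b j)) ∧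
        (1 + w • ((u t : K →L[ℂ] K) * rankOne ℂ (b j) (b j))) *
        (1 + (u t : K →L[ℂ] K) * rankOne ℂ (b j) (b j)) = 1 +
        (1 + w + w * inner ℂ (b j) ((u t : K →L[ℂ] K) (b j))) •
          ((u t : K →L[ℂ] K) * rankOne ℂ (b j) (b j)) := fun w => by
      have hm : ((u t : K →L[ℂ] K) * rankOne ℂ (b j) (b j)) * ((u t : K →L[ℂ] K) *
          rankOne ℂ (b j) (b j)) = inner ℂ (b j) ((u t : K →L[ℂ] K) (b j)) •
            ((u t : K →L[ℂ] K) * rankOne ℂ (b j) (b j)) := by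
        ext x
        simp [smul_smul, mul_comm]
      generalize (u t : K →L[ℂ] K) * rankOne ℂ (b j) (b j) = R at hm
      constructor
      · simp only [mul_add, add_mul, mul_one, one_mul, Algebra.mul_smul_comm, hm]; module
      · simp only [mul_add, add_mul, mul_one, one_mul, Algebra.smul_mul_assoc, hm]; module
    have h4 : 1 + -(1 + inner ℂ (b j) ((u t : K →L[ℂ] K) (b j)))⁻¹ +
        -(1 + inner ℂ (b j) ((u t : K →L[ℂ] K) (b j)))⁻¹ *
          inner ℂ (b j) ((u t : K →L[ℂ] K) (b j)) = 0 := by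
      field_simp; ring
    obtain ⟨h5, h6⟩ := h3 (-(1 + inner ℂ (b j) ((u t : K →L[ℂ] K) (b j)))⁻¹)
    rw [h4, zero_smul, add_zero] at h5 h6
    exact ⟨⟨_, _, h5, h6⟩, rfl⟩
  have hunit' : ∀ (s t : I), IsUnit (1 + ((s : ℝ) : ℂ) • ((1 - P) * (u t : K →L[ℂ] K))) :=
    fun s t => isUnit_one_add_smul hP (u t).2.1 (hunit t) s.2
  have hmem : ∀ s t : I, mob P (u t : K →L[ℂ] K) s ∈ UFin b S := fun s t => by
    refine ⟨mob_mem_unitary hP (u t).2.1 s.2 (hunit' s t), fun i hi => ?_⟩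
    exact mob_apply_of_fixed (hunit' s t) (hPi i fun h => hi (h ▸ hj)) ((u t).2.2 i hi)
  have hcu : Continuous fun x : I × I => (u x.2 : K →L[ℂ] K) :=
    continuous_subtype_val.comp (u.continuous.comp continuous_snd)
  have hc : Continuous fun x : I × I => mob P (u x.2 : K →L[ℂ] K) x.1 :=
    continuous_mob P hcu (by fun_prop) fun x => hunit' x.1 x.2
  refine ⟨⟨fun t => ⟨mob P (u t : K →L[ℂ] K) (1 : I), hmem 1 t⟩, ?_⟩, ?_, fun t => ?_⟩
  · exact Continuous.subtype_mk (hc.comp (continuous_const.prodMk continuous_id)) _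
  · refine closedHomotopic_of_map (fun x => ⟨mob P (u x.2 : K →L[ℂ] K) x.1, hmem x.1 x.2⟩)
      (hc.subtype_mk _) (fun t => ?_) (fun t => ?_) (fun s => ?_)
    · exact Subtype.ext mob_zero
    · rfl
    · exact Subtype.ext (by simp only [hu])
  · refine ⟨(hmem 1 t).1, fun i hi => ?_⟩
    rw [Finset.mem_erase, not_and_or, not_not] at hi
    rcases hi with rfl | hi
    · exact mob_one_apply hPj
    · exact (hmem 1 t).2 i hi

omit [CompleteSpace K] in
theorem inner_basis_of_notMem {i j : ι} (hj : j ∈ S) (hi : i ∉ S) : inner ℂ (b i) (b j) = 0 :=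
  b.orthonormal.2 fun h => hi (h ▸ hj)

theorem inner_curve {u : K →L[ℂ] K} (hu : u ∈ UFin b S) {j : ι} (hj : j ∈ S) {i : ι} (hi : i ∉ S) :
    inner ℂ (b i) (u (b j)) = 0 := by
  rw [inner_apply_of_mem_UFin hu hi]
  exact inner_basis_of_notMem hj hi

/-- A loop can be deformed into one that moves the vector `b j` along a prescribed nearby curve. -/
theorem exists_homotopic_curve {j : ι} (hj : j ∈ S) (u : C(I, UFin b S)) (hu : u 0 = u 1)
    (c : C(I, K)) (hc : c 0 = c 1) (hc1 : ∀ t, ‖c t‖ = 1)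
    (hcS : ∀ t, ∀ i ∉ S, inner ℂ (b i) (c t) = 0)
    (hne : ∀ t, c t ≠ -((u t : K →L[ℂ] K) (b j))) :
    ∃ u' : C(I, UFin b S), ClosedHomotopic u u' ∧ u' 0 = u' 1 ∧
      ∀ t, (u' t : K →L[ℂ] K) (b j) = c t := by
  have hv1 : ∀ t, ‖(u t : K →L[ℂ] K) (b j)‖ = 1 := fun t => by
    rw [unitary_norm_map (u t).2.1, b.orthonormal.norm_eq_one]
  have hcu : Continuous fun x : I × I => (u x.2 : K →L[ℂ] K) :=
    continuous_subtype_val.comp (u.continuous.comp continuous_snd)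
  have hcv : Continuous fun x : I × I => (u x.2 : K →L[ℂ] K) (b j) := hcu.clm_apply continuous_const
  have hcc : Continuous fun x : I × I => c x.2 := c.continuous.comp continuous_snd
  have hcs : Continuous fun x : I × I => seg ((u x.2 : K →L[ℂ] K) (b j)) (c x.2) x.1 :=
    continuous_seg hcv hcc (by fun_prop) (fun x => hv1 _) (fun x => hc1 _) fun x => hne _
  have hsn : ∀ x : I × I, ‖seg ((u x.2 : K →L[ℂ] K) (b j)) (c x.2) x.1‖ = 1 := fun x =>
    norm_seg (hv1 _) (hc1 _) (hne _)
  have hsne : ∀ x : I × I, seg ((u x.2 : K →L[ℂ] K) (b j)) (c x.2) x.1 ≠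
      -((u x.2 : K →L[ℂ] K) (b j)) := fun x => seg_ne_neg (hv1 _) (hc1 _) (hne _) x.1.2
  -- Follow u by the rotation that carries u b_j along the arc towards c. It is the identity at time
  -- 0 and fixes the basis vectors outside S.
  let F : I × I → K →L[ℂ] K := fun x =>
    rot ((u x.2 : K →L[ℂ] K) (b j)) (seg ((u x.2 : K →L[ℂ] K) (b j)) (c x.2) x.1) *
      (u x.2 : K →L[ℂ] K)
  have hF : Continuous F := (continuous_rot hcv hcs (fun x => hv1 _) hsn hsne).mul hcu
  have hFm : ∀ x, F x ∈ UFin b S := fun x => by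
    refine mul_mem_UFin (rot_mem_UFin (hv1 _) (hsn x) (hsne x) ?_ ?_) (u x.2).2
    · exact fun i hi => inner_curve (u x.2).2 hj hi
    · exact fun i hi => inner_seg (inner_curve (u x.2).2 hj hi) (hcS _ i hi)
  have hFcl : ∀ s, F (s, 0) = F (s, 1) := fun s => by simp only [F, hu, hc]
  refine ⟨⟨fun t => ⟨F (1, t), hFm _⟩, ?_⟩, ?_, ?_, fun t => ?_⟩
  · exact Continuous.subtype_mk (hF.comp (continuous_const.prodMk continuous_id)) _
  · refine closedHomotopic_of_map (fun x => ⟨F x, hFm x⟩) (hF.subtype_mk _) (fun t => ?_)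
      (fun t => rfl) (fun s => Subtype.ext (hFcl s))
    refine Subtype.ext ?_
    simp only [F, Set.Icc.coe_zero, seg_zero (hv1 t), rot_self (hv1 t), one_mul]
  · exact Subtype.ext (hFcl 1)
  · simp only [F, ContinuousMap.coe_mk, Set.Icc.coe_one, seg_one (hc1 t), mul_apply_eq_comp]
    exact rot_apply_left (hv1 t) (hc1 t) (hne t)

/-- A loop of unitary matrices can be deformed into one fixing a prescribed basis vector. -/
theorem exists_homotopic_erase {i₀ j : ι} [DecidableEq ι] (hi₀ : i₀ ∈ S) (hj : j ∈ S) (hij : i₀ ≠ j)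
    (u : C(I, UFin b S)) (hu : u 0 = u 1) :
    ∃ u' : C(I, UFin b S), ClosedHomotopic u u' ∧ ∀ t, (u' t : K →L[ℂ] K) ∈ UFin b (S.erase j) := by
  classical
  have hb : ∀ i, ‖b i‖ = 1 := b.orthonormal.norm_eq_one
  have hv1 : ∀ t, ‖(u t : K →L[ℂ] K) (b j)‖ = 1 := fun t => by
    rw [unitary_norm_map (u t).2.1, hb]
  let v : C(I, K) := ⟨fun t => (u t : K →L[ℂ] K) (b j),
    (continuous_subtype_val.comp u.continuous).clm_apply continuous_const⟩
  obtain ⟨s, c, hcv, hc0, hc1, hcs⟩ := exists_polygon v (by norm_num : (0 : ℝ) < 1 / 2)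
  -- The polygon lies in finitely many real planes, so some unit vector w in the complex plane of
  -- b_{i₀} and b_j is missed even after normalizing the polygon. The extra pair (b_j, b_j) ensures
  -- w ≠ b_j, so that w can be rotated to −b_j along an arc.
  obtain ⟨w₁, w₂, hw1, hw⟩ := exists_notMem_real_planes (hb i₀) (hb j) (b.orthonormal.2 hij)
    (insert (b j, b j) (s.image fun p => (v p.1, v p.2)))
  set w := w₁ • b i₀ + w₂ • b j with hwdef
  have hwS : ∀ i ∉ S, inner ℂ (b i) w = 0 := fun i hi => by
    rw [hwdef, inner_add_right, inner_smul_right, inner_smul_right,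
      inner_basis_of_notMem hi₀ hi, inner_basis_of_notMem hj hi]
    simp
  have hwj : w ≠ b j := fun h => hw _ (Finset.mem_insert_self _ _) 1 0 (by simpa using h)
  have hcS : ∀ t, ∀ i ∉ S, inner ℂ (b i) (c t) = 0 := fun t i hi => by
    obtain ⟨p, _, r₁, r₂, h⟩ := hcs t
    rw [h, inner_add_right, inner_smul_right_eq_smul, inner_smul_right_eq_smul]
    simp only [v, ContinuousMap.coe_mk, inner_curve (u _).2 hj hi, smul_zero, add_zero]
  have hcn : ∀ t, 1 / 2 < ‖c t‖ := fun t => by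
    have h1 := hcv t
    have h2 : ‖v t‖ = 1 := hv1 t
    have h3 := norm_sub_norm_le (v t) (c t)
    rw [norm_sub_rev] at h3
    linarith
  let c' : C(I, K) := ⟨fun t => (‖c t‖⁻¹ : ℝ) • c t,
    (c.continuous.norm.inv₀ fun t => (by linarith [hcn t] : ‖c t‖ ≠ 0)).smul c.continuous⟩
  have hc'1 : ∀ t, ‖c' t‖ = 1 := fun t => by
    change ‖(‖c t‖⁻¹ : ℝ) • c t‖ = 1
    rw [norm_smul, norm_inv, norm_norm, inv_mul_cancel₀ (by linarith [hcn t])]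
  have hc'w : ∀ t, c' t ≠ w := fun t h => by
    obtain ⟨p, hp, r₁, r₂, h'⟩ := hcs t
    refine hw _ (Finset.mem_insert_of_mem (Finset.mem_image_of_mem _ hp)) (‖c t‖⁻¹ * r₁)
      (‖c t‖⁻¹ * r₂) ?_
    rw [← h, mul_smul, mul_smul, ← smul_add, ← h']; rfl
  have hc'S : ∀ t, ∀ i ∉ S, inner ℂ (b i) (c' t) = 0 := fun t i hi => by
    change inner ℂ (b i) ((‖c t‖⁻¹ : ℝ) • c t) = 0
    rw [inner_smul_right_eq_smul, hcS t i hi, smul_zero]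
  -- If c/‖c‖ were antipodal to the unit vector v, then ‖c − v‖ = ‖c‖ + 1, contrary to ‖c − v‖ <
  -- 1/2.
  have hc'ne : ∀ t, c' t ≠ -((u t : K →L[ℂ] K) (b j)) := fun t h => by
    have h1 : c t = -(‖c t‖ • v t) := by
      have : ‖c t‖ • c' t = -(‖c t‖ • v t) := by rw [h, smul_neg]; rfl
      rw [← this]
      change c t = ‖c t‖ • (‖c t‖⁻¹ : ℝ) • c t
      rw [smul_smul, mul_inv_cancel₀ (by linarith [hcn t]), one_smul]
    have h2 : c t - v t = -((‖c t‖ + 1) • v t) := by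
      conv_lhs => rw [h1]
      module
    have h3 := hcv t
    have h4 : ‖v t‖ = 1 := hv1 t
    rw [h2, norm_neg, norm_smul, h4, Real.norm_of_nonneg (by linarith [hcn t])] at h3
    linarith [hcn t]
  obtain ⟨u₁, hu₁, hcl₁, hu₁c⟩ := exists_homotopic_curve hj u hu c'
    (by
      have : c 0 = c 1 := by
        rw [hc0, hc1]; change (u 0 : K →L[ℂ] K) (b j) = (u 1 : K →L[ℂ] K) (b j); rw [hu]
      change (‖c 0‖⁻¹ : ℝ) • c 0 = (‖c 1‖⁻¹ : ℝ) • c 1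
      rw [this]) hc'1 hc'S hc'ne
  have hnj : ‖-b j‖ = 1 := by rw [norm_neg, hb]
  have hnwj : -b j ≠ -w := fun h => hwj (neg_injective h).symm
  have hjS : ∀ i ∉ S, inner ℂ (b i) (-b j) = 0 := fun i hi => by
    rw [inner_neg_right, inner_basis_of_notMem hj hi, neg_zero]
  -- G(1) carries w to −b_j. The curve c' avoids w, so after composing with G(1) the image of b_j
  -- avoids −b_j and the Möbius contraction applies.
  let G : I → K →L[ℂ] K := fun s => rot w (seg w (-b j) s)
  have hGm : ∀ s, G s ∈ UFin b S := fun s =>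
    rot_mem_UFin hw1 (norm_seg hw1 hnj hnwj) (seg_ne_neg hw1 hnj hnwj s.2) hwS
      fun i hi => inner_seg (hwS i hi) (hjS i hi)
  have hGc : Continuous G := continuous_rot continuous_const
    (continuous_seg continuous_const continuous_const (by fun_prop) (fun _ => hw1) (fun _ => hnj)
      fun _ => hnwj) (fun _ => hw1) (fun s => norm_seg hw1 hnj hnwj)
      fun s => seg_ne_neg hw1 hnj hnwj s.2
  have hu₁t : Continuous fun t => (u₁ t : K →L[ℂ] K) := continuous_subtype_val.comp u₁.continuous
  let u₂ : C(I, UFin b S) := ⟨fun t => ⟨G 1 * u₁ t, mul_mem_UFin (hGm 1) (u₁ t).2⟩,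
    (continuous_const.mul hu₁t).subtype_mk _⟩
  have hu₂ : ClosedHomotopic u₁ u₂ := by
    refine closedHomotopic_of_map (fun x => ⟨G x.1 * u₁ x.2, mul_mem_UFin (hGm _) (u₁ _).2⟩)
      (((hGc.comp continuous_fst).mul (hu₁t.comp continuous_snd)).subtype_mk _) (fun t => ?_)
      (fun t => rfl) (fun s => Subtype.ext (by simp only [hcl₁]))
    refine Subtype.ext ?_
    simp only [G, Set.Icc.coe_zero, seg_zero hw1, rot_self hw1, one_mul]
  have hG1 : G 1 w = -b j := by
    simp only [G, Set.Icc.coe_one, seg_one hnj]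
    exact rot_apply_left hw1 hnj hnwj
  obtain ⟨u₃, hu₃, hu₃m⟩ := exists_homotopic_fixing hj u₂
    (Subtype.ext (by simp only [u₂, ContinuousMap.coe_mk, hcl₁])) fun t h => hc'w t (by
      have h1 : G 1 (c' t) = G 1 w := by
        rw [hG1, ← h, ← hu₁c]; rfl
      have h2 : ‖G 1 (c' t - w)‖ = 0 := by rw [map_sub, h1, sub_self, norm_zero]
      rw [unitary_norm_map (hGm 1).1, norm_eq_zero, sub_eq_zero] at h2
      exact h2)
  exact ⟨u₃, hu₁.trans (hu₂.trans hu₃), hu₃m⟩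

end Finite

theorem ClosedHomotopic.map {X Y : Type*} [TopologicalSpace X] [TopologicalSpace Y] {f g : C(I, X)}
    (h : ClosedHomotopic f g) (k : C(X, Y)) : ClosedHomotopic (k.comp f) (k.comp g) := by
  obtain ⟨F⟩ := h
  exact closedHomotopic_of_map (fun x => k (F x)) (k.continuous.comp F.continuous)
    (fun t => congrArg k (F.apply_zero t)) (fun t => congrArg k (F.apply_one t))
    fun s => congrArg k (F.prop s)

theorem ClosedHomotopic.closed_right {X : Type*} [TopologicalSpace X] {f g : C(I, X)}
    (h : ClosedHomotopic f g) : g 0 = g 1 := by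
  obtain ⟨F⟩ := h
  rw [← F.apply_one, ← F.apply_one]
  exact F.prop 1

theorem homotopic_of_map {X : Type*} [TopologicalSpace X] {a b : X} {p q : Path a b}
    (F : I × I → X) (hF : Continuous F) (h0 : ∀ t, F (0, t) = p t) (h1 : ∀ t, F (1, t) = q t)
    (hl : ∀ s, F (s, 0) = a) (hr : ∀ s, F (s, 1) = b) : p.Homotopic q :=
  ⟨{ toFun := F
     continuous_toFun := hF
     map_zero_left := h0
     map_one_left := h1
     prop' := fun s t ht => by
       rcases ht with rfl | rfl
       · exact (hl s).trans p.source.symm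
       · exact (hr s).trans p.target.symm }⟩

theorem closedHomotopic_of_homotopic {X : Type*} [TopologicalSpace X] {a : X} {p q : Path a a}
    (h : p.Homotopic q) : ClosedHomotopic p.toContinuousMap q.toContinuousMap := by
  obtain ⟨F⟩ := h
  exact closedHomotopic_of_map F F.continuous F.apply_zero F.apply_one fun s => by
    rw [F.source, F.target]

/-! ### Standard loops, and reduction of all loops to them -/

section Loops

variable {K : Type*} [NormedAddCommGroup K] [InnerProductSpace ℂ K] [CompleteSpace K]

theorem one_add_smul_mem_unitary {p : K →L[ℂ] K} (hp : IsStarProjection p) {z : ℂ} (hz : ‖z‖ = 1) :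
    1 + (z - 1) • p ∈ unitary (K →L[ℂ] K) := by
  have hpp := hp.isIdempotentElem.eq
  have hs : star (1 + (z - 1) • p) = 1 + ((starRingEnd ℂ) z - 1) • p := by
    rw [star_add, star_one, star_smul, hp.isSelfAdjoint.star_eq, star_sub, star_one]; rfl
  have hzz : (starRingEnd ℂ) z * z = 1 := by
    rw [mul_comm, Complex.mul_conj, Complex.normSq_eq_norm_sq, hz]; simp
  rw [Unitary.mem_iff, hs]
  constructor
  · simp only [mul_add, add_mul, mul_one, one_mul, Algebra.mul_smul_comm, Algebra.smul_mul_assoc, hpp]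
    trans (1 : K →L[ℂ] K) + ((starRingEnd ℂ) z * z - 1) • p
    · module
    · rw [hzz]; simp
  · simp only [mul_add, add_mul, mul_one, one_mul, Algebra.mul_smul_comm, Algebra.smul_mul_assoc, hpp]
    trans (1 : K →L[ℂ] K) + ((starRingEnd ℂ) z * z - 1) • p
    · module
    · rw [hzz]; simp

theorem one_add_smul_mem_UFred {p : K →L[ℂ] K} (hp : IsStarProjection p)
    (hpf : (p : K →ₗ[ℂ] K).HasFiniteRange) {z : ℂ} (hz : ‖z‖ = 1) :
    1 + (z - 1) • p ∈ UFred K := by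
  refine mem_UFred_of_finiteRange (one_add_smul_mem_unitary hp hz) ?_
  have : 1 + (z - 1) • p - 1 = p * ((z - 1) • (1 : K →L[ℂ] K)) := by
    rw [Algebra.mul_smul_comm, mul_one]; abel
  rw [this]
  exact hpf.comp_right _

variable (K) in
/-- The identity as a point of `UFred K`. -/
def oneUFred : UFred K := ⟨1, UStar_subset_UFred one_mem_UStar⟩

theorem norm_exp_two_pi (n : ℤ) (t : ℝ) :
    ‖Complex.exp (2 * Real.pi * Complex.I * n * t)‖ = 1 := by
  have : 2 * Real.pi * Complex.I * n * t = ((2 * Real.pi * n * t : ℝ) : ℂ) * Complex.I := by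
    push_cast; ring
  rw [this, Complex.norm_exp_ofReal_mul_I]

theorem exp_two_pi_one (n : ℤ) : Complex.exp (2 * Real.pi * Complex.I * n * (1 : ℝ)) = 1 := by
  have : 2 * Real.pi * Complex.I * n * (1 : ℝ) = n * (2 * Real.pi * Complex.I) := by
    push_cast; ring
  rw [this, Complex.exp_int_mul_two_pi_mul_I]

/-- The loop `1 + (e^{2πint} - 1) p`. -/
def projLoop (p : K →L[ℂ] K) (hp : IsStarProjection p) (hpf : (p : K →ₗ[ℂ] K).HasFiniteRange)
    (n : ℤ) : Path (oneUFred K) (oneUFred K) where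
  toFun t := ⟨1 + (Complex.exp (2 * Real.pi * Complex.I * n * (t : ℝ)) - 1) • p,
    one_add_smul_mem_UFred hp hpf (norm_exp_two_pi n t)⟩
  continuous_toFun := by
    refine Continuous.subtype_mk ?_ _
    fun_prop
  source' := Subtype.ext (by simp [oneUFred])
  target' := Subtype.ext (by
    have := exp_two_pi_one n
    simp only [Set.Icc.coe_one, this, sub_self, zero_smul, add_zero, oneUFred])

theorem exists_sum_of_finiteRange {p : K →L[ℂ] K} (hp : IsStarProjection p)
    (hpf : (p : K →ₗ[ℂ] K).HasFiniteRange) :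
    ∃ f : Fin (Module.finrank ℂ p.range) → K, (∀ k, ‖f k‖ = 1) ∧
      ∀ v, p v = ∑ k, inner ℂ (f k) v • f k := by
  have hfin : FiniteDimensional ℂ p.range := (Submodule.fg_iff_finiteDimensional _).1 hpf
  let e := stdOrthonormalBasis ℂ p.range
  have hpe : ∀ k, p (e k : K) = e k := fun k => by
    obtain ⟨x, hx⟩ := (e k).2
    have hx' : p x = e k := hx
    rw [← hx', starProj_idem hp]
  refine ⟨fun k => e k, fun k => e.orthonormal.norm_eq_one k, fun v => ?_⟩
  have h1 := e.sum_repr' ⟨p v, ⟨v, rfl⟩⟩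
  have h2 := congrArg Subtype.val h1
  simp only [Submodule.coe_sum, Submodule.coe_smul, Submodule.coe_inner] at h2
  rw [← h2]
  refine Finset.sum_congr rfl fun k _ => ?_
  rw [← starProj_inner hp, hpe]

theorem isTraceClass_proj {p : K →L[ℂ] K} (hp : IsStarProjection p)
    (hpf : (p : K →ₗ[ℂ] K).HasFiniteRange) : IsTraceClass p := by
  obtain ⟨f, _, h⟩ := exists_sum_of_finiteRange hp hpf
  exact isTraceClass_of_eq_sum h

theorem trace_smul_proj {p : K →L[ℂ] K} (hp : IsStarProjection p)
    (hpf : (p : K →ₗ[ℂ] K).HasFiniteRange) (z : ℂ) :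
    trace (z • p) = z * Module.finrank ℂ p.range := by
  obtain ⟨f, hf, h⟩ := exists_sum_of_finiteRange hp hpf
  have h1 : HasSum (fun i => inner ℂ (traceBasis K i) ((z • p) (traceBasis K i)))
      (∑ k, z * inner ℂ (f k) (f k)) := by
    have : ∀ i, inner ℂ (traceBasis K i) ((z • p) (traceBasis K i)) =
        ∑ k, z * (inner ℂ (f k) (traceBasis K i) * inner ℂ (traceBasis K i) (f k)) := fun i => by
      rw [smul_apply, h, inner_smul_right, inner_sum, Finset.mul_sum]
      simp only [inner_smul_right]
    simp only [this]
    exact hasSum_sum fun k _ => ((traceBasis K).hasSum_inner_mul_inner (f k) (f k)).mul_left z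
  have h2 : trace (z • p) = _ := h1.tsum_eq
  rw [h2, Finset.sum_congr rfl fun k _ => by rw [inner_self_eq_one (hf k)]]
  simp
  ring

/-- All differences are scalars times the fixed trace class operator p, so trace norm convergence is
convergence of scalars. -/
theorem isC1TraceLoop_proj {p : K →L[ℂ] K} (hp : IsStarProjection p)
    (hpf : (p : K →ₗ[ℂ] K).HasFiniteRange) (n : ℤ) :
    IsC1TraceLoop (fun t : ℝ => 1 + (Complex.exp (2 * Real.pi * Complex.I * n * t) - 1) • p)
      (fun t : ℝ => (Complex.exp (2 * Real.pi * Complex.I * n * t) *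
        (2 * Real.pi * Complex.I * n)) • p) := by
  have hT := isTraceClass_proj hp hpf
  have key : ∀ {l : Filter ℝ} {w : ℝ → ℂ}, Filter.Tendsto w l (𝓝 0) →
      Filter.Tendsto (fun s => traceNorm (w s • p)) l (𝓝 0) := fun {l w} hw => by
    have h1 : Filter.Tendsto (fun s => ‖w s‖ₑ * traceNorm p) l (𝓝 (‖(0 : ℂ)‖ₑ * traceNorm p)) :=
      ENNReal.Tendsto.mul_const hw.enorm (Or.inr hT.ne)
    rw [enorm_zero, zero_mul] at h1
    exact tendsto_of_tendsto_of_tendsto_of_le_of_le tendsto_const_nhds h1 (fun _ => zero_le)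
      fun s => traceNorm_smul_le _ _
  refine ⟨fun t _ => one_add_smul_mem_unitary hp (norm_exp_two_pi n t), fun t _ => ?_, ?_,
    fun t _ => ?_, fun t _ => ?_⟩
  · rw [add_sub_cancel_left]; exact hT.smul _
  · have := exp_two_pi_one n
    simp only [this]; simp
  · have hd : HasDerivAt (fun t : ℝ => Complex.exp (2 * Real.pi * Complex.I * n * t))
        (Complex.exp (2 * Real.pi * Complex.I * n * t) * (2 * Real.pi * Complex.I * n)) t := by
      have := ((Complex.ofRealCLM.hasDerivAt (x := t)).const_mul (2 * Real.pi * Complex.I * n)).cexp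
      simpa using this
    have h1 := (hasDerivWithinAt_iff_tendsto_slope.1 (hd.hasDerivWithinAt (s := Set.Icc 0 1)))
    have h2 := key (l := 𝓝[Set.Icc 0 1 \ {t}] t)
      (w := fun s => slope (fun t : ℝ => Complex.exp (2 * Real.pi * Complex.I * n * t)) t s -
        Complex.exp (2 * Real.pi * Complex.I * n * t) * (2 * Real.pi * Complex.I * n)) (by
        have := h1.sub_const (Complex.exp (2 * Real.pi * Complex.I * n * t) *
          (2 * Real.pi * Complex.I * n))
        rwa [sub_self] at this)
    refine h2.congr fun s => ?_
    congr 1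
    rw [slope_def_module, ← Complex.coe_smul, smul_eq_mul]
    push_cast
    module
  · have hc : Continuous fun t : ℝ => Complex.exp (2 * Real.pi * Complex.I * n * t) *
      (2 * Real.pi * Complex.I * n) := by fun_prop
    have := key (w := fun s : ℝ => Complex.exp (2 * Real.pi * Complex.I * n * s) *
      (2 * Real.pi * Complex.I * n) - Complex.exp (2 * Real.pi * Complex.I * n * t) *
      (2 * Real.pi * Complex.I * n)) (l := 𝓝[Set.Icc 0 1] t) (by
        have := (hc.tendsto t).sub_const (Complex.exp (2 * Real.pi * Complex.I * n * t) *
          (2 * Real.pi * Complex.I * n))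
        rw [sub_self] at this
        exact this.mono_left nhdsWithin_le_nhds)
    simpa only [sub_smul] using this

/-- The integrand is constant: g*g' = 2πin p, whose trace is 2πin times the rank of p. -/
theorem hasLoopWinding_projLoop {p : K →L[ℂ] K} (hp : IsStarProjection p)
    (hpf : (p : K →ₗ[ℂ] K).HasFiniteRange) (n : ℤ) :
    HasLoopWinding (projLoop p hp hpf n) (n * Module.finrank ℂ p.range) := by
  refine ⟨_, projLoop p hp hpf n, _, _, isC1TraceLoop_proj hp hpf n, fun t => rfl,
    .refl _ (by simp), ?_⟩
  have e : ∀ t : ℝ, star (1 + (Complex.exp (2 * Real.pi * Complex.I * n * t) - 1) • p) *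
      ((Complex.exp (2 * Real.pi * Complex.I * n * t) * (2 * Real.pi * Complex.I * n)) • p) =
      (2 * Real.pi * Complex.I * n) • p := fun t => by
    have hz := norm_exp_two_pi n t
    set z := Complex.exp (2 * Real.pi * Complex.I * n * t)
    have hzz : (starRingEnd ℂ) z * z = 1 := by
      rw [mul_comm, Complex.mul_conj, Complex.normSq_eq_norm_sq, hz]; simp
    have hs : star (1 + (z - 1) • p) = 1 + ((starRingEnd ℂ) z - 1) • p := by
      rw [star_add, star_one, star_smul, hp.isSelfAdjoint.star_eq, star_sub, star_one]; rfl
    rw [hs]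
    simp only [add_mul, one_mul, Algebra.mul_smul_comm, Algebra.smul_mul_assoc,
      hp.isIdempotentElem.eq]
    trans (((starRingEnd ℂ) z * z) * (2 * Real.pi * Complex.I * n)) • p
    · module
    · rw [hzz, one_mul]
  simp only [e, trace_smul_proj hp hpf]
  rw [intervalIntegral.integral_const, sub_zero, one_smul, mul_assoc (2 * Real.pi * Complex.I),
    inv_mul_cancel_left₀ Complex.two_pi_I_ne_zero]
  push_cast
  rfl

theorem HasLoopWinding.of_subsingleton [Subsingleton K] {a : UFred K} (u : Path a a) :
    HasLoopWinding u 0 := by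
  have h := hasLoopWinding_projLoop (p := (0 : K →L[ℂ] K)) (.zero _) (.zero) 0
  rw [zero_mul] at h
  have : ∀ x y : UFred K, x = y := fun x y =>
    Subtype.ext (ContinuousLinearMap.ext fun v => Subsingleton.elim _ _)
  exact h.congr (closedHomotopic_of_map (fun x => u x.2) (by fun_prop) (fun t => this _ _)
    (fun t => rfl) fun s => this _ _)

variable {ι : Type*} {b : HilbertBasis ι ℂ K} {S : Finset ι}

theorem exists_homotopic_singleton [DecidableEq ι] {i₀ : ι} (S : Finset ι) (hi₀ : i₀ ∈ S)
    (u : C(I, UFin b S)) (hu : u 0 = u 1) :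
    ∃ u' : C(I, UFin b S), ClosedHomotopic u u' ∧ ∀ t, (u' t : K →L[ℂ] K) ∈ UFin b {i₀} := by
  induction S using Finset.strongInduction with
  | H S ih =>
    by_cases h : ∃ j ∈ S, i₀ ≠ j
    · obtain ⟨j, hj, hij⟩ := h
      obtain ⟨u₁, h₁, h₁m⟩ := exists_homotopic_erase hi₀ hj hij u hu
      let v : C(I, UFin b (S.erase j)) := ⟨fun t => ⟨u₁ t, h₁m t⟩,
        (continuous_subtype_val.comp u₁.continuous).subtype_mk _⟩
      obtain ⟨v', hv', hv'm⟩ := ih _ (Finset.erase_ssubset hj) (Finset.mem_erase.2 ⟨hij, hi₀⟩) v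
        (by have := congrArg Subtype.val h₁.closed_right; exact Subtype.ext this)
      let k : C(UFin b (S.erase j), UFin b S) := ⟨fun U => ⟨U, U.2.1, fun i hi =>
        U.2.2 i fun h => hi (Finset.mem_of_mem_erase h)⟩, continuous_subtype_val.subtype_mk _⟩
      exact ⟨k.comp v', h₁.trans (hv'.map k), hv'm⟩
    · push Not at h
      have : S = {i₀} := Finset.eq_singleton_iff_unique_mem.2 ⟨hi₀, fun j hj => (h j hj).symm⟩
      subst this
      exact ⟨u, .refl _ hu, fun t => (u t).2⟩

/-- U fixes all other basis vectors, so U b_{i₀} is orthogonal to them and hence a multiple of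
b_{i₀}. -/
theorem eq_of_mem_UFin_singleton {i₀ : ι} {U : K →L[ℂ] K} (hU : U ∈ UFin b {i₀}) :
    U = 1 + (inner ℂ (b i₀) (U (b i₀)) - 1) • bproj b {i₀} ∧
      ‖inner ℂ (b i₀) (U (b i₀))‖ = 1 := by
  classical
  have h1 : U (b i₀) = inner ℂ (b i₀) (U (b i₀)) • b i₀ := by
    have hs := b.hasSum_repr (U (b i₀))
    have h2 := hasSum_single (f := fun i => b.repr (U (b i₀)) i • b i) i₀ (fun i hi => by
      rw [b.repr_apply_apply, inner_apply_of_mem_UFin hU (by simpa using hi), b.orthonormal.2 hi,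
        zero_smul])
    have := hs.unique h2
    rwa [b.repr_apply_apply] at this
  refine ⟨clm_ext_basis (b := b) fun i => ?_, ?_⟩
  · by_cases hi : i = i₀
    · subst hi
      conv_lhs => rw [h1]
      simp only [add_apply, smul_apply, one_apply_eq_self, bproj_of_mem b {i} (Finset.mem_singleton_self i)]
      module
    · simp [hU.2 i (by simpa using hi), bproj_of_notMem b {i₀} (by simpa using hi)]
  · have h2 : ‖U (b i₀)‖ = 1 := by rw [unitary_norm_map hU.1, b.orthonormal.norm_eq_one]
    rw [h1, norm_smul, b.orthonormal.norm_eq_one, mul_one] at h2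
    exact h2

theorem exists_log (f : C(I, ℂ)) (hf : ∀ t, f t ≠ 0) :
    ∃ L : C(I, ℂ), ∀ t, Complex.exp (L t) = f t := by
  have cov := Complex.isCoveringMap_exp
  let g : C(I, {z : ℂ // z ≠ 0}) := ⟨fun t => ⟨f t, hf t⟩, by fun_prop⟩
  have h0 : g 0 = ⟨Complex.exp (Complex.log (f 0)), Complex.exp_ne_zero _⟩ :=
    Subtype.ext (Complex.exp_log (hf 0)).symm
  exact ⟨cov.liftPath g _ h0, fun t =>
    congrArg Subtype.val (congrFun (cov.liftPath_lifts g _ h0) t)⟩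

/-- Every loop in `UFred K` is homotopic to a standard loop. -/
theorem exists_homotopic_projLoop (b : HilbertBasis ι ℂ K) (i₀ : ι)
    (u : Path (oneUFred K) (oneUFred K)) :
    ∃ n : ℤ, u.Homotopic (projLoop (bproj b {i₀}) (isStarProjection_bproj b _)
      (hasFiniteRange_bproj b _) n) := by
  classical
  have hut : Continuous fun t => (u t : K →L[ℂ] K) := continuous_subtype_val.comp u.continuous
  obtain ⟨S, hS, hi₀⟩ := ((eventually_isUnit_one_add b hut fun t => (u t).2).and
    (Filter.eventually_ge_atTop ({i₀} : Finset ι))).exists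
  replace hi₀ : i₀ ∈ S := hi₀ (by simp)
  have hP := isStarProjection_bproj b S
  have hPP := hP.isIdempotentElem.eq
  have hu' : ∀ s t : I, IsUnit (1 + ((s : ℝ) : ℂ) • ((1 - bproj b S) * (u t : K →L[ℂ] K))) :=
    fun s t => isUnit_one_add_smul hP (u t).2.1 (hS t) s.2
  have hmc : Continuous fun x : I × I => mob (bproj b S) (u x.2 : K →L[ℂ] K) x.1 :=
    continuous_mob _ (hut.comp continuous_snd) (by fun_prop) fun x => hu' x.1 x.2
  have hm1 : ∀ t : I, mob (bproj b S) (u t : K →L[ℂ] K) (1 : I) ∈ UFin b S := fun t =>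
    ⟨mob_mem_unitary hP (u t).2.1 (1 : I).2 (hu' 1 t), fun i hi =>
      mob_one_apply (bproj_of_notMem b S hi)⟩
  have hone : ∀ s : I, mob (bproj b S) (1 : K →L[ℂ] K) s = 1 := fun s => mob_one_right hPP s.2
  have hu0 : (u 0 : K →L[ℂ] K) = 1 := by rw [u.source]; rfl
  have hu1 : (u 1 : K →L[ℂ] K) = 1 := by rw [u.target]; rfl
  let M : C(I, UFin b S) := ⟨fun t => ⟨mob (bproj b S) (u t : K →L[ℂ] K) (1 : I), hm1 t⟩,
    (hmc.comp (continuous_const.prodMk continuous_id)).subtype_mk _⟩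
  have hM0 : (M 0 : K →L[ℂ] K) = 1 := by
    change mob (bproj b S) (u 0 : K →L[ℂ] K) (1 : I) = 1
    rw [hu0, hone]
  have hM1 : (M 1 : K →L[ℂ] K) = 1 := by
    change mob (bproj b S) (u 1 : K →L[ℂ] K) (1 : I) = 1
    rw [hu1, hone]
  let u₁ : Path (oneUFred K) (oneUFred K) :=
    { toFun := fun t => ⟨M t, UFin_subset_UFred (M t).2⟩
      continuous_toFun := (continuous_subtype_val.comp M.continuous).subtype_mk _
      source' := Subtype.ext hM0
      target' := Subtype.ext hM1 }
  have h1 : u.Homotopic u₁ := by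
    refine homotopic_of_map (fun x => ⟨mob (bproj b S) (u x.2 : K →L[ℂ] K) x.1,
      mob_mem_UFred hP (hasFiniteRange_bproj b S) (u x.2).2 x.1.2 (hS x.2)⟩) (hmc.subtype_mk _)
      (fun t => Subtype.ext mob_zero) (fun t => rfl) (fun s => Subtype.ext ?_)
      (fun s => Subtype.ext ?_)
    · simp only [hu0, hone]; rfl
    · simp only [hu1, hone]; rfl
  obtain ⟨v, ⟨F⟩, hv⟩ := exists_homotopic_singleton S hi₀ M (Subtype.ext (hM0.trans hM1.symm))
  -- Multiplying by the inverse of the initial point turns the homotopy through closed paths into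
  -- one with base point 1.
  let G : I × I → K →L[ℂ] K := fun x => (F x : K →L[ℂ] K) * star (F (x.1, 0) : K →L[ℂ] K)
  have hFc : Continuous fun x => (F x : K →L[ℂ] K) := continuous_subtype_val.comp F.continuous
  have hGc : Continuous G :=
    hFc.mul (hFc.comp (continuous_fst.prodMk continuous_const)).star
  have hGm : ∀ x, G x ∈ UFin b S := fun x => mul_mem_UFin (F x).2 (star_mem_UFin (F _).2)
  have hG0 : ∀ s, G (s, 0) = 1 := fun s => (Unitary.mem_iff.1 (F (s, 0)).2.1).2
  have hG1 : ∀ s, G (s, 1) = 1 := fun s => by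
    have : F (s, 0) = F (s, 1) := F.prop s
    simp only [G, this]
    exact (Unitary.mem_iff.1 (F (s, 1)).2.1).2
  have hGz : ∀ t, G (0, t) = M t := fun t => by
    have e0 : F (0, 0) = M 0 := F.apply_zero 0
    have e1 : F (0, t) = M t := F.apply_zero t
    simp only [G, e0, e1, hM0, star_one, mul_one]
  have hGo : ∀ t, G (1, t) ∈ UFin b {i₀} := fun t => by
    have e0 : F (1, 0) = v 0 := F.apply_one 0
    have e1 : F (1, t) = v t := F.apply_one t
    simp only [G, e0, e1]
    exact mul_mem_UFin (hv t) (star_mem_UFin (hv 0))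
  let u₂ : Path (oneUFred K) (oneUFred K) :=
    { toFun := fun t => ⟨G (1, t), UFin_subset_UFred (hGm _)⟩
      continuous_toFun := (hGc.comp (continuous_const.prodMk continuous_id)).subtype_mk _
      source' := Subtype.ext (hG0 1)
      target' := Subtype.ext (hG1 1) }
  have h2 : u₁.Homotopic u₂ :=
    homotopic_of_map (fun x => ⟨G x, UFin_subset_UFred (hGm x)⟩) (hGc.subtype_mk _)
      (fun t => Subtype.ext (hGz t)) (fun t => rfl) (fun s => Subtype.ext (hG0 s))
      (fun s => Subtype.ext (hG1 s))
  let z : C(I, ℂ) := ⟨fun t => inner ℂ (b i₀) (G (1, t) (b i₀)), by fun_prop⟩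
  have hz : ∀ t, ‖z t‖ = 1 := fun t => (eq_of_mem_UFin_singleton (hGo t)).2
  have hGz1 : ∀ t, G (1, t) = 1 + (z t - 1) • bproj b {i₀} := fun t =>
    (eq_of_mem_UFin_singleton (hGo t)).1
  have hb1 : inner ℂ (b i₀) (b i₀) = (1 : ℂ) := inner_self_eq_one (b.orthonormal.norm_eq_one i₀)
  have hz0 : z 0 = 1 := by simp only [z, ContinuousMap.coe_mk, hG0, one_apply_eq_self, hb1]
  have hz1 : z 1 = 1 := by simp only [z, ContinuousMap.coe_mk, hG1, one_apply_eq_self, hb1]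
  obtain ⟨L, hL⟩ := exists_log z fun t h => by
    have := hz t
    rw [h] at this; simp at this
  have hLre : ∀ t, (L t).re = 0 := fun t => by
    have := hz t
    rw [← hL, Complex.norm_exp, Real.exp_eq_one_iff] at this
    exact this
  obtain ⟨n, hn⟩ := Complex.exp_eq_one_iff.1 (show Complex.exp (L 1 - L 0) = 1 by
    rw [Complex.exp_sub, hL, hL, hz0, hz1, div_one])
  -- Interpolate linearly between the logarithm of z and that of the standard loop. Both vanish at
  -- time 0, agree at time 1 and are purely imaginary, so the exponentials stay on the circle.
  let T : I × I → ℂ := fun x => (1 - ((x.1 : ℝ) : ℂ)) * (L x.2 - L 0) +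
    ((x.1 : ℝ) : ℂ) * (2 * Real.pi * Complex.I * n * (x.2 : ℝ))
  have hT : Continuous T := by fun_prop
  have hTn : ∀ x, ‖Complex.exp (T x)‖ = 1 := fun x => by
    rw [Complex.norm_exp, Real.exp_eq_one_iff]
    have e : T x = ((1 - (x.1 : ℝ) : ℝ) : ℂ) * (L x.2 - L 0) +
        (((x.1 : ℝ) * (2 * Real.pi * n * (x.2 : ℝ)) : ℝ) : ℂ) * Complex.I := by
      simp only [T]; push_cast; ring
    rw [e, Complex.add_re, Complex.re_ofReal_mul, Complex.re_ofReal_mul, Complex.sub_re, hLre, hLre,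
      Complex.I_re]
    ring
  refine ⟨n, h1.trans (h2.trans ?_)⟩
  refine homotopic_of_map (fun x => ⟨1 + (Complex.exp (T x) - 1) • bproj b {i₀},
    one_add_smul_mem_UFred (isStarProjection_bproj b _) (hasFiniteRange_bproj b _) (hTn x)⟩) ?_
    (fun t => Subtype.ext ?_) (fun t => Subtype.ext ?_) (fun s => Subtype.ext ?_)
    (fun s => Subtype.ext ?_)
  · refine Continuous.subtype_mk ?_ _
    fun_prop
  · change _ = G (1, t)
    rw [hGz1]
    simp only [T, Set.Icc.coe_zero, Complex.ofReal_zero, sub_zero, one_mul, zero_mul, add_zero]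
    rw [Complex.exp_sub, hL, hL, hz0, div_one]
  · simp only [T, Set.Icc.coe_one, Complex.ofReal_one, sub_self, zero_mul, one_mul, zero_add]
    rfl
  · simp [T, oneUFred]
  · have e : T (s, 1) = n * (2 * Real.pi * Complex.I) := by
      simp only [T, hn, Set.Icc.coe_one, Complex.ofReal_one]; ring
    simp only [e, Complex.exp_int_mul_two_pi_mul_I, sub_self, zero_smul, add_zero]
    rfl

end Loops

/-! ### Paths relative to a contractible subset, turned into loops -/

section Contraction

variable {X : Type*} [TopologicalSpace X]

/-- A deformation of the subset `A` of `X`, inside `A`, to the point `o`. -/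
structure Contraction (A : Set X) (o : X) where
  map : A × I → X
  continuous_map : Continuous map
  map_mem : ∀ x, map x ∈ A
  map_zero : ∀ a : A, map (a, 0) = a
  map_one : ∀ a : A, map (a, 1) = o

theorem homotopicWith_of_map {P : C(I, X) → Prop} {f g : C(I, X)} (F : I × I → X)
    (hF : Continuous F) (h0 : ∀ t, F (0, t) = f t) (h1 : ∀ t, F (1, t) = g t)
    (hP : ∀ (k : C(I, X)) (s : I), (∀ t, k t = F (s, t)) → P k) :
    ContinuousMap.HomotopicWith f g P :=
  ⟨⟨⟨⟨F, hF⟩, h0, h1⟩, fun s => hP _ s fun _ => rfl⟩⟩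

namespace Contraction

variable {A : Set X} {o : X} (c : Contraction A o)

/-- The path from the image of `a` at time `s` of the contraction back to `a`. -/
def back (a : A) (s : I) : Path (c.map (a, s)) (a : X) where
  toFun t := c.map (a, s * σ t)
  continuous_toFun := c.continuous_map.comp (by fun_prop)
  source' := by simp
  target' := by simp [c.map_zero]

variable {a b d : X}

/-- The path `p`, extended at both ends along the contraction up to time `s`. -/
def extend (p : Path a b) (ha : a ∈ A) (hb : b ∈ A) (s : I) :
    Path (c.map (⟨a, ha⟩, s)) (c.map (⟨b, hb⟩, s)) :=
  ((c.back ⟨a, ha⟩ s).trans p).trans (c.back ⟨b, hb⟩ s).symm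

/-- The path from the center of the contraction to `a`. -/
def toPt (ha : a ∈ A) : Path o a := (c.back ⟨a, ha⟩ 1).cast (c.map_one _).symm rfl

/-- The loop at the center of the contraction obtained by closing up `p`. -/
def loop (p : Path a b) (ha : a ∈ A) (hb : b ∈ A) : Path o o :=
  ((c.toPt ha).trans p).trans (c.toPt hb).symm

theorem extend_one (p : Path a b) (ha : a ∈ A) (hb : b ∈ A) (t : I) :
    c.extend p ha hb 1 t = c.loop p ha hb t := by
  simp only [extend, loop, Path.trans_apply, Path.symm_apply, toPt, Path.cast_coe]

theorem extend_zero (p : Path a b) (ha : a ∈ A) (hb : b ∈ A) (t : I) :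
    c.extend p ha hb 0 t = ((Path.refl a).trans p).trans (Path.refl b).symm t := by
  have h : ∀ (x : A) (t : I), c.back x 0 t = x := fun x t => by
    change c.map (x, 0 * σ t) = x
    rw [zero_mul, c.map_zero]
  simp only [extend, Path.trans_apply, Path.symm_apply, Function.comp_apply, h, Path.refl_apply]

theorem extend_congr {a' b' : X} {p : Path a b} {p' : Path a' b'} (h : ∀ t, p t = p' t)
    (ha : a ∈ A) (hb : b ∈ A) (ha' : a' ∈ A) (hb' : b' ∈ A) (s t : I) :
    c.extend p ha hb s t = c.extend p' ha' hb' s t := by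
  obtain rfl : a = a' := by rw [← p.source, ← p'.source, h]
  obtain rfl : b = b' := by rw [← p.target, ← p'.target, h]
  obtain rfl : p = p' := Path.ext (funext h)
  rfl

theorem continuous_extend {Y : Type*} [TopologicalSpace Y] {x y : Y → X}
    (γ : ∀ s, Path (x s) (y s)) (hγ : Continuous ↿γ) (hx : ∀ s, x s ∈ A) (hy : ∀ s, y s ∈ A)
    {r : Y → I} (hr : Continuous r) :
    Continuous ↿fun s => c.extend (γ s) (hx s) (hy s) (r s) := by
  have hxc : Continuous x := by
    have : x = fun s => γ s 0 := funext fun s => (γ s).source.symm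
    rw [this]
    exact hγ.comp (continuous_id.prodMk continuous_const)
  have hyc : Continuous y := by
    have : y = fun s => γ s 1 := funext fun s => (γ s).target.symm
    rw [this]
    exact hγ.comp (continuous_id.prodMk continuous_const)
  have hb : ∀ {z : Y → X} (hz : Continuous z) (hzA : ∀ s, z s ∈ A),
      Continuous ↿fun s => c.back ⟨z s, hzA s⟩ (r s) := fun {z} hz hzA => by
    change Continuous fun q : Y × I => c.map (⟨z q.1, hzA q.1⟩, r q.1 * σ q.2)
    exact c.continuous_map.comp (((hz.comp continuous_fst).subtype_mk _).prodMk (by fun_prop))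
  exact Path.trans_continuous_family _ (Path.trans_continuous_family _ (hb hxc hx) _ hγ) _
    (Path.symm_continuous_family _ (hb hyc hy))

variable {c}

/-- Close up every path of the homotopy along the contraction; since the contraction ends at o, the
closed paths are all based at o. -/
theorem loop_homotopic_of_homotopicWith {a' b' : X} {p : Path a b} {q : Path a' b'} (ha : a ∈ A)
    (hb : b ∈ A) (ha' : a' ∈ A) (hb' : b' ∈ A)
    (h : ContinuousMap.HomotopicWith p.toContinuousMap q.toContinuousMap
      (fun f => f 0 ∈ A ∧ f 1 ∈ A)) : (c.loop p ha hb).Homotopic (c.loop q ha' hb') := by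
  obtain ⟨F⟩ := h
  have hF0 : ∀ s, F (s, 0) ∈ A := fun s => (F.prop s).1
  have hF1 : ∀ s, F (s, 1) ∈ A := fun s => (F.prop s).2
  let γ : ∀ s : I, Path (F (s, 0)) (F (s, 1)) := fun s =>
    { toFun := fun t => F (s, t)
      continuous_toFun := by fun_prop
      source' := rfl
      target' := rfl }
  have hγ : Continuous ↿γ := F.continuous
  refine homotopic_of_map _ (c.continuous_extend γ hγ hF0 hF1 (r := fun _ => 1) continuous_const)
    (fun t => ?_) (fun t => ?_) (fun s => ?_) (fun s => ?_)
  · rw [← extend_one]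
    exact extend_congr c (fun t => F.apply_zero t) _ _ _ _ _ _
  · rw [← extend_one]
    exact extend_congr c (fun t => F.apply_one t) _ _ _ _ _ _
  · exact ((c.extend (γ s) (hF0 s) (hF1 s) 1).source).trans (c.map_one _)
  · exact ((c.extend (γ s) (hF0 s) (hF1 s) 1).target).trans (c.map_one _)

/-- Grow the two tails along the contraction. At time s both endpoints are images under the
contraction at time s, so the property Q can be either that endpoints lie in A or that the path is
closed. -/
theorem homotopicWith_loop (p : Path a b) (ha : a ∈ A) (hb : b ∈ A) {Q : C(I, X) → Prop}
    (hQ : ∀ (f : C(I, X)) (s : I), f 0 = c.map (⟨a, ha⟩, s) → f 1 = c.map (⟨b, hb⟩, s) → Q f) :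
    ContinuousMap.HomotopicWith p.toContinuousMap (c.loop p ha hb).toContinuousMap Q := by
  have h1 : p.Homotopic (((Path.refl a).trans p).trans (Path.refl b).symm) :=
    ((Path.Homotopic.trans_refl _).trans (Path.Homotopic.refl_trans p)).symm
  obtain ⟨H⟩ := h1
  have e1 : ContinuousMap.HomotopicWith p.toContinuousMap
      (((Path.refl a).trans p).trans (Path.refl b).symm).toContinuousMap Q := by
    refine homotopicWith_of_map (fun x => H x) H.continuous H.apply_zero H.apply_one fun k s hk =>
      hQ k 0 ?_ ?_
    · exact (hk 0).trans ((H.source s).trans (c.map_zero ⟨a, ha⟩).symm)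
    · exact (hk 1).trans ((H.target s).trans (c.map_zero ⟨b, hb⟩).symm)
  have hc : Continuous fun x : I × I => c.extend p ha hb x.1 x.2 :=
    c.continuous_extend (Y := I) (x := fun _ => a) (y := fun _ => b) (fun _ : I => p)
      (p.continuous.comp continuous_snd) (fun _ => ha) (fun _ => hb) (r := fun s => s) continuous_id
  have e2 : ContinuousMap.HomotopicWith
      (((Path.refl a).trans p).trans (Path.refl b).symm).toContinuousMap
      (c.loop p ha hb).toContinuousMap Q := by
    refine homotopicWith_of_map _ hc (fun t => c.extend_zero p ha hb t)
      (fun t => c.extend_one p ha hb t) fun k s hk => hQ k s ?_ ?_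
    · exact (hk 0).trans (c.extend p ha hb s).source
    · exact (hk 1).trans (c.extend p ha hb s).target
  exact e1.trans e2

theorem homotopicWith_of_loop_homotopic {a' b' : X} {p : Path a b} {q : Path a' b'} (ha : a ∈ A)
    (hb : b ∈ A) (ha' : a' ∈ A) (hb' : b' ∈ A)
    (h : (c.loop p ha hb).Homotopic (c.loop q ha' hb')) :
    ContinuousMap.HomotopicWith p.toContinuousMap q.toContinuousMap
      (fun f => f 0 ∈ A ∧ f 1 ∈ A) := by
  have ho : o ∈ A := by rw [← c.map_one ⟨a, ha⟩]; exact c.map_mem _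
  have key : ∀ {a b : X} (p : Path a b) (ha : a ∈ A) (hb : b ∈ A),
      ContinuousMap.HomotopicWith p.toContinuousMap (c.loop p ha hb).toContinuousMap
        (fun f => f 0 ∈ A ∧ f 1 ∈ A) := fun p ha hb =>
    homotopicWith_loop p ha hb fun f s h0 h1 =>
      ⟨by rw [h0]; exact c.map_mem _, by rw [h1]; exact c.map_mem _⟩
  obtain ⟨H⟩ := h
  have h2 : ContinuousMap.HomotopicWith (c.loop p ha hb).toContinuousMap
      (c.loop q ha' hb').toContinuousMap (fun f => f 0 ∈ A ∧ f 1 ∈ A) :=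
    homotopicWith_of_map H H.continuous H.apply_zero H.apply_one fun k s hk =>
      ⟨by rw [hk, H.source]; exact ho, by rw [hk, H.target]; exact ho⟩
  exact (key p ha hb).trans (h2.trans (key q ha' hb').symm)

theorem closedHomotopic_loop (p : Path a a) (ha : a ∈ A) :
    ClosedHomotopic p.toContinuousMap (c.loop p ha ha).toContinuousMap :=
  homotopicWith_loop p ha ha fun _ _ h0 h1 => h0.trans h1.symm

/-- The tail at b is run forth and back between p and q, and cancels. -/
theorem loop_trans (p : Path a b) (q : Path b d) (ha : a ∈ A) (hb : b ∈ A) (hd : d ∈ A) :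
    (c.loop (p.trans q) ha hd).Homotopic ((c.loop p ha hb).trans (c.loop q hb hd)) := by
  apply Path.Homotopic.Quotient.eq.1
  simp only [loop, Path.Homotopic.Quotient.mk_trans, Path.Homotopic.Quotient.mk_symm, Path.Homotopic.Quotient.trans_assoc]
  rw [← Path.Homotopic.Quotient.trans_assoc (Path.Homotopic.Quotient.mk (c.toPt hb)).symm, Path.Homotopic.Quotient.symm_trans,
    Path.Homotopic.Quotient.refl_trans]

/-- The contraction itself shrinks v, inside A, to the constant path at o. -/
theorem loop_homotopic_refl (v : Path a b) (hv : ∀ t, v t ∈ A) (ha : a ∈ A) (hb : b ∈ A) :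
    (c.loop v ha hb).Homotopic (Path.refl o) := by
  have ho : o ∈ A := by rw [← c.map_one ⟨a, ha⟩]; exact c.map_mem _
  have h1 : (c.loop v ha hb).Homotopic (c.loop (Path.refl o) ho ho) := by
    refine loop_homotopic_of_homotopicWith ha hb ho ho ?_
    refine homotopicWith_of_map (fun x => c.map (⟨v x.2, hv x.2⟩, x.1)) ?_ (fun t => c.map_zero _)
      (fun t => c.map_one _) fun k s hk => ⟨?_, ?_⟩
    · exact c.continuous_map.comp (((v.continuous.comp continuous_snd).subtype_mk _).prodMk
        continuous_fst)
    · rw [hk]; exact c.map_mem _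
    · rw [hk]; exact c.map_mem _
  refine h1.trans ?_
  apply Path.Homotopic.Quotient.eq.1
  simp only [loop, Path.Homotopic.Quotient.mk_trans, Path.Homotopic.Quotient.mk_symm, Path.Homotopic.Quotient.mk_refl, Path.Homotopic.Quotient.trans_refl,
    Path.Homotopic.Quotient.trans_symm]

end Contraction

end Contraction

/-! ### The index of a path with endpoints in UStar -/

section Index

variable {K : Type*} [NormedAddCommGroup K] [InnerProductSpace ℂ K] [CompleteSpace K]

variable (K) in
/-- The points of `UFred K` that lie in `UStar K`. -/
def starSet : Set (UFred K) := {a | (a : K →L[ℂ] K) ∈ UStar K}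

theorem isUnit_one_add_smul_of_mem_UStar {U : K →L[ℂ] K} (hU : U ∈ UStar K) (s : I) :
    IsUnit (1 + ((s : ℝ) : ℂ) • ((1 - 0) * U)) :=
  isUnit_one_add_smul (.zero _) hU.1 (isUnit_one_add_of_mem_UStar hU) s.2

variable (K) in
/-- The Möbius contraction of `UStar K` to the identity. -/
def starContraction : Contraction (starSet K) (oneUFred K) where
  map x := ⟨mob 0 (x.1 : K →L[ℂ] K) (x.2 : ℝ), UStar_subset_UFred
    (mob_mem_UStar (.zero _) x.1.2 x.2.2 (isUnit_one_add_of_mem_UStar x.1.2))⟩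
  continuous_map := by
    have h1 : Continuous fun x : starSet K × I => ((x.1 : UFred K) : K →L[ℂ] K) :=
      continuous_subtype_val.comp (continuous_subtype_val.comp continuous_fst)
    have h2 : Continuous fun x : starSet K × I => (x.2 : ℝ) := by fun_prop
    exact Continuous.subtype_mk (continuous_mob 0 h1 h2
      fun x => isUnit_one_add_smul_of_mem_UStar x.1.2 x.2) _
  map_mem x := mob_mem_UStar (.zero _) x.1.2 x.2.2 (isUnit_one_add_of_mem_UStar x.1.2)
  map_zero a := Subtype.ext mob_zero
  map_one a := Subtype.ext (by simp [mob_one, oneUFred])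

theorem exists_basis [Nontrivial K] : Nonempty (exists_hilbertBasis ℂ K).choose := by
  by_contra h
  rw [not_nonempty_iff] at h
  have : (1 : K →L[ℂ] K) = 0 := clm_ext_basis (b := traceBasis K) fun i => h.elim i
  exact one_ne_zero this

variable (K) in
/-- A projection of rank one (of rank zero if `K = 0`). -/
def stdProj : K →L[ℂ] K :=
  open Classical in
  if h : Nonempty (exists_hilbertBasis ℂ K).choose then bproj (traceBasis K) {h.some} else 0

theorem isStarProjection_stdProj : IsStarProjection (stdProj K) := by
  unfold stdProj
  split_ifs
  · exact isStarProjection_bproj _ _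
  · exact .zero _

theorem hasFiniteRange_stdProj : ((stdProj K : K →L[ℂ] K) : K →ₗ[ℂ] K).HasFiniteRange := by
  unfold stdProj
  split_ifs
  · exact hasFiniteRange_bproj _ _
  · exact .zero

theorem finrank_stdProj [Nontrivial K] : Module.finrank ℂ (stdProj K).range = 1 := by
  have h := exists_basis (K := K)
  have e : (stdProj K).range = Submodule.span ℂ {traceBasis K h.some} := by
    ext x
    rw [Submodule.mem_span_singleton]
    constructor
    · rintro ⟨y, rfl⟩
      exact ⟨inner ℂ (traceBasis K h.some) y, by simp [stdProj, h, bproj_apply]⟩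
    · rintro ⟨z, rfl⟩
      refine ⟨z • traceBasis K h.some, ?_⟩
      change stdProj K (z • traceBasis K h.some) = _
      rw [map_smul, stdProj, dif_pos h, bproj_of_mem _ _ (Finset.mem_singleton_self _)]
  rw [e]
  exact finrank_span_singleton ((traceBasis K).orthonormal.ne_zero _)

variable (K) in
/-- The standard loops. -/
def stdLoop (n : ℤ) : Path (oneUFred K) (oneUFred K) :=
  projLoop (stdProj K) isStarProjection_stdProj hasFiniteRange_stdProj n

theorem hasLoopWinding_stdLoop [Nontrivial K] (n : ℤ) : HasLoopWinding (stdLoop K n) n := by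
  have := hasLoopWinding_projLoop (isStarProjection_stdProj (K := K)) hasFiniteRange_stdProj n
  rwa [finrank_stdProj, Nat.cast_one, mul_one] at this

theorem exists_homotopic_stdLoop (u : Path (oneUFred K) (oneUFred K)) :
    ∃ n, u.Homotopic (stdLoop K n) := by
  by_cases h : Nonempty (exists_hilbertBasis ℂ K).choose
  · obtain ⟨n, hn⟩ := exists_homotopic_projLoop (traceBasis K) h.some u
    refine ⟨n, ?_⟩
    have e : stdLoop K n = projLoop (bproj (traceBasis K) {h.some}) (isStarProjection_bproj _ _)
        (hasFiniteRange_bproj _ _) n := by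
      ext t : 2
      simp [stdLoop, projLoop, stdProj, h]
    rwa [e]
  · have hK : Subsingleton K := by
      by_contra h'
      rw [not_subsingleton_iff_nontrivial] at h'
      exact h exists_basis
    have : u = stdLoop K 0 := by
      refine Path.ext (funext fun t => Subtype.ext (ContinuousLinearMap.ext fun v => ?_))
      exact Subsingleton.elim (α := K) _ _
    exact ⟨0, by rw [this]⟩

theorem exists_hasLoopWinding (u : Path (oneUFred K) (oneUFred K)) : ∃ n, HasLoopWinding u n := by
  obtain ⟨n, hn⟩ := exists_homotopic_stdLoop u
  have := hasLoopWinding_projLoop (isStarProjection_stdProj (K := K)) hasFiniteRange_stdProj n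
  exact ⟨_, this.congr (closedHomotopic_of_homotopic hn.symm)⟩

/-- Both sides are images, under one periodic map ℝ → UFred, of paths from 0 to m + n in the simply
connected line. -/
theorem stdLoop_trans (m n : ℤ) :
    ((stdLoop K m).trans (stdLoop K n)).Homotopic (stdLoop K (m + n)) := by
  let F : C(ℝ, UFred K) := ⟨fun x => ⟨1 + (Complex.exp (2 * Real.pi * Complex.I * (1 : ℤ) * x) - 1) •
    stdProj K, one_add_smul_mem_UFred isStarProjection_stdProj hasFiniteRange_stdProj
      (norm_exp_two_pi 1 x)⟩, by
      refine Continuous.subtype_mk ?_ _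
      fun_prop⟩
  let line : ∀ x y : ℝ, Path x y := fun x y =>
    { toFun := fun t => x + t * (y - x)
      continuous_toFun := by fun_prop
      source' := by simp
      target' := by simp }
  have hF : ∀ k l : ℤ, F k = F l := fun k l => by
    refine Subtype.ext ?_
    have : ∀ k : ℤ, Complex.exp (2 * Real.pi * Complex.I * (1 : ℤ) * ((k : ℝ) : ℂ)) = 1 := fun k => by
      rw [← exp_two_pi_one k]; congr 1; push_cast; ring
    simp only [F, ContinuousMap.coe_mk, this]
  have hF0 : ∀ k : ℤ, F k = oneUFred K := fun k => by
    rw [hF k 0]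
    refine Subtype.ext ?_
    simp [F, oneUFred]
  have hl : ∀ k l : ℤ, ∀ t : I, F (line k l t) = stdLoop K (l - k) t := fun k l t => by
    refine Subtype.ext ?_
    have e : Complex.exp (2 * Real.pi * Complex.I * (1 : ℤ) * ((line k l t : ℝ) : ℂ)) =
        Complex.exp (2 * Real.pi * Complex.I * (l - k : ℤ) * (t : ℝ)) := by
      have : 2 * Real.pi * Complex.I * (1 : ℤ) * ((line k l t : ℝ) : ℂ) =
          2 * Real.pi * Complex.I * (l - k : ℤ) * (t : ℝ) + k * (2 * Real.pi * Complex.I) := by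
        simp only [line, Path.coe_mk_mk]; push_cast; ring
      rw [this, Complex.exp_add, Complex.exp_int_mul_two_pi_mul_I, mul_one]
    simp only [F, ContinuousMap.coe_mk, e]
    rfl
  have h1 : ((line (0 : ℤ) m).trans (line m (m + n : ℤ))).Homotopic (line (0 : ℤ) (m + n : ℤ)) :=
    SimplyConnectedSpace.paths_homotopic _ _
  have h2 := (h1.map F).pathCast (hF0 0).symm (hF0 (m + n)).symm
  convert h2 using 1
  · refine Path.ext (funext fun t => ?_)
    simp only [Path.cast_coe, Path.map_coe, Function.comp_apply, Path.trans_apply]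
    split_ifs
    · rw [hl, sub_zero]
    · rw [hl, add_sub_cancel_left]
  · refine Path.ext (funext fun t => ?_)
    simp only [Path.cast_coe, Path.map_coe, Function.comp_apply]
    rw [hl, sub_zero]

theorem homotopic_of_hasLoopWinding {u v : Path (oneUFred K) (oneUFred K)} {n : ℤ}
    (hu : HasLoopWinding u n) (hv : HasLoopWinding v n) : u.Homotopic v := by
  cases subsingleton_or_nontrivial K
  · have : u = v := by
      refine Path.ext (funext fun t => Subtype.ext (ContinuousLinearMap.ext fun v => ?_))
      exact Subsingleton.elim (α := K) _ _
    rw [this]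
  · obtain ⟨k, hk⟩ := exists_homotopic_stdLoop u
    obtain ⟨l, hl⟩ := exists_homotopic_stdLoop v
    obtain rfl := hu.unique (hasLoopWinding_stdLoop k) (closedHomotopic_of_homotopic hk)
    obtain rfl := hv.unique (hasLoopWinding_stdLoop l) (closedHomotopic_of_homotopic hl)
    exact hk.trans hl.symm

theorem HasLoopWinding.eq_zero [Subsingleton K] {a : UFred K} {u : Path a a} {n : ℤ}
    (h : HasLoopWinding u n) : n = 0 :=
  h.unique (.of_subsingleton u) (.refl _ (by simp))

theorem HasLoopWinding.trans {u v : Path (oneUFred K) (oneUFred K)} {m n : ℤ}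
    (hu : HasLoopWinding u m) (hv : HasLoopWinding v n) : HasLoopWinding (u.trans v) (m + n) := by
  cases subsingleton_or_nontrivial K
  · rw [hu.eq_zero, hv.eq_zero]
    exact .of_subsingleton _
  · have h1 := homotopic_of_hasLoopWinding hu (hasLoopWinding_stdLoop m)
    have h2 := homotopic_of_hasLoopWinding hv (hasLoopWinding_stdLoop n)
    exact (hasLoopWinding_stdLoop (m + n)).congr
      (closedHomotopic_of_homotopic ((h1.hcomp h2).trans (stdLoop_trans m n)).symm)

variable {a b d : UFred K}

/-- The winding number of a path with endpoints in `UStar K`, closed up by the Möbius contraction. -/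
def HasIndex (p : Path a b) (ha : a ∈ starSet K) (hb : b ∈ starSet K) (n : ℤ) : Prop :=
  HasLoopWinding ((starContraction K).loop p ha hb) n

theorem existsUnique_hasIndex (p : Path a b) (ha : a ∈ starSet K) (hb : b ∈ starSet K) :
    ∃! n, HasIndex p ha hb n := by
  obtain ⟨n, hn⟩ := exists_hasLoopWinding ((starContraction K).loop p ha hb)
  exact ⟨n, hn, fun m hm => HasLoopWinding.unique hm hn (.refl _ (by simp))⟩

theorem HasIndex.eq_iff {a' b' : UFred K} {p : Path a b} {q : Path a' b'} {ha : a ∈ starSet K}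
    {hb : b ∈ starSet K} {ha' : a' ∈ starSet K} {hb' : b' ∈ starSet K} {m n : ℤ}
    (hp : HasIndex p ha hb m) (hq : HasIndex q ha' hb' n) :
    m = n ↔ ContinuousMap.HomotopicWith p.toContinuousMap q.toContinuousMap
      (fun f => f 0 ∈ starSet K ∧ f 1 ∈ starSet K) := by
  constructor
  · rintro rfl
    exact Contraction.homotopicWith_of_loop_homotopic ha hb ha' hb'
      (homotopic_of_hasLoopWinding hp hq)
  · intro h
    exact HasLoopWinding.unique hp hq (closedHomotopic_of_homotopic
      (Contraction.loop_homotopic_of_homotopicWith ha hb ha' hb' h))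

theorem HasIndex.trans {p : Path a b} {q : Path b d} {ha : a ∈ starSet K}
    {hb : b ∈ starSet K} {hd : d ∈ starSet K} {m n : ℤ} (hp : HasIndex p ha hb m)
    (hq : HasIndex q hb hd n) : HasIndex (p.trans q) ha hd (m + n) :=
  (HasLoopWinding.trans hp hq).congr (closedHomotopic_of_homotopic
    (Contraction.loop_trans p q ha hb hd).symm)

theorem HasIndex.of_loopWinding {p : Path a a} (ha : a ∈ starSet K) {n : ℤ}
    (h : HasLoopWinding p n) : HasIndex p ha ha n :=
  h.congr (Contraction.closedHomotopic_loop p ha)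

theorem HasIndex.loopWinding {p : Path a a} {ha : a ∈ starSet K} {n : ℤ}
    (h : HasIndex p ha ha n) : HasLoopWinding p n :=
  HasLoopWinding.congr h (Contraction.closedHomotopic_loop p ha).symm

theorem hasIndex_zero_of_mem (v : Path a b) (hv : ∀ t, v t ∈ starSet K) (ha : a ∈ starSet K)
    (hb : b ∈ starSet K) : HasIndex v ha hb 0 := by
  have h := hasLoopWinding_projLoop (p := (0 : K →L[ℂ] K)) (.zero _) (.zero) 0
  rw [zero_mul] at h
  refine h.congr (closedHomotopic_of_homotopic ?_)
  have e : projLoop (0 : K →L[ℂ] K) (.zero _) (.zero) 0 = Path.refl _ := by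
    refine Path.ext (funext fun t => Subtype.ext ?_)
    simp [projLoop, oneUFred]
    rfl
  rw [e]
  exact (Contraction.loop_homotopic_refl v hv ha hb).symm

/-- A path inside UStar has index 0, so additivity shows that the choice of the closing path is
irrelevant; the contraction supplies one. -/
theorem hasRelWinding_iff (p : Path a b) (ha : a ∈ starSet K) (hb : b ∈ starSet K) (n : ℤ) :
    HasRelWinding p n ↔ HasIndex p ha hb n := by
  constructor
  · rintro ⟨v, hv, h⟩
    obtain ⟨m, hm, _⟩ := existsUnique_hasIndex p ha hb
    have h1 := hm.trans (hasIndex_zero_of_mem v hv hb ha)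
    have h2 := HasIndex.of_loopWinding ha h
    rw [add_zero] at h1
    obtain rfl := (existsUnique_hasIndex (p.trans v) ha ha).unique h1 h2
    exact hm
  · intro h
    let c := starContraction K
    have hc : ∀ {a : UFred K} (ha : a ∈ starSet K) t, c.toPt ha t ∈ starSet K :=
      fun ha t => c.map_mem _
    refine ⟨(c.toPt hb).symm.trans (c.toPt ha), fun t => ?_, ?_⟩
    · change _ ∈ starSet K
      rw [Path.trans_apply]
      split_ifs
      · exact hc hb _
      · exact hc ha _
    · have h1 := h.trans (hasIndex_zero_of_mem ((c.toPt hb).symm.trans (c.toPt ha)) (fun t => by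
        rw [Path.trans_apply]
        split_ifs
        · exact hc hb _
        · exact hc ha _) hb ha)
      rw [add_zero] at h1
      exact h1.loopWinding

end Index

/-! ### Small rotations and the winding number of arbitrary paths -/

section Rotation

variable {K : Type*} [NormedAddCommGroup K] [InnerProductSpace ℂ K] [CompleteSpace K]

variable {a b : UFred K}

theorem HasIndex.of_homotopicWith {a' b' : UFred K} {p : Path a b} {q : Path a' b'}
    {ha : a ∈ starSet K} {hb : b ∈ starSet K} {n : ℤ} (hp : HasIndex p ha hb n)
    (ha' : a' ∈ starSet K) (hb' : b' ∈ starSet K)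
    (h : ContinuousMap.HomotopicWith p.toContinuousMap q.toContinuousMap
      (fun f => f 0 ∈ starSet K ∧ f 1 ∈ starSet K)) : HasIndex q ha' hb' n := by
  obtain ⟨m, hm, _⟩ := existsUnique_hasIndex q ha' hb'
  rwa [(hp.eq_iff hm).2 h]

omit [CompleteSpace K] in
theorem continuous_exp_smul {Y : Type*} [TopologicalSpace Y] {φ : Y → ℝ} (hφ : Continuous φ)
    {u : Y → K →L[ℂ] K} (hu : Continuous u) :
    Continuous fun y => Complex.exp (φ y * Complex.I) • u y := by
  fun_prop

/-- Rotating a path by different angles does not change its index as long as the endpoints stay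
in `UStar`. -/
theorem HasIndex.of_rotation (u : Path a b) {φ₁ φ₂ : ℝ}
    (hF : ∀ φ ∈ Set.uIcc φ₁ φ₂, ∀ t : I,
      Complex.exp (φ * Complex.I) • (u t : K →L[ℂ] K) ∈ UFred K)
    (hS : ∀ φ ∈ Set.uIcc φ₁ φ₂, Complex.exp (φ * Complex.I) • (a : K →L[ℂ] K) ∈ UStar K ∧
      Complex.exp (φ * Complex.I) • (b : K →L[ℂ] K) ∈ UStar K)
    {a₁ b₁ a₂ b₂ : UFred K} {u₁ : Path a₁ b₁} {u₂ : Path a₂ b₂}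
    (h₁ : ∀ t, (u₁ t : K →L[ℂ] K) = Complex.exp (φ₁ * Complex.I) • (u t : K →L[ℂ] K))
    (h₂ : ∀ t, (u₂ t : K →L[ℂ] K) = Complex.exp (φ₂ * Complex.I) • (u t : K →L[ℂ] K))
    {ha₁ : a₁ ∈ starSet K} {hb₁ : b₁ ∈ starSet K} (ha₂ : a₂ ∈ starSet K) (hb₂ : b₂ ∈ starSet K)
    {n : ℤ} (h : HasIndex u₁ ha₁ hb₁ n) : HasIndex u₂ ha₂ hb₂ n := by
  have hmem : ∀ s : I, φ₁ + s * (φ₂ - φ₁) ∈ Set.uIcc φ₁ φ₂ := fun s => by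
    rw [← segment_eq_uIcc, segment_eq_image']
    exact ⟨s, s.2, by simp⟩
  refine h.of_homotopicWith ha₂ hb₂ (homotopicWith_of_map
    (fun x => ⟨Complex.exp (((φ₁ + x.1 * (φ₂ - φ₁) : ℝ) : ℂ) * Complex.I) • (u x.2 : K →L[ℂ] K),
      hF _ (hmem x.1) x.2⟩) ?_ (fun t => ?_) (fun t => ?_) fun k s hk => ⟨?_, ?_⟩)
  · refine Continuous.subtype_mk (continuous_exp_smul (by fun_prop) ?_) _
    exact continuous_subtype_val.comp (u.continuous.comp continuous_snd)
  · refine Subtype.ext ?_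
    simp only [Set.Icc.coe_zero, zero_mul, add_zero]
    exact (h₁ t).symm
  · refine Subtype.ext ?_
    simp only [Set.Icc.coe_one, one_mul, add_sub_cancel]
    exact (h₂ t).symm
  · rw [hk]
    change Complex.exp (((φ₁ + s * (φ₂ - φ₁) : ℝ) : ℂ) * Complex.I) • (u 0 : K →L[ℂ] K) ∈ UStar K
    rw [u.source]
    exact (hS _ (hmem s)).1
  · rw [hk]
    change Complex.exp (((φ₁ + s * (φ₂ - φ₁) : ℝ) : ℂ) * Complex.I) • (u 1 : K →L[ℂ] K) ∈ UStar K
    rw [u.target]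
    exact (hS _ (hmem s)).2

/-- UFred is open among the unitaries, and [0, 1] is compact, so one neighbourhood of angles works
for all t. -/
theorem eventually_exp_smul_mem_UFred (u : Path a b) :
    ∀ᶠ φ : ℝ in 𝓝 0, ∀ t : I, Complex.exp (φ * Complex.I) • (u t : K →L[ℂ] K) ∈ UFred K := by
  have hc : Continuous fun x : ℝ × I => Complex.exp (x.1 * Complex.I) • (u x.2 : K →L[ℂ] K) :=
    continuous_exp_smul continuous_fst
      (continuous_subtype_val.comp (u.continuous.comp continuous_snd))
  have key : ∀ t : I, ∀ᶠ x : ℝ × I in 𝓝 (0, t),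
      Complex.exp (x.1 * Complex.I) • (u x.2 : K →L[ℂ] K) ∈ UFred K := fun t => by
    obtain ⟨δ, hδ, h⟩ := exists_ball_mem_UFred (u t).2
    have h1 := hc.tendsto (0, t)
    simp only [Complex.ofReal_zero, zero_mul, Complex.exp_zero, one_smul] at h1
    filter_upwards [h1.eventually (Metric.ball_mem_nhds _ hδ)] with x hx
    exact h _ (smul_mem_unitary (u x.2).2.1 (Complex.norm_exp_ofReal_mul_I _))
      (by simpa [dist_eq_norm] using hx)
  have := isCompact_univ.eventually_forall_of_forall_eventually (x₀ := (0 : ℝ))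
    (P := fun (φ : ℝ) (t : I) => Complex.exp (φ * Complex.I) • (u t : K →L[ℂ] K) ∈ UFred K)
    (fun t _ => key t)
  exact this.mono fun φ h t => h t trivial

theorem exp_mul_I_ne_one {φ : ℝ} (h0 : φ ≠ 0) (h1 : |φ| < 2 * Real.pi) :
    Complex.exp (φ * Complex.I) ≠ 1 := by
  intro h
  obtain ⟨n, hn⟩ := Complex.exp_eq_one_iff.1 h
  have h2 : (φ : ℂ) = ((n * (2 * Real.pi) : ℝ) : ℂ) := by
    refine mul_right_cancel₀ Complex.I_ne_zero (hn.trans ?_)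
    push_cast; ring
  have h3 : φ = n * (2 * Real.pi) := by exact_mod_cast h2
  rw [h3, abs_mul, abs_of_pos Real.two_pi_pos] at h1
  have h4 : |(n : ℝ)| < 1 := by nlinarith [Real.two_pi_pos]
  have h5 : |n| < 1 := by exact_mod_cast h4
  have h6 : n = 0 := Int.abs_lt_one_iff.1 h5
  exact h0 (by rw [h3, h6]; simp)

theorem eventually_exp_smul_mem_UStar (a : UFred K) :
    ∀ᶠ φ : ℝ in 𝓝 0, φ ≠ 0 → Complex.exp (φ * Complex.I) • (a : K →L[ℂ] K) ∈ UStar K := by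
  obtain ⟨δ, hδ, h⟩ := exists_smul_mem_UStar a.2
  have hc : Continuous fun φ : ℝ => ‖Complex.exp (φ * Complex.I) - 1‖ := by fun_prop
  have h1 := hc.tendsto 0
  simp only [Complex.ofReal_zero, zero_mul, Complex.exp_zero, sub_self, norm_zero] at h1
  have h2 : Filter.Tendsto (fun φ : ℝ => |φ|) (𝓝 0) (𝓝 0) := by
    simpa using (continuous_abs (G := ℝ)).tendsto 0
  filter_upwards [h1.eventually_lt_const hδ, h2.eventually_lt_const Real.two_pi_pos] with φ h3 h4 h0
  exact h _ (Complex.norm_exp_ofReal_mul_I _) (exp_mul_I_ne_one h0 h4) h3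

/-- The angle `ε` is admissible in the definition of the winding number of `u`. -/
structure IsSmallAngle (u : Path a b) (ε : ℝ) : Prop where
  pos : 0 < ε
  mem : ∀ φ ∈ Set.Icc (-ε) ε, ∀ t : I,
    Complex.exp (φ * Complex.I) • (u t : K →L[ℂ] K) ∈ UFred K
  ends : ∀ φ ∈ Set.Icc (-ε) ε, φ ≠ 0 →
    Complex.exp (φ * Complex.I) • (a : K →L[ℂ] K) ∈ UStar K ∧
    Complex.exp (φ * Complex.I) • (b : K →L[ℂ] K) ∈ UStar K

theorem exists_isSmallAngle (u : Path a b) : ∃ ε, IsSmallAngle u ε := by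
  have h := (eventually_exp_smul_mem_UFred u).and
    ((eventually_exp_smul_mem_UStar a).and (eventually_exp_smul_mem_UStar b))
  obtain ⟨ε, hε, hb⟩ := Metric.eventually_nhds_iff.1 h
  have hb' : ∀ φ ∈ Set.Icc (-(ε / 2)) (ε / 2), dist φ 0 < ε := fun φ hφ => by
    rw [Real.dist_eq, sub_zero, abs_lt]
    constructor <;> linarith [hφ.1, hφ.2]
  exact ⟨ε / 2, by positivity, fun φ hφ => (hb (hb' φ hφ)).1,
    fun φ hφ h0 => ⟨(hb (hb' φ hφ)).2.1 h0, (hb (hb' φ hφ)).2.2 h0⟩⟩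

/-- The path `e^{iφ} u`. -/
def rotPath (u : Path a b) (φ : ℝ)
    (h : ∀ t : I, Complex.exp (φ * Complex.I) • (u t : K →L[ℂ] K) ∈ UFred K) :
    Path (⟨_, h 0⟩ : UFred K) ⟨_, h 1⟩ where
  toFun t := ⟨_, h t⟩
  continuous_toFun := Continuous.subtype_mk
    (continuous_exp_smul continuous_const (continuous_subtype_val.comp u.continuous)) _
  source' := rfl
  target' := rfl

theorem IsSmallAngle.neg_mem {u : Path a b} {ε : ℝ} (h : IsSmallAngle u ε) :
    -ε ∈ Set.Icc (-ε) ε := ⟨le_rfl, by linarith [h.pos]⟩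

theorem IsSmallAngle.source_mem {u : Path a b} {ε : ℝ} (h : IsSmallAngle u ε) {a' b' : UFred K}
    {u' : Path a' b'} (hu : ∀ t, (u' t : K →L[ℂ] K) =
      Complex.exp (((-ε : ℝ) : ℂ) * Complex.I) • (u t : K →L[ℂ] K)) : a' ∈ starSet K := by
  have := (h.ends _ h.neg_mem (by linarith [h.pos])).1
  rw [← u.source, ← hu, u'.source] at this
  exact this

theorem IsSmallAngle.target_mem {u : Path a b} {ε : ℝ} (h : IsSmallAngle u ε) {a' b' : UFred K}
    {u' : Path a' b'} (hu : ∀ t, (u' t : K →L[ℂ] K) =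
      Complex.exp (((-ε : ℝ) : ℂ) * Complex.I) • (u t : K →L[ℂ] K)) : b' ∈ starSet K := by
  have := (h.ends _ h.neg_mem (by linarith [h.pos])).2
  rw [← u.target, ← hu, u'.target] at this
  exact this

theorem hasWinding_iff (u : Path a b) (n : ℤ) :
    HasWinding u n ↔ ∃ ε, IsSmallAngle u ε ∧ ∃ (a' b' : UFred K) (u' : Path a' b')
      (ha : a' ∈ starSet K) (hb : b' ∈ starSet K),
      (∀ t, (u' t : K →L[ℂ] K) = Complex.exp (((-ε : ℝ) : ℂ) * Complex.I) • (u t : K →L[ℂ] K)) ∧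
      HasIndex u' ha hb n := by
  constructor
  · rintro ⟨ε, h1, h2, h3, a', b', u', h4, h5⟩
    have h : IsSmallAngle u ε := ⟨h1, h2, h3⟩
    have h4' : ∀ t, (u' t : K →L[ℂ] K) =
        Complex.exp (((-ε : ℝ) : ℂ) * Complex.I) • (u t : K →L[ℂ] K) := fun t => by
      rw [h4, Complex.ofReal_neg]
    have ha := h.source_mem h4'
    have hb := h.target_mem h4'
    exact ⟨ε, h, a', b', u', ha, hb, h4', (hasRelWinding_iff u' ha hb n).1 h5⟩
  · rintro ⟨ε, h, a', b', u', ha, hb, h4, h5⟩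
    exact ⟨ε, h.pos, h.mem, h.ends, a', b', u', fun t => by rw [h4, Complex.ofReal_neg],
      (hasRelWinding_iff u' ha hb n).2 h5⟩

/-- The winding number of `u` is the index of `e^{iφ} u` for negative `φ` near zero. -/
theorem HasWinding.hasIndex {u : Path a b} {n : ℤ} (h : HasWinding u n) {φ₀ : ℝ}
    (hmem : ∀ φ ∈ Set.Icc φ₀ 0, ∀ t : I,
      Complex.exp (φ * Complex.I) • (u t : K →L[ℂ] K) ∈ UFred K)
    (hends : ∀ φ ∈ Set.Icc φ₀ 0, (φ = φ₀ ∨ φ ≠ 0) →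
      Complex.exp (φ * Complex.I) • (a : K →L[ℂ] K) ∈ UStar K ∧
      Complex.exp (φ * Complex.I) • (b : K →L[ℂ] K) ∈ UStar K) (hφ₀ : φ₀ ≤ 0)
    {a' b' : UFred K} {u' : Path a' b'} (ha : a' ∈ starSet K) (hb : b' ∈ starSet K)
    (hu : ∀ t, (u' t : K →L[ℂ] K) = Complex.exp ((φ₀ : ℂ) * Complex.I) • (u t : K →L[ℂ] K)) :
    HasIndex u' ha hb n := by
  obtain ⟨ε, h, a₁, b₁, u₁, ha₁, hb₁, h1, h2⟩ := (hasWinding_iff u n).1 h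
  -- Every angle between −ε and φ₀ is nonpositive and lies in one of the two ranges known to be
  -- admissible. The angle 0 occurs only as φ₀ itself, where admissibility at the endpoints is
  -- assumed.
  have hle : ∀ φ ∈ Set.uIcc (-ε) φ₀, φ ≤ 0 := fun φ hφ => by
    have := hφ.2
    rcases le_sup_iff.1 this with h' | h' <;> linarith [h.pos]
  have hcase : ∀ φ ∈ Set.uIcc (-ε) φ₀, -ε ≤ φ ∨ φ₀ ≤ φ := fun φ hφ => inf_le_iff.1 hφ.1
  refine HasIndex.of_rotation u (fun φ hφ t => ?_) (fun φ hφ => ?_) h1 hu ha hb h2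
  · rcases hcase φ hφ with h' | h'
    · exact h.mem φ ⟨h', (hle φ hφ).trans h.pos.le⟩ t
    · exact hmem φ ⟨h', hle φ hφ⟩ t
  · rcases eq_or_ne φ φ₀ with rfl | h0
    · exact hends φ ⟨le_rfl, hφ₀⟩ (Or.inl rfl)
    rcases eq_or_ne φ 0 with rfl | h0'
    · exfalso
      rcases le_sup_iff.1 hφ.2 with h' | h'
      · linarith [h.pos]
      · exact h0 (le_antisymm h' hφ₀)
    rcases hcase φ hφ with h' | h'
    · exact h.ends φ ⟨h', (hle φ hφ).trans h.pos.le⟩ h0'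
    · exact hends φ ⟨h', hle φ hφ⟩ (Or.inr h0')

theorem existsUnique_hasWinding (u : Path a b) : ∃! n, HasWinding u n := by
  obtain ⟨ε, h⟩ := exists_isSmallAngle u
  have hu : ∀ t, (rotPath u (-ε) (h.mem _ h.neg_mem) t : K →L[ℂ] K) =
      Complex.exp (((-ε : ℝ) : ℂ) * Complex.I) • (u t : K →L[ℂ] K) := fun t => rfl
  have ha := h.source_mem hu
  have hb := h.target_mem hu
  obtain ⟨n, hn, hn'⟩ := existsUnique_hasIndex (rotPath u (-ε) (h.mem _ h.neg_mem)) ha hb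
  refine ⟨n, (hasWinding_iff u n).2 ⟨ε, h, _, _, _, ha, hb, hu, hn⟩, fun m hm => hn' m ?_⟩
  have h0 := h.pos
  exact hm.hasIndex (fun φ hφ => h.mem φ ⟨hφ.1, hφ.2.trans h0.le⟩)
    (fun φ hφ hc => h.ends φ ⟨hφ.1, hφ.2.trans h0.le⟩ (by
      rcases hc with rfl | hc
      · linarith
      · exact hc)) (by linarith) ha hb hu

/-- The case φ₀ = 0: if the endpoints are already in UStar, no rotation is needed. -/
theorem HasWinding.hasIndex_self {u : Path a b} {n : ℤ} (h : HasWinding u n)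
    (ha : a ∈ starSet K) (hb : b ∈ starSet K) : HasIndex u ha hb n := by
  have h0 : ∀ φ ∈ Set.Icc (0 : ℝ) 0, ∀ U : K →L[ℂ] K, Complex.exp (φ * Complex.I) • U = U :=
    fun φ hφ U => by
      rw [le_antisymm hφ.2 hφ.1]; simp
  refine h.hasIndex (φ₀ := 0) (fun φ hφ t => ?_) (fun φ hφ _ => ?_) le_rfl ha hb fun t => ?_
  · rw [h0 φ hφ]; exact (u t).2
  · rw [h0 φ hφ, h0 φ hφ]; exact ⟨ha, hb⟩
  · rw [h0 0 ⟨le_rfl, le_rfl⟩]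

/-! ### Crossing the eigenvalue `-1` -/

theorem one_add_smul_mem_UStar {p : K →L[ℂ] K} (hp : IsStarProjection p) {z : ℂ} (hz : ‖z‖ = 1)
    (hz1 : z ≠ -1) : 1 + (z - 1) • p ∈ UStar K := by
  refine mem_UStar_iff.2 ⟨one_add_smul_mem_unitary hp hz, ?_⟩
  have h1 : z + 1 ≠ 0 := fun h => hz1 (eq_neg_of_add_eq_zero_left h)
  have h2 := isUnit_add_smul_compl (P := 1 - p) hp.one_sub.isIdempotentElem.eq
    (mul_ne_zero h1 (inv_ne_zero two_ne_zero))
  have h3 := h2.smul (Units.mk0 (2 : ℂ) two_ne_zero)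
  have e : 1 + (z - 1) • p + 1 =
      (Units.mk0 (2 : ℂ) two_ne_zero) • (1 - p + ((z + 1) * 2⁻¹) • (1 - (1 - p))) := by
    change _ = (2 : ℂ) • (1 - p + ((z + 1) * 2⁻¹) • (1 - (1 - p)))
    module
  rw [e]
  exact h3

/-- On ker(U + 1) the operator is the identity for every z. For z ≠ 1 it is zU + 1 with the
eigenvalue 1 − z on that kernel divided out; for z = 1 it is U + 1 + p. -/
theorem isUnit_one_add_compl_kerProj {U : K →L[ℂ] K} (hU : U ∈ UFred K) {z : ℂ}
    (hz : z ≠ 1 → z • U ∈ UStar K) : IsUnit (1 + (1 - kerProj U) * (z • U)) := by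
  have h1 : 1 + (1 - kerProj U) * (z • U) = 1 + z • U + z • kerProj U := by
    rw [sub_mul, one_mul, Algebra.mul_smul_comm, kerProj_mul hU.1]; module
  rw [h1]
  rcases eq_or_ne z 1 with rfl | h
  · rw [one_smul, one_smul, add_comm 1 U]
    exact isUnit_add_kerProj hU
  · have h0 : 1 - z ≠ 0 := sub_ne_zero.2 h.symm
    have hpp : kerProj U * kerProj U = kerProj U := (isStarProjection_kerProj U).isIdempotentElem.eq
    have h2 := isUnit_add_smul_compl (P := 1 - kerProj U)
      (isStarProjection_kerProj U).one_sub.isIdempotentElem.eq (inv_ne_zero h0)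
    have e : 1 + z • U + z • kerProj U =
        (z • U + 1) * (1 - kerProj U + (1 - z)⁻¹ • (1 - (1 - kerProj U))) := by
      simp only [sub_sub_cancel, add_mul, mul_add, mul_sub, mul_one, one_mul,
        Algebra.mul_smul_comm, Algebra.smul_mul_assoc, mul_kerProj]
      trans z • U + 1 + ((1 - z) * (1 - z)⁻¹ - (1 - z)) • kerProj U
      · rw [mul_inv_cancel₀ h0]; module
      · module
    rw [e]
    exact (mem_UStar_iff.1 (hz h)).2.mul h2

/-- The resolvent in the transform acts as the identity on ker(U + 1), so only the eigenvalue −z of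
zU there survives. -/
theorem mob_smul_kerProj {U : K →L[ℂ] K} {z : ℂ}
    (hu : IsUnit (1 + (1 - kerProj U) * (z • U))) :
    mob (kerProj U) (z • U) 1 = 1 + (-z - 1) • kerProj U := by
  have hpp : kerProj U * kerProj U = kerProj U := (isStarProjection_kerProj U).isIdempotentElem.eq
  have h1 : (1 + (1 - kerProj U) * (z • U)) * kerProj U = kerProj U := by
    simp only [add_mul, sub_mul, one_mul, Algebra.mul_smul_comm, Algebra.smul_mul_assoc, mul_assoc,
      mul_kerProj, mul_neg, hpp]
    module
  have h2 : Ring.inverse (1 + (1 - kerProj U) * (z • U)) * kerProj U = kerProj U := by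
    calc _ = Ring.inverse (1 + (1 - kerProj U) * (z • U)) *
          ((1 + (1 - kerProj U) * (z • U)) * kerProj U) := by rw [h1]
      _ = _ := by rw [← mul_assoc, Ring.inverse_mul_cancel _ hu, one_mul]
  rw [mob_one, mul_assoc (z • U), h2]
  simp only [Algebra.mul_smul_comm, Algebra.smul_mul_assoc, mul_kerProj, mul_neg, hpp]
  module

theorem neg_exp_ne_neg_one {φ : ℝ} (h0 : φ ≠ 0) (h1 : |φ| < 2 * Real.pi) :
    -Complex.exp (φ * Complex.I) ≠ -1 := fun h => exp_mul_I_ne_one h0 h1 (neg_injective h)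

theorem kerProj_eq_zero {U : K →L[ℂ] K} (hU : U ∈ UStar K) : kerProj U = 0 := by
  have h := (mem_UStar_iff.1 hU).2
  have h2 : (U + 1) * kerProj U = 0 := by rw [add_mul, mul_kerProj]; simp
  exact (h.mul_right_eq_zero).1 h2

/-- The path `e^{iφ} U`, where `φ` runs from `α > 0` to `-α`, has index minus the multiplicity of
the eigenvalue `-1`, if `-1` is not in the spectrum of `e^{iφ} U` for other `φ`. -/
theorem hasIndex_crossing {U : K →L[ℂ] K} (hU : U ∈ UFred K) {α : ℝ} (hα : 0 < α)
    (h : ∀ φ : ℝ, φ ≠ 0 → |φ| ≤ α → Complex.exp (φ * Complex.I) • U ∈ UStar K)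
    {u : Path a b} (hu : ∀ t : I, (u t : K →L[ℂ] K) =
      Complex.exp (((α * (1 - 2 * t) : ℝ) : ℂ) * Complex.I) • U)
    (ha : a ∈ starSet K) (hb : b ∈ starSet K) :
    HasIndex u ha hb (-Module.finrank ℂ (U + 1).ker) := by
  -- If −1 is not an eigenvalue the hypotheses put no bound on α, but then the whole path lies in
  -- UStar. Otherwise α < 2π, since the rotation by 2π returns to U.
  by_cases hU0 : U ∈ UStar K
  · have h1 : ∀ t, u t ∈ starSet K := fun t => by
      change (u t : K →L[ℂ] K) ∈ UStar K
      rw [hu]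
      by_cases h0 : α * (1 - 2 * (t : ℝ)) = 0
      · rw [h0]; simpa using hU0
      · refine h _ h0 ?_
        rw [abs_mul, abs_of_pos hα]
        have : |1 - 2 * (t : ℝ)| ≤ 1 := by
          rw [abs_le]; constructor <;> linarith [t.2.1, t.2.2]
        nlinarith
    have h2 := hasIndex_zero_of_mem u h1 ha hb
    rwa [← range_kerProj, kerProj_eq_zero hU0, show ((0 : K →L[ℂ] K)).range = ⊥ from
      LinearMap.range_zero, finrank_bot, Nat.cast_zero, neg_zero]
  have hα2 : α < 2 * Real.pi := by
    by_contra hc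
    push Not at hc
    refine hU0 ?_
    have := h (2 * Real.pi) Real.two_pi_pos.ne' (by rwa [abs_of_pos Real.two_pi_pos])
    simpa [Complex.exp_two_pi_mul_I] using this
  set p := kerProj U with hpdef
  have hp : IsStarProjection p := isStarProjection_kerProj U
  have hpf := hasFiniteRange_kerProj hU
  have hangle : ∀ φ : ℝ, |φ| ≤ α → Complex.exp (φ * Complex.I) ≠ 1 →
      Complex.exp (φ * Complex.I) • U ∈ UStar K := fun φ hφ h1 =>
    h φ (by rintro rfl; simp at h1) hφ
  have habs : ∀ t : I, |1 - 2 * (t : ℝ)| ≤ 1 := fun t => by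
    rw [abs_le]; constructor <;> linarith [t.2.1, t.2.2]
  have hle : ∀ t : I, |α * (1 - 2 * (t : ℝ))| ≤ α := fun t => by
    rw [abs_mul, abs_of_pos hα]
    nlinarith [habs t]
  have hunit : ∀ t : I, IsUnit (1 + (1 - p) * (u t : K →L[ℂ] K)) := fun t => by
    rw [hu]; exact isUnit_one_add_compl_kerProj hU (hangle _ (hle t))
  have hunit' : ∀ (s t : I), IsUnit (1 + ((s : ℝ) : ℂ) • ((1 - p) * (u t : K →L[ℂ] K))) :=
    fun s t => isUnit_one_add_smul hp (u t).2.1 (hunit t) s.2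
  let W : C(ℝ, UFred K) := ⟨fun x => ⟨1 + (-Complex.exp (x * Complex.I) - 1) • p,
    one_add_smul_mem_UFred hp hpf (by rw [norm_neg, Complex.norm_exp_ofReal_mul_I])⟩,
    Continuous.subtype_mk (by fun_prop) _⟩
  have hW : ∀ x : ℝ, x ≠ 0 → |x| < 2 * Real.pi → W x ∈ starSet K := fun x h0 h1 =>
    one_add_smul_mem_UStar hp (by rw [norm_neg, Complex.norm_exp_ofReal_mul_I])
      (neg_exp_ne_neg_one h0 h1)
  let w : C(I, UFred K) := W.comp ⟨fun t => α * (1 - 2 * (t : ℝ)), by fun_prop⟩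
  have h1 : ContinuousMap.HomotopicWith u.toContinuousMap w
      (fun f => f 0 ∈ starSet K ∧ f 1 ∈ starSet K) := by
    have hmob : ∀ s t : I, u t ∈ starSet K → mob p (u t : K →L[ℂ] K) s ∈ UStar K :=
      fun s t ht => mob_mem_UStar hp ht s.2 (hunit t)
    refine homotopicWith_of_map (fun x => ⟨mob p (u x.2 : K →L[ℂ] K) (x.1 : ℝ),
      mob_mem_UFred hp hpf (u x.2).2 x.1.2 (hunit x.2)⟩) ?_ (fun t => ?_) (fun t => ?_)
      fun k s hk => ⟨?_, ?_⟩
    · exact Continuous.subtype_mk (continuous_mob p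
        (U := fun x : I × I => (u x.2 : K →L[ℂ] K)) (r := fun x : I × I => (x.1 : ℝ))
        (continuous_subtype_val.comp (u.continuous.comp continuous_snd)) (by fun_prop)
        fun x => hunit' x.1 x.2) _
    · exact Subtype.ext mob_zero
    · refine Subtype.ext ?_
      have := hunit t
      rw [hu] at this
      change mob p (u t : K →L[ℂ] K) ((1 : I) : ℝ) = _
      rw [Set.Icc.coe_one, hu]
      exact mob_smul_kerProj this
    · rw [hk]; exact hmob s 0 (by rw [u.source]; exact ha)
    · rw [hk]; exact hmob s 1 (by rw [u.target]; exact hb)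
  -- Stretch the half width of the arc from α to π. It stays strictly between 0 and 2π, so the
  -- endpoints stay in UStar, and for half width π the arc −e^{iπ(1−2t)} = e^{−2πit} is one negative
  -- turn.
  have h2 : ContinuousMap.HomotopicWith w (projLoop p hp hpf (-1)).toContinuousMap
      (fun f => f 0 ∈ starSet K ∧ f 1 ∈ starSet K) := by
    have hr : ∀ s : I, 0 < α + s * (Real.pi - α) ∧ α + s * (Real.pi - α) < 2 * Real.pi := fun s => by
      have hπ := Real.pi_pos
      rcases s.2.2.lt_or_eq with h1 | h1
      · constructor <;> nlinarith [s.2.1, mul_pos (sub_pos.2 h1) hα]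
      · rw [h1]; constructor <;> linarith
    refine homotopicWith_of_map (fun x => W ((α + x.1 * (Real.pi - α)) * (1 - 2 * (x.2 : ℝ))))
      (W.continuous.comp (by fun_prop)) (fun t => ?_) (fun t => ?_) fun k s hk => ⟨?_, ?_⟩
    · simp [w]
    · refine Subtype.ext ?_
      have e : -Complex.exp ((((α + ((1 : I) : ℝ) * (Real.pi - α)) * (1 - 2 * (t : ℝ)) : ℝ) : ℂ) *
          Complex.I) = Complex.exp (2 * Real.pi * Complex.I * (-1 : ℤ) * (t : ℝ)) := by
        have e1 : (((α + ((1 : I) : ℝ) * (Real.pi - α)) * (1 - 2 * (t : ℝ)) : ℝ) : ℂ) * Complex.I =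
            Real.pi * Complex.I + 2 * Real.pi * Complex.I * (-1 : ℤ) * (t : ℝ) := by
          rw [Set.Icc.coe_one]; push_cast; ring
        rw [e1, Complex.exp_add, Complex.exp_pi_mul_I, neg_one_mul, neg_neg]
      change 1 + (-Complex.exp ((((α + ((1 : I) : ℝ) * (Real.pi - α)) * (1 - 2 * (t : ℝ)) : ℝ) : ℂ) *
          Complex.I) - 1) • p = _
      rw [e]
      rfl
    · rw [hk]
      have := hr s
      simp only [Set.Icc.coe_zero, mul_zero, sub_zero, mul_one]
      exact hW _ this.1.ne' (by rw [abs_of_pos this.1]; exact this.2)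
    · rw [hk]
      have := hr s
      refine hW _ ?_ ?_
      · simp only [Set.Icc.coe_one]
        intro h; linarith
      · simp only [Set.Icc.coe_one]
        rw [abs_mul, abs_of_pos this.1]; norm_num; exact this.2
  have hone : oneUFred K ∈ starSet K := one_mem_UStar
  have h3 : HasIndex (projLoop p hp hpf (-1)) hone hone _ :=
    .of_loopWinding hone (hasLoopWinding_projLoop hp hpf (-1))
  have h4 := h3.of_homotopicWith ha hb (h1.trans h2).symm
  rwa [range_kerProj, neg_one_mul] at h4

end Rotation

/-! ### Lagrangian projections, their unitaries, and the action of e^{sγ} -/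

section Lagrangian

variable {H : Type*} [NormedAddCommGroup H] [InnerProductSpace ℂ H] [CompleteSpace H]

variable {γ P Q : H →L[ℂ] H}

theorem exists_add_plus_minus (hγ : IsHermitianSymplectic γ) (x : H) :
    ∃ (y : Eplus γ) (z : Eminus γ), x = y + z := by
  have hg2 : γ (γ x) = -x := by
    simpa using congrArg (fun T : H →L[ℂ] H => T x) hγ.sq
  have hI : Complex.I • Complex.I • γ x = -γ x := by rw [smul_smul]; simp
  refine ⟨⟨(2⁻¹ : ℂ) • (x - Complex.I • γ x), ?_⟩, ⟨(2⁻¹ : ℂ) • (x + Complex.I • γ x), ?_⟩, ?_⟩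
  · rw [mem_Eplus, map_smul, map_sub, map_smul, hg2, smul_comm Complex.I, smul_sub Complex.I, hI]
    congr 1; module
  · rw [mem_Eminus, map_smul, map_add, map_smul, hg2, smul_comm Complex.I, ← smul_neg,
      smul_add Complex.I, hI]
    congr 1; module
  · change x = (2⁻¹ : ℂ) • (x - Complex.I • γ x) + (2⁻¹ : ℂ) • (x + Complex.I • γ x)
    module

/-- Operators that agree on both eigenspaces are equal. -/
theorem clm_ext_plus_minus (hγ : IsHermitianSymplectic γ) {S T : H →L[ℂ] H}
    (h1 : ∀ y : Eplus γ, S y = T y) (h2 : ∀ z : Eminus γ, S z = T z) : S = T := by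
  ext x
  obtain ⟨y, z, rfl⟩ := exists_add_plus_minus hγ x
  rw [map_add, map_add, h1, h2]

theorem proj_minus_plus (hγ : IsHermitianSymplectic γ) (y : Eplus γ) :
    (Eminus γ).orthogonalProjectionOnto (y : H) = 0 := by
  have h := proj_minus hγ y.2 (zero_mem (Eminus γ))
  rw [add_zero] at h
  exact h

theorem proj_plus_minus (hγ : IsHermitianSymplectic γ) (z : Eminus γ) :
    (Eplus γ).orthogonalProjectionOnto (z : H) = 0 := by
  refine Submodule.orthogonalProjectionOnto_apply_of_mem_orthogonal fun y hy => ?_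
  rw [← inner_conj_symm, inner_plus_minus hγ hy z.2, map_zero]

/-- The reflection with off-diagonal blocks `W` and `W*`. -/
def reflection (γ : H →L[ℂ] H) (W : Eplus γ →L[ℂ] Eminus γ) : H →L[ℂ] H :=
  (Eminus γ).subtypeL ∘L W ∘L (Eplus γ).orthogonalProjectionOnto +
    (Eplus γ).subtypeL ∘L ContinuousLinearMap.adjoint W ∘L (Eminus γ).orthogonalProjectionOnto

/-- The Lagrangian projection `½ [[1, W*], [W, 1]]`. -/
def lag (γ : H →L[ℂ] H) (W : Eplus γ →L[ℂ] Eminus γ) : H →L[ℂ] H :=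
  (2⁻¹ : ℂ) • (1 + reflection γ W)

theorem continuous_lag : Continuous (lag γ) := by
  have h : Continuous fun W : Eplus γ →L[ℂ] Eminus γ => ContinuousLinearMap.adjoint W :=
    ContinuousLinearMap.adjoint.continuous
  unfold lag reflection
  fun_prop

theorem reflection_plus (hγ : IsHermitianSymplectic γ) (W : Eplus γ →L[ℂ] Eminus γ) (y : Eplus γ) :
    reflection γ W y = W y := by
  simp [reflection, proj_minus_plus hγ]

theorem reflection_minus (hγ : IsHermitianSymplectic γ) (W : Eplus γ →L[ℂ] Eminus γ)
    (z : Eminus γ) : reflection γ W z = ContinuousLinearMap.adjoint W z := by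
  simp [reflection, proj_plus_minus hγ]

theorem star_reflection (W : Eplus γ →L[ℂ] Eminus γ) :
    star (reflection γ W) = reflection γ W := by
  rw [ContinuousLinearMap.star_eq_adjoint, reflection, map_add, ContinuousLinearMap.adjoint_comp,
    ContinuousLinearMap.adjoint_comp, ContinuousLinearMap.adjoint_comp,
    ContinuousLinearMap.adjoint_comp, ContinuousLinearMap.adjoint_adjoint,
    Submodule.adjoint_orthogonalProjectionOnto, Submodule.adjoint_orthogonalProjectionOnto,
    Submodule.adjoint_subtypeL, Submodule.adjoint_subtypeL, ContinuousLinearMap.comp_assoc,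
    ContinuousLinearMap.comp_assoc, add_comm]

/-- Unitary maps from `E_i` to `E_{-i}`. -/
def IsUnitaryMap (W : Eplus γ →L[ℂ] Eminus γ) : Prop :=
  ContinuousLinearMap.adjoint W ∘L W = 1 ∧ W ∘L ContinuousLinearMap.adjoint W = 1

theorem isUnitaryMap_Phi (hγ : IsHermitianSymplectic γ) (hP : P ∈ Gr γ) :
    IsUnitaryMap (Phi γ P) :=
  ⟨Phi_adjoint_comp hγ hP, Phi_comp_adjoint hγ hP⟩

variable {W : Eplus γ →L[ℂ] Eminus γ}

theorem reflection_mul_self (hγ : IsHermitianSymplectic γ) (hW : IsUnitaryMap W) :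
    reflection γ W * reflection γ W = 1 := by
  refine clm_ext_plus_minus hγ (fun y => ?_) fun z => ?_
  · rw [mul_apply_eq_comp, reflection_plus hγ, reflection_minus hγ]
    exact congrArg (fun T : Eplus γ →L[ℂ] Eplus γ => ((T y : Eplus γ) : H)) hW.1
  · rw [mul_apply_eq_comp, reflection_minus hγ, reflection_plus hγ]
    exact congrArg (fun T : Eminus γ →L[ℂ] Eminus γ => ((T z : Eminus γ) : H)) hW.2

theorem gamma_mul_reflection (hγ : IsHermitianSymplectic γ) :
    γ * reflection γ W = -(reflection γ W * γ) := by
  refine clm_ext_plus_minus hγ (fun y => ?_) fun z => ?_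
  · rw [mul_apply_eq_comp, neg_apply, mul_apply_eq_comp, mem_Eplus.1 y.2, map_smul,
      reflection_plus hγ, mem_Eminus.1 (W y).2]
  · rw [mul_apply_eq_comp, neg_apply, mul_apply_eq_comp, mem_Eminus.1 z.2, map_neg, map_smul,
      reflection_minus hγ, mem_Eplus.1 (ContinuousLinearMap.adjoint W z).2, neg_neg]

theorem lag_mem_Gr (hγ : IsHermitianSymplectic γ) (hW : IsUnitaryMap W) : lag γ W ∈ Gr γ := by
  have h1 := reflection_mul_self hγ hW
  refine ⟨⟨?_, ?_⟩, ?_⟩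
  · change lag γ W * lag γ W = lag γ W
    rw [lag, smul_mul_smul_comm, mul_add, add_mul, add_mul, h1]
    simp only [mul_one, one_mul]
    module
  · change star (lag γ W) = lag γ W
    rw [lag, star_smul, star_add, star_reflection, star_one]
    simp
  · have h2 : γ * star γ = 1 := by rw [hγ.adj, mul_neg, hγ.sq, neg_neg]
    rw [lag, Algebra.mul_smul_comm, Algebra.smul_mul_assoc, mul_add, mul_one,
      gamma_mul_reflection hγ, add_mul, h2, neg_mul, mul_assoc, h2, mul_one]
    module

theorem two_smul_lag_sub (x : H) : (2 : ℂ) • lag γ W x - x = reflection γ W x := by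
  simp only [lag, smul_apply, add_apply, one_apply_eq_self]
  module

theorem Phi_lag (hγ : IsHermitianSymplectic γ) (hW : IsUnitaryMap W) : Phi γ (lag γ W) = W := by
  ext y
  rw [Phi_apply hγ (lag_mem_Gr hγ hW), two_smul_lag_sub, reflection_plus hγ]

theorem lag_Phi (hγ : IsHermitianSymplectic γ) (hP : P ∈ Gr γ) : lag γ (Phi γ P) = P := by
  refine clm_ext_plus_minus hγ (fun y => ?_) fun z => ?_
  · simp only [lag, smul_apply, add_apply, one_apply_eq_self]
    rw [reflection_plus hγ, Phi_apply hγ hP]; module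
  · simp only [lag, smul_apply, add_apply, one_apply_eq_self]
    rw [reflection_minus hγ, Phi_adjoint_apply hγ hP]; module

/-! ### Fredholm pairs and invertible pairs in terms of `Φ(P) Φ(Q)*` -/

/-- The Lagrangian im Q is the graph of Φ(Q)* over E_{-i}, and likewise for P. In these coordinates
P : im Q → im P becomes half of Φ(P)Φ(Q)* + 1; the factor 2 is absorbed in `eP`. -/
theorem exists_PhiPair_add_one (hγ : IsHermitianSymplectic γ) (hP : P ∈ Gr γ) (hQ : Q ∈ Gr γ) :
    ∃ eP : P.range ≃L[ℂ] Eminus γ, PhiPair γ (P, Q) + 1 =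
      eP.toContinuousLinearMap ∘L pairMap P Q ∘L (graphEquiv hγ hQ).toContinuousLinearMap := by
  let c : Eminus γ ≃L[ℂ] Eminus γ := ContinuousLinearEquiv.smulLeft (Units.mk0 (2 : ℂ) two_ne_zero)
  let eP := (graphEquiv hγ hP).symm.trans c
  let eQ := graphEquiv hγ hQ
  refine ⟨eP, ?_⟩
  ext y
  have e1 : (eQ y : H) = (2 : ℂ) • Q y := rfl
  have hw : (2 : ℂ) • Q (y : H) - y ∈ Eplus γ := gr_reflect_minus hγ hQ y.2
  have e3 : P ((2 : ℂ) • Q (y : H)) = (2⁻¹ : ℂ) • ((2 : ℂ) • P y - y + ((2 : ℂ) • Q y - y)) +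
      (2⁻¹ : ℂ) • (((2 : ℂ) • P ((2 : ℂ) • Q y - y) - ((2 : ℂ) • Q y - y)) + y) := by
    simp only [map_sub, map_smul]; module
  have e4 := proj_minus hγ
    ((Eplus γ).smul_mem (2⁻¹ : ℂ) ((Eplus γ).add_mem (gr_reflect_minus hγ hP y.2) hw))
    ((Eminus γ).smul_mem (2⁻¹ : ℂ) ((Eminus γ).add_mem (gr_reflect_plus hγ hP hw) y.2))
  rw [← e3] at e4
  have e5 : (eP (pairMap P Q (eQ y)) : H) =
      (2 : ℂ) • ((Eminus γ).orthogonalProjectionOnto (P (eQ y : H)) : H) := rfl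
  change (PhiPair γ (P, Q) y + y : H) = eP (pairMap P Q (eQ y))
  rw [e5, e1, e4]
  simp only [PhiPair, ContinuousLinearMap.comp_apply, Phi_apply hγ hP, Phi_adjoint_apply hγ hQ]
  module

theorem mem_GrStar_iff (hγ : IsHermitianSymplectic γ) (hP : P ∈ Gr γ) (hQ : Q ∈ Gr γ) :
    (P, Q) ∈ GrStar γ ↔ PhiPair γ (P, Q) ∈ UStar (Eminus γ) := by
  obtain ⟨eP, h⟩ := exists_PhiPair_add_one hγ hP hQ
  have h1 : IsUnit (PhiPair γ (P, Q) + 1) ↔ Function.Bijective (pairMap P Q) := by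
    rw [ContinuousLinearMap.isUnit_iff_bijective, h]
    change Function.Bijective (eP ∘ (pairMap P Q ∘ graphEquiv hγ hQ)) ↔ _
    rw [eP.bijective.of_comp_iff', Function.Bijective.of_comp_iff _ (graphEquiv hγ hQ).bijective]
  rw [mem_UStar_iff, h1]
  exact ⟨fun h => ⟨PhiPair_mem_unitary hγ hP hQ, h.2.2⟩, fun h => ⟨hP, hQ, h.2⟩⟩

theorem mem_GrFred_of_mem_UFred (hγ : IsHermitianSymplectic γ) (hP : P ∈ Gr γ) (hQ : Q ∈ Gr γ)
    (h : PhiPair γ (P, Q) ∈ UFred (Eminus γ)) : (P, Q) ∈ GrFred γ := by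
  obtain ⟨eP, h1⟩ := exists_PhiPair_add_one hγ hP hQ
  let eQ := graphEquiv hγ hQ
  obtain ⟨v, hv⟩ := (mem_UFred_iff.1 h).2.exists_isQuasiInverse
  refine ⟨hP, hQ, ContinuousLinearMap.IsFredholm.of_isQuasiInverse
    (v := eQ.toContinuousLinearMap ∘L v ∘L eP.toContinuousLinearMap) ?_⟩
  have h2 := (eQ.symm.toLinearEquiv.isQuasiInverse.comp hv).comp eP.symm.toLinearEquiv.isQuasiInverse
  have h3 : pairMap P Q = eP.symm.toContinuousLinearMap ∘L (PhiPair γ (P, Q) + 1) ∘L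
      eQ.symm.toContinuousLinearMap := by
    rw [h1]
    ext x
    simp [eQ]
  rw [h3]
  exact h2

/-- The graph coordinates on im Q carry ker(Φ(P)Φ(Q)* + 1) onto the part of im Q killed by P. -/
theorem finrank_ker_inf_range (hγ : IsHermitianSymplectic γ) (hP : P ∈ Gr γ) (hQ : Q ∈ Gr γ) :
    Module.finrank ℂ ↥(P.ker ⊓ Q.range) =
      Module.finrank ℂ (PhiPair γ (P, Q) + 1).ker := by
  obtain ⟨eP, h⟩ := exists_PhiPair_add_one hγ hP hQ
  let f : Eminus γ →ₗ[ℂ] H := Q.range.subtype ∘ₗ (graphEquiv hγ hQ).toLinearEquiv.toLinearMap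
  have hf : Function.Injective f :=
    (Subtype.val_injective).comp (graphEquiv hγ hQ).injective
  have hk : ∀ y : Eminus γ, y ∈ (PhiPair γ (P, Q) + 1).ker ↔ P (f y) = 0 := fun y => by
    rw [h, LinearMap.mem_ker]
    change eP (pairMap P Q (graphEquiv hγ hQ y)) = 0 ↔ _
    rw [eP.map_eq_zero_iff, Subtype.ext_iff]
    rfl
  have e : Submodule.map f (PhiPair γ (P, Q) + 1).ker = P.ker ⊓ Q.range := by
    ext x
    constructor
    · rintro ⟨y, hy, rfl⟩
      exact ⟨(hk y).1 hy, (graphEquiv hγ hQ y).2⟩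
    · rintro ⟨h1, h2⟩
      have h3 : f ((graphEquiv hγ hQ).symm ⟨x, h2⟩) = x := by
        change ((graphEquiv hγ hQ ((graphEquiv hγ hQ).symm ⟨x, h2⟩) : Q.range) : H) = x
        rw [ContinuousLinearEquiv.apply_symm_apply]
      refine ⟨_, (hk _).2 ?_, h3⟩
      rw [h3]; exact h1
  rw [← e]
  exact (Submodule.equivMapOfInjective f hf _).finrank_eq.symm

/-! ### Rotating a Lagrangian -/

omit [CompleteSpace H] in
theorem pow_apply_of_eigen {T : H →L[ℂ] H} {x : H} {c : ℂ} (h : T x = c • x) (n : ℕ) :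
    (T ^ n) x = c ^ n • x := by
  induction n with
  | zero => simp
  | succ k ih => rw [pow_succ', mul_apply_eq_comp, ih, map_smul, h, smul_smul, pow_succ]

theorem exp_apply_of_eigen {T : H →L[ℂ] H} {x : H} {c : ℂ} (h : T x = c • x) :
    NormedSpace.exp T x = Complex.exp c • x := by
  have h1 := NormedSpace.exp_series_hasSum_exp' (𝕂 := ℂ) T
  have h2 := (ContinuousLinearMap.apply ℂ H x).hasSum h1
  have h3 := NormedSpace.exp_series_hasSum_exp' (𝕂 := ℂ) c
  have h4 := ((ContinuousLinearMap.id ℂ ℂ).smulRight x).hasSum h3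
  rw [← Complex.exp_eq_exp_ℂ] at h4
  refine h2.unique ?_
  convert h4 using 2 with n
  · simp [pow_apply_of_eigen h, smul_smul]
  · rfl

theorem exp_plus (s : ℂ) (y : Eplus γ) :
    NormedSpace.exp (s • γ) (y : H) = Complex.exp (s * Complex.I) • (y : H) :=
  exp_apply_of_eigen (by rw [smul_apply, mem_Eplus.1 y.2, smul_smul])

theorem exp_minus (s : ℂ) (z : Eminus γ) :
    NormedSpace.exp (s • γ) (z : H) = Complex.exp (-(s * Complex.I)) • (z : H) :=
  exp_apply_of_eigen (by rw [smul_apply, mem_Eminus.1 z.2, smul_neg, smul_smul, neg_smul])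

/-- e^{sγ} acts by e^{is} on E_i and by e^{−is} on E_{-i}. Conjugation therefore fixes the diagonal
blocks and multiplies the block E_i → E_{-i} by e^{−2is}. -/
theorem exp_mul_lag_mul_exp (hγ : IsHermitianSymplectic γ) (W : Eplus γ →L[ℂ] Eminus γ) (s : ℝ) :
    NormedSpace.exp ((s : ℂ) • γ) * lag γ W * NormedSpace.exp (-((s : ℂ) • γ)) =
      lag γ (Complex.exp (((-2 * s : ℝ) : ℂ) * Complex.I) • W) := by
  have hc : (starRingEnd ℂ) (Complex.exp (((-2 * s : ℝ) : ℂ) * Complex.I)) =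
      Complex.exp (s * Complex.I) * Complex.exp (s * Complex.I) := by
    rw [← Complex.exp_conj, map_mul, Complex.conj_ofReal, Complex.conj_I, ← Complex.exp_add]
    congr 1; push_cast; ring
  have hc' : Complex.exp (((-2 * s : ℝ) : ℂ) * Complex.I) =
      Complex.exp (-(s * Complex.I)) * Complex.exp (-(s * Complex.I)) := by
    rw [← Complex.exp_add]
    congr 1; push_cast; ring
  have h1 : Complex.exp (s * Complex.I) * Complex.exp (-(s * Complex.I)) = 1 := by
    rw [← Complex.exp_add, add_neg_cancel, Complex.exp_zero]
  rw [← neg_smul]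
  refine clm_ext_plus_minus hγ (fun y => ?_) fun z => ?_
  · rw [mul_apply_eq_comp, mul_apply_eq_comp, exp_plus, neg_mul, map_smul, map_smul]
    simp only [lag, smul_apply, add_apply, one_apply_eq_self]
    rw [reflection_plus hγ, reflection_plus hγ, map_smul, map_add, exp_plus, exp_minus, smul_apply,
      hc', Submodule.coe_smul]
    trans (2⁻¹ : ℂ) • ((Complex.exp (s * Complex.I) * Complex.exp (-(s * Complex.I))) • (y : H) +
      (Complex.exp (-(s * Complex.I)) * Complex.exp (-(s * Complex.I))) • (W y : H))
    · module
    · rw [h1, one_smul]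
  · rw [mul_apply_eq_comp, mul_apply_eq_comp, exp_minus, neg_mul, neg_neg, map_smul, map_smul]
    simp only [lag, smul_apply, add_apply, one_apply_eq_self]
    rw [reflection_minus hγ, reflection_minus hγ, map_smul, map_add, exp_plus, exp_minus,
      map_smulₛₗ, smul_apply, hc, Submodule.coe_smul]
    trans (2⁻¹ : ℂ) • ((Complex.exp (s * Complex.I) * Complex.exp (-(s * Complex.I))) • (z : H) +
      (Complex.exp (s * Complex.I) * Complex.exp (s * Complex.I)) •
        (ContinuousLinearMap.adjoint W z : H))
    · module
    · rw [h1, one_smul]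

theorem IsUnitaryMap.smul (hW : IsUnitaryMap W) {z : ℂ} (hz : ‖z‖ = 1) : IsUnitaryMap (z • W) := by
  have h : (starRingEnd ℂ) z * z = 1 := by
    rw [mul_comm, Complex.mul_conj, Complex.normSq_eq_norm_sq, hz]; simp
  constructor
  · rw [map_smulₛₗ, ContinuousLinearMap.smul_comp, ContinuousLinearMap.comp_smul, hW.1, smul_smul,
      h, one_smul]
  · rw [map_smulₛₗ, ContinuousLinearMap.smul_comp, ContinuousLinearMap.comp_smul, hW.2, smul_smul,
      mul_comm, h, one_smul]

theorem rotate_eq (hγ : IsHermitianSymplectic γ) {p : (H →L[ℂ] H) × (H →L[ℂ] H)}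
    (hp : p.1 ∈ Gr γ) (s : ℝ) : rotate γ s p =
      (lag γ (Complex.exp (((-2 * s : ℝ) : ℂ) * Complex.I) • Phi γ p.1), p.2) := by
  rw [rotate, ← exp_mul_lag_mul_exp hγ, lag_Phi hγ hp]

theorem rotate_fst_mem (hγ : IsHermitianSymplectic γ) {p : (H →L[ℂ] H) × (H →L[ℂ] H)}
    (hp : p.1 ∈ Gr γ) (s : ℝ) : (rotate γ s p).1 ∈ Gr γ := by
  rw [rotate_eq hγ hp]
  exact lag_mem_Gr hγ ((isUnitaryMap_Phi hγ hp).smul (Complex.norm_exp_ofReal_mul_I _))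

theorem PhiPair_rotate (hγ : IsHermitianSymplectic γ) {p : (H →L[ℂ] H) × (H →L[ℂ] H)}
    (hp : p.1 ∈ Gr γ) (s : ℝ) : PhiPair γ (rotate γ s p) =
      Complex.exp (((-2 * s : ℝ) : ℂ) * Complex.I) • PhiPair γ p := by
  rw [rotate_eq hγ hp, PhiPair,
    Phi_lag hγ ((isUnitaryMap_Phi hγ hp).smul (Complex.norm_exp_ofReal_mul_I _)), PhiPair,
    ContinuousLinearMap.smul_comp]

end Lagrangian

/-! ### Path connectedness of the unitary group -/

section UnitaryConnected

variable {K : Type*} [NormedAddCommGroup K] [InnerProductSpace ℂ K] [CompleteSpace K]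

theorem joined_smul_unitary {W : K →L[ℂ] K} (hW : W ∈ unitary (K →L[ℂ] K)) {z : ℂ} (hz : ‖z‖ = 1) :
    Joined (⟨z • W, smul_mem_unitary hW hz⟩ : unitary (K →L[ℂ] K)) ⟨W, hW⟩ := by
  have hz' : Complex.exp (Complex.arg z * Complex.I) = z := by
    have := Complex.norm_mul_exp_arg_mul_I z
    rwa [hz, Complex.ofReal_one, one_mul] at this
  exact ⟨{
    toFun := fun t => ⟨Complex.exp (((Complex.arg z * (1 - t) : ℝ) : ℂ) * Complex.I) • W,
      smul_mem_unitary hW (Complex.norm_exp_ofReal_mul_I _)⟩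
    continuous_toFun := Continuous.subtype_mk
      (continuous_exp_smul (by fun_prop) continuous_const) _
    source' := Subtype.ext (by simp [hz'])
    target' := Subtype.ext (by simp) }⟩

/-- The contraction of UStar joins 1 to zW, and turning the phase back joins zW to W. -/
theorem joined_one_of_smul_mem_UStar {W : K →L[ℂ] K} (hW : W ∈ unitary (K →L[ℂ] K)) {z : ℂ}
    (hz : ‖z‖ = 1) (h : z • W ∈ UStar K) : Joined (1 : unitary (K →L[ℂ] K)) ⟨W, hW⟩ := by
  refine Joined.trans ?_ (joined_smul_unitary hW hz)
  let a : UFred K := ⟨z • W, UStar_subset_UFred h⟩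
  have ha : a ∈ starSet K := h
  have hc : Continuous fun u : UFred K => (⟨u, u.2.1⟩ : unitary (K →L[ℂ] K)) :=
    continuous_subtype_val.subtype_mk _
  exact ⟨((starContraction K).toPt ha).map hc⟩

theorem mul_compl_unitary {A : Type*} [Ring A] {U V p : A} (hVU : V * U = 1) (hpp : p * p = p)
    (hU : p * U = U * p) : (V * p + (1 - p)) * (U * p + (1 - p)) = 1 := by
  have h1 : p * (U * p) = U * p := by rw [← mul_assoc, hU, mul_assoc, hpp]
  calc _ = V * (p * (U * p)) + (U * p - p * (U * p)) + V * (p - p * p) + (1 - p - (p - p * p)) := by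
        noncomm_ring
    _ = _ := by rw [h1, hpp, ← mul_assoc, hVU]; simp

theorem mem_unitary_block {U p : K →L[ℂ] K} (hU : U ∈ unitary (K →L[ℂ] K))
    (hp : IsStarProjection p) (hc : p * U = U * p) :
    U * p + (1 - p) ∈ unitary (K →L[ℂ] K) := by
  have hc' : p * star U = star U * p := by
    have := congrArg star hc
    rw [star_mul, star_mul, hp.isSelfAdjoint.star_eq] at this
    exact this.symm
  have hs : star (U * p + (1 - p)) = star U * p + (1 - p) := by
    rw [star_add, star_mul, star_sub, star_one, hp.isSelfAdjoint.star_eq, hc']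
  rw [Unitary.mem_iff, hs]
  exact ⟨mul_compl_unitary (Unitary.mem_iff.1 hU).1 hp.isIdempotentElem.eq hc,
    mul_compl_unitary (Unitary.mem_iff.1 hU).2 hp.isIdempotentElem.eq hc'⟩

/-- A unitary whose quadratic form has imaginary part of constant sign can be rotated into `UStar`
by a quarter turn. -/
theorem smul_mem_UStar_of_im {W : K →L[ℂ] K} (hW : W ∈ unitary (K →L[ℂ] K)) {z : ℂ} (hz : ‖z‖ = 1)
    (h : ∀ x, 0 ≤ ((starRingEnd ℂ) z * inner ℂ (W x) x).re) : z • W ∈ UStar K := by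
  refine mem_UStar_iff.2 ⟨smul_mem_unitary hW hz, isUnit_of_re_inner_le one_pos fun x => ?_⟩
  rw [add_apply, smul_apply, one_apply_eq_self, inner_add_left, inner_smul_left, Complex.add_re,
    one_mul, inner_self_eq_norm_sq_to_K]
  have := h x
  have e : (((‖x‖ : ℝ) : ℂ) ^ 2).re = ‖x‖ ^ 2 := by rw [← Complex.ofReal_pow, Complex.ofReal_re]
  change ‖x‖ ^ 2 ≤ _ + (((‖x‖ : ℝ) : ℂ) ^ 2).re
  rw [e]
  linarith

theorem starProjection_commute {M : Submodule ℂ K} [M.HasOrthogonalProjection] {U : K →L[ℂ] K}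
    (h : ∀ x ∈ M, U x ∈ M) (h' : ∀ x ∈ M, star U x ∈ M) :
    M.starProjection * U = U * M.starProjection := by
  have hp : IsStarProjection M.starProjection := isStarProjection_starProjection
  have key : ∀ V : K →L[ℂ] K, (∀ x ∈ M, V x ∈ M) →
      M.starProjection * (V * M.starProjection) = V * M.starProjection := fun V hV => by
    ext x
    exact Submodule.starProjection_eq_self_iff.2 (hV _ (Submodule.starProjection_apply_mem _ x))
  have h1 := congrArg star (key _ h')
  rw [star_mul, star_mul, star_star, hp.isSelfAdjoint.star_eq, mul_assoc, key _ h] at h1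
  exact h1.symm

theorem re_inner_smul_sub_star (U : K →L[ℂ] K) (x : K) :
    (inner ℂ ((-Complex.I • (U - star U)) x) x).re = -2 * (inner ℂ (U x) x).im := by
  have h : inner ℂ (star U x) x = (starRingEnd ℂ) (inner ℂ (U x) x) := by
    rw [ContinuousLinearMap.star_eq_adjoint, ContinuousLinearMap.adjoint_inner_left, inner_conj_symm]
  rw [smul_apply, sub_apply, inner_smul_left, inner_sub_left, h]
  generalize inner ℂ (U x) x = z
  simp
  ring

/-- Let B = −i(U − U*) and let p project to the kernel of its negative part, which commutes with U.
Then U = (Up + 1 − p)(U(1 − p) + p), and the quadratic form of each factor has imaginary part of one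
sign, so a quarter turn puts each factor into UStar. Only positive and negative parts are used, no
logarithm of U. -/
theorem joined_one_unitary (U : unitary (K →L[ℂ] K)) : Joined 1 U := by
  obtain ⟨U, hU⟩ := U
  set B : K →L[ℂ] K := -Complex.I • (U - star U) with hB
  have hBs : IsSelfAdjoint B := by
    change star B = B
    rw [hB, star_smul, star_sub, star_star]
    simp only [star_neg, RCLike.star_def, Complex.conj_I]
    module
  have hUs := Unitary.mem_iff.1 hU
  have hBU : Commute B U := by
    refine Commute.smul_left (Commute.sub_left (Commute.refl U) ?_) _
    rw [commute_iff_eq, hUs.1, hUs.2]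
  have hBU' : Commute B (star U) := by
    refine Commute.smul_left (Commute.sub_left ?_ (Commute.refl _)) _
    rw [commute_iff_eq, hUs.1, hUs.2]
  set N : K →L[ℂ] K := B⁻ with hN
  have hNU : Commute N U := hBU.cfcₙ_real _
  have hNU' : Commute N (star U) := hBU'.cfcₙ_real _
  have hsub : B⁺ - N = B := CFC.posPart_sub_negPart B hBs
  have hNP : N * B⁺ = 0 := CFC.negPart_mul_posPart B
  have hPos : ∀ x, 0 ≤ (inner ℂ ((B⁺ : K →L[ℂ] K) x) x).re := fun x =>
    ((ContinuousLinearMap.nonneg_iff_isPositive _).1 (CFC.posPart_nonneg B)).re_inner_nonneg_left x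
  have hNeg : ∀ x, 0 ≤ (inner ℂ (N x) x).re := fun x =>
    ((ContinuousLinearMap.nonneg_iff_isPositive _).1 (CFC.negPart_nonneg B)).re_inner_nonneg_left x
  set p : K →L[ℂ] K := N.ker.starProjection with hp
  have hps : IsStarProjection p := isStarProjection_starProjection
  have hinv : ∀ V : K →L[ℂ] K, Commute N V → ∀ x ∈ N.ker, V x ∈ N.ker := fun V hV x hx => by
    have h1 := congrArg (fun T : K →L[ℂ] K => T x) hV.eq
    simp only [mul_apply_eq_comp] at h1
    rw [LinearMap.mem_ker] at hx ⊢
    change N (V x) = 0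
    rw [h1, show N x = 0 from hx, map_zero]
  have hpU : p * U = U * p := starProjection_commute (hinv U hNU) (hinv _ hNU')
  have hqU : (1 - p) * U = U * (1 - p) := by rw [sub_mul, mul_sub, hpU, one_mul, mul_one]
  have hpp := hps.isIdempotentElem.eq
  have him : ∀ x, (inner ℂ (U x) x).im = -(1 / 2) * (inner ℂ (B x) x).re := fun x => by
    rw [hB, re_inner_smul_sub_star]; ring
  have hBx : ∀ x, (inner ℂ (B x) x).re = (inner ℂ ((B⁺ : K →L[ℂ] K) x) x).re -
      (inner ℂ (N x) x).re := fun x => by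
    conv_lhs => rw [← hsub]
    rw [sub_apply, inner_sub_left, Complex.sub_re]
  have hblock : ∀ q : K →L[ℂ] K, IsStarProjection q → q * U = U * q → ∀ x,
      (inner ℂ ((U * q + (1 - q)) x) x).im = (inner ℂ (U (q x)) (q x)).im := fun q hq hqU x => by
    have h1 : U (q x) = q (U (q x)) := by
      have h2 := congrArg (fun T : K →L[ℂ] K => T (q x)) hqU
      simp only [mul_apply_eq_comp, starProj_idem hq] at h2
      exact h2.symm
    have h3 : inner ℂ (U (q x)) x = inner ℂ (U (q x)) (q x) := by
      conv_lhs => rw [h1]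
      rw [starProj_inner hq]
    have h4 : inner ℂ ((1 - q) x) x = inner ℂ ((1 - q) x) ((1 - q) x) := by
      rw [← starProj_inner hq.one_sub, starProj_idem hq.one_sub]
    rw [add_apply, inner_add_left, mul_apply_eq_comp, h3, h4, inner_self_eq_norm_sq_to_K,
      Complex.add_im]
    have e : (((‖(1 - q) x‖ : ℝ) : ℂ) ^ 2).im = 0 := by rw [← Complex.ofReal_pow, Complex.ofReal_im]
    change _ + (((‖(1 - q) x‖ : ℝ) : ℂ) ^ 2).im = _
    rw [e, add_zero]
  have hW1 := mem_unitary_block hU hps hpU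
  have hW2 := mem_unitary_block hU hps.one_sub hqU
  have j1 : Joined (1 : unitary (K →L[ℂ] K)) ⟨_, hW1⟩ := by
    refine joined_one_of_smul_mem_UStar hW1 (z := -Complex.I) (by simp)
      (smul_mem_UStar_of_im hW1 (by simp) fun x => ?_)
    have h0 : N (p x) = 0 := Submodule.starProjection_apply_mem N.ker x
    have h1 : (inner ℂ ((U * p + (1 - p)) x) x).im ≤ 0 := by
      rw [hblock p hps hpU, him, hBx, h0, inner_zero_left, Complex.zero_re]
      linarith [hPos (p x)]
    have h2 : ∀ z : ℂ, ((starRingEnd ℂ) (-Complex.I) * z).re = -z.im := fun z => by simp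
    rw [h2]
    linarith
  have j2 : Joined (1 : unitary (K →L[ℂ] K)) ⟨_, hW2⟩ := by
    refine joined_one_of_smul_mem_UStar hW2 (z := Complex.I) (by simp)
      (smul_mem_UStar_of_im hW2 (by simp) fun x => ?_)
    have h0 : inner ℂ ((B⁺ : K →L[ℂ] K) ((1 - p) x)) ((1 - p) x) = 0 := by
      have h2 : (B⁺ : K →L[ℂ] K) ((1 - p) x) ∈ N.ker :=
        congrArg (fun T : K →L[ℂ] K => T ((1 - p) x)) hNP
      have h3 : p ((B⁺ : K →L[ℂ] K) ((1 - p) x)) = (B⁺ : K →L[ℂ] K) ((1 - p) x) :=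
        Submodule.starProjection_eq_self_iff.2 h2
      have h4 : p ((1 - p) x) = 0 := by
        rw [sub_apply, one_apply_eq_self, map_sub, starProj_idem hps, sub_self]
      rw [← h3, starProj_inner hps, h4, inner_zero_right]
    have h1 : 0 ≤ (inner ℂ ((U * (1 - p) + (1 - (1 - p))) x) x).im := by
      rw [hblock _ hps.one_sub hqU, him, hBx, h0, Complex.zero_re]
      linarith [hNeg ((1 - p) x)]
    have h2 : ∀ z : ℂ, ((starRingEnd ℂ) Complex.I * z).re = z.im := fun z => by simp
    rw [h2]
    exact h1
  have e : (⟨U, hU⟩ : unitary (K →L[ℂ] K)) = ⟨_, hW1⟩ * ⟨_, hW2⟩ := by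
    refine Subtype.ext ?_
    change U = (U * p + (1 - p)) * (U * (1 - p) + (1 - (1 - p)))
    calc U = U * p + U * (1 - p) := by noncomm_ring
      _ = U * (U * (p * (1 - p))) + U * (p * p) + U * ((1 - p) * (1 - p)) + (p - p * p) := by
        rw [hps.one_sub.isIdempotentElem.eq, mul_sub p, hpp]; simp
      _ = U * (p * U) * (1 - p) + U * (p * p) + ((1 - p) * U) * (1 - p) + (p - p * p) := by
        rw [hqU, hpU]; noncomm_ring
      _ = _ := by noncomm_ring
  rw [e]
  have j3 : Joined ((1 : unitary (K →L[ℂ] K)) * ⟨_, hW2⟩) (⟨_, hW1⟩ * ⟨_, hW2⟩) := by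
    obtain ⟨P⟩ := j1
    exact ⟨P.map (continuous_mul_const _)⟩
  rw [one_mul] at j3
  exact j2.trans j3

end UnitaryConnected

/-! ### Fredholm pairs as a product, and the classification of their paths -/

section Pairs

variable {H : Type*} [NormedAddCommGroup H] [InnerProductSpace ℂ H] [CompleteSpace H]

variable {γ : H →L[ℂ] H}

theorem IsUnitaryMap.unitary_comp {U : Eminus γ →L[ℂ] Eminus γ} {V : Eplus γ →L[ℂ] Eminus γ}
    (hU : U ∈ unitary (Eminus γ →L[ℂ] Eminus γ)) (hV : IsUnitaryMap V) : IsUnitaryMap (U ∘L V) := by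
  obtain ⟨h1, h2⟩ := Unitary.mem_iff.1 hU
  rw [ContinuousLinearMap.star_eq_adjoint] at h1 h2
  constructor
  · rw [ContinuousLinearMap.adjoint_comp, ContinuousLinearMap.comp_assoc,
      ← ContinuousLinearMap.comp_assoc _ U V, ← ContinuousLinearMap.mul_def, h1]
    exact hV.1
  · rw [ContinuousLinearMap.adjoint_comp, ContinuousLinearMap.comp_assoc,
      ← ContinuousLinearMap.comp_assoc V, hV.2, ContinuousLinearMap.one_def,
      ContinuousLinearMap.id_comp, ← ContinuousLinearMap.mul_def, h2, ContinuousLinearMap.one_def]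

theorem comp_adjoint_mem_unitary {V W : Eplus γ →L[ℂ] Eminus γ} (hV : IsUnitaryMap V)
    (hW : IsUnitaryMap W) :
    V ∘L ContinuousLinearMap.adjoint W ∈ unitary (Eminus γ →L[ℂ] Eminus γ) := by
  rw [Unitary.mem_iff]
  simp only [ContinuousLinearMap.star_eq_adjoint, ContinuousLinearMap.adjoint_comp,
    ContinuousLinearMap.adjoint_adjoint, ContinuousLinearMap.mul_def]
  constructor
  · rw [ContinuousLinearMap.comp_assoc, ← ContinuousLinearMap.comp_assoc _ V, hV.1,
      ContinuousLinearMap.one_def, ContinuousLinearMap.id_comp, hW.2, ContinuousLinearMap.one_def]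
  · rw [ContinuousLinearMap.comp_assoc, ← ContinuousLinearMap.comp_assoc _ W, hW.1,
      ContinuousLinearMap.one_def, ContinuousLinearMap.id_comp, hV.2, ContinuousLinearMap.one_def]

theorem isUnitaryMap_of_isometryEquiv (J : Eplus γ ≃ₗᵢ[ℂ] Eminus γ) :
    IsUnitaryMap (J.toContinuousLinearEquiv : Eplus γ →L[ℂ] Eminus γ) := by
  have h : ContinuousLinearMap.adjoint (J.toContinuousLinearEquiv : Eplus γ →L[ℂ] Eminus γ) =
      (J.symm.toContinuousLinearEquiv : Eminus γ →L[ℂ] Eplus γ) :=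
    LinearIsometryEquiv.adjoint_eq_symm J
  constructor <;> rw [h] <;> ext x <;> simp

variable (γ) in
/-- The space of unitary maps from `E_i` to `E_{-i}`. -/
abbrev UnitaryMap := {V : Eplus γ →L[ℂ] Eminus γ // IsUnitaryMap V}

/-- The pair of Lagrangian projections with `Φ(P) = U V` and `Φ(Q) = V`. -/
def lagPair (hγ : IsHermitianSymplectic γ) (x : UFred (Eminus γ) × UnitaryMap γ) : GrFred γ :=
  ⟨(lag γ ((x.1 : Eminus γ →L[ℂ] Eminus γ) ∘L x.2.1), lag γ x.2.1), by
    have h1 := x.2.2.unitary_comp x.1.2.1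
    refine mem_GrFred_of_mem_UFred hγ (lag_mem_Gr hγ h1) (lag_mem_Gr hγ x.2.2) ?_
    rw [PhiPair, Phi_lag hγ h1, Phi_lag hγ x.2.2, ContinuousLinearMap.comp_assoc, x.2.2.2]
    exact x.1.2⟩

theorem continuous_lagPair (hγ : IsHermitianSymplectic γ) : Continuous (lagPair hγ) := by
  refine Continuous.subtype_mk (Continuous.prodMk (continuous_lag.comp ?_) (continuous_lag.comp ?_)) _
  · exact (continuous_subtype_val.comp continuous_fst).clm_comp
      (continuous_subtype_val.comp continuous_snd)
  · exact continuous_subtype_val.comp continuous_snd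

theorem toUFred_lagPair (hγ : IsHermitianSymplectic γ) (x : UFred (Eminus γ) × UnitaryMap γ) :
    toUFred hγ (lagPair hγ x) = x.1 := by
  refine Subtype.ext ?_
  change PhiPair γ (lag γ _, lag γ _) = _
  rw [PhiPair, Phi_lag hγ (x.2.2.unitary_comp x.1.2.1), Phi_lag hγ x.2.2,
    ContinuousLinearMap.comp_assoc, x.2.2.2]
  rfl

theorem toUFred_mem_starSet_iff (hγ : IsHermitianSymplectic γ) (p : GrFred γ) :
    toUFred hγ p ∈ starSet (Eminus γ) ↔ p.1 ∈ GrStar γ :=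
  (mem_GrStar_iff hγ p.2.1 p.2.2.1).symm

theorem lagPair_mem_GrStar (hγ : IsHermitianSymplectic γ) {x : UFred (Eminus γ) × UnitaryMap γ}
    (h : x.1 ∈ starSet (Eminus γ)) : (lagPair hγ x).1 ∈ GrStar γ := by
  rwa [← toUFred_mem_starSet_iff hγ, toUFred_lagPair]

/-- The unitary map `Φ(Q)` of a pair `(P, Q)`. -/
def sndMap (hγ : IsHermitianSymplectic γ) (p : GrFred γ) : UnitaryMap γ :=
  ⟨Phi γ p.1.2, isUnitaryMap_Phi hγ p.2.2.1⟩

theorem continuous_sndMap (hγ : IsHermitianSymplectic γ) : Continuous (sndMap hγ) := by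
  have h : Continuous (Phi γ) := by
    unfold Phi; fun_prop
  exact (h.comp (continuous_snd.comp continuous_subtype_val)).subtype_mk _

theorem lagPair_toUFred (hγ : IsHermitianSymplectic γ) (p : GrFred γ) :
    lagPair hγ (toUFred hγ p, sndMap hγ p) = p := by
  have h1 : PhiPair γ p.1 ∘L Phi γ p.1.2 = Phi γ p.1.1 := by
    rw [PhiPair, ContinuousLinearMap.comp_assoc, (isUnitaryMap_Phi hγ p.2.2.1).1]
    rfl
  refine Subtype.ext (Prod.ext ?_ ?_)
  · change lag γ (PhiPair γ p.1 ∘L Phi γ p.1.2) = _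
    rw [h1, lag_Phi hγ p.2.1]
  · exact lag_Phi hγ p.2.2.1

/-- The condition on the endpoints of a homotopy. -/
abbrev StarEnds (γ : H →L[ℂ] H) (f : C(I, GrFred γ)) : Prop :=
  (f 0).1 ∈ GrStar γ ∧ (f 1).1 ∈ GrStar γ

theorem homotopicWith_lagPair (hγ : IsHermitianSymplectic γ) {u : C(I, UFred (Eminus γ))}
    (h0 : u 0 ∈ starSet (Eminus γ)) (h1 : u 1 ∈ starSet (Eminus γ))
    {V : I × I → UnitaryMap γ} (hV : Continuous V) {f g : C(I, GrFred γ)}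
    (hf : ∀ t, lagPair hγ (u t, V (0, t)) = f t) (hg : ∀ t, lagPair hγ (u t, V (1, t)) = g t) :
    ContinuousMap.HomotopicWith f g (StarEnds γ) := by
  refine homotopicWith_of_map (fun x => lagPair hγ (u x.2, V x))
    ((continuous_lagPair hγ).comp ((u.continuous.comp continuous_snd).prodMk hV)) hf hg
    fun k s hk => ⟨?_, ?_⟩
  · rw [hk]; exact lagPair_mem_GrStar hγ h0
  · rw [hk]; exact lagPair_mem_GrStar hγ h1

/-- The path of pairs `(P, Q)` with fixed `Φ(Q) = J` and with `Φ(P) Φ(Q)*` a given path. -/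
def lagPath (hγ : IsHermitianSymplectic γ) (J : UnitaryMap γ) {a b : UFred (Eminus γ)}
    (u : Path a b) : Path (lagPair hγ (a, J)) (lagPair hγ (b, J)) :=
  u.map (f := fun u => lagPair hγ (u, J))
    ((continuous_lagPair hγ).comp (continuous_id.prodMk continuous_const))

theorem phiPath_lagPath (hγ : IsHermitianSymplectic γ) (J : UnitaryMap γ) {a b : UFred (Eminus γ)}
    (u : Path a b) (t : I) : phiPath hγ (lagPath hγ J u) t = u t :=
  toUFred_lagPair hγ _

/-- Fredholmness and invertibility depend only on Φ(P)Φ(Q)*, so Φ(Q) may be deformed freely: first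
contract the path Φ(g) to its initial value, then move that constant to J by connectedness of the
unitary group. -/
theorem homotopicWith_lagPath (hγ : IsHermitianSymplectic γ) (J : UnitaryMap γ) {a b : GrFred γ}
    (p : Path a b) (ha : a.1 ∈ GrStar γ) (hb : b.1 ∈ GrStar γ) :
    ContinuousMap.HomotopicWith p.toContinuousMap (lagPath hγ J (phiPath hγ p)).toContinuousMap
      (StarEnds γ) := by
  let u : C(I, UFred (Eminus γ)) := (phiPath hγ p).toContinuousMap
  have h0 : u 0 ∈ starSet (Eminus γ) := by
    change toUFred hγ (p 0) ∈ _
    rw [p.source]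
    exact (toUFred_mem_starSet_iff hγ a).2 ha
  have h1 : u 1 ∈ starSet (Eminus γ) := by
    change toUFred hγ (p 1) ∈ _
    rw [p.target]
    exact (toUFred_mem_starSet_iff hγ b).2 hb
  set V₀ : UnitaryMap γ := sndMap hγ (p 0) with hV₀
  have hmem := comp_adjoint_mem_unitary J.2 V₀.2
  obtain ⟨X⟩ := joined_one_unitary (⟨_, hmem⟩ : unitary (Eminus γ →L[ℂ] Eminus γ))
  have hc : Continuous fun s : I => (⟨(X s : Eminus γ →L[ℂ] Eminus γ) ∘L V₀.1,
      V₀.2.unitary_comp (X s).2⟩ : UnitaryMap γ) :=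
    Continuous.subtype_mk ((continuous_subtype_val.comp X.continuous).clm_comp continuous_const) _
  let m : C(I, GrFred γ) := ⟨fun t => lagPair hγ (u t, V₀),
    (continuous_lagPair hγ).comp (u.continuous.prodMk continuous_const)⟩
  have e1 : ContinuousMap.HomotopicWith p.toContinuousMap m (StarEnds γ) := by
    refine homotopicWith_lagPair hγ h0 h1 (V := fun x => sndMap hγ (p (σ x.1 * x.2)))
      ((continuous_sndMap hγ).comp (p.continuous.comp (by fun_prop))) (fun t => ?_) fun t => ?_
    · rw [unitInterval.symm_zero, one_mul]
      exact lagPair_toUFred hγ (p t)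
    · rw [unitInterval.symm_one, zero_mul]
      rfl
  have e2 : ContinuousMap.HomotopicWith m (lagPath hγ J (phiPath hγ p)).toContinuousMap
      (StarEnds γ) := by
    refine homotopicWith_lagPair hγ h0 h1 (hc.comp continuous_fst) (fun t => ?_) fun t => ?_
    · change lagPair hγ (u t, _) = lagPair hγ (u t, V₀)
      refine congrArg (fun v => lagPair hγ (u t, v)) (Subtype.ext ?_)
      change ((X 0 : Eminus γ →L[ℂ] Eminus γ)) ∘L V₀.1 = V₀.1
      rw [X.source]
      rfl
    · change lagPair hγ (u t, _) = lagPair hγ (u t, J)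
      refine congrArg (fun v => lagPair hγ (u t, v)) (Subtype.ext ?_)
      change ((X 1 : Eminus γ →L[ℂ] Eminus γ)) ∘L V₀.1 = J.1
      rw [X.target, ContinuousLinearMap.comp_assoc, V₀.2.1]
      rfl
  exact e1.trans e2

theorem exists_unitaryMap (hγ : IsHermitianSymplectic γ) : Nonempty (UnitaryMap γ) := by
  obtain ⟨J⟩ := hγ.dim_eq
  exact ⟨⟨_, isUnitaryMap_of_isometryEquiv J⟩⟩

theorem starEnds_map (hγ : IsHermitianSymplectic γ) {f g : C(I, GrFred γ)}
    (h : ContinuousMap.HomotopicWith f g (StarEnds γ)) :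
    ContinuousMap.HomotopicWith ((⟨toUFred hγ, continuous_toUFred hγ⟩ : C(_, _)).comp f)
      ((⟨toUFred hγ, continuous_toUFred hγ⟩ : C(_, _)).comp g)
      (fun f => f 0 ∈ starSet (Eminus γ) ∧ f 1 ∈ starSet (Eminus γ)) := by
  obtain ⟨F⟩ := h
  refine homotopicWith_of_map (fun x => toUFred hγ (F x))
    ((continuous_toUFred hγ).comp F.continuous) (fun t => congrArg _ (F.apply_zero t))
    (fun t => congrArg _ (F.apply_one t)) fun k s hk => ⟨?_, ?_⟩
  · rw [hk, toUFred_mem_starSet_iff]; exact (F.prop s).1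
  · rw [hk, toUFred_mem_starSet_iff]; exact (F.prop s).2

theorem lagPath_homotopicWith (hγ : IsHermitianSymplectic γ) (J : UnitaryMap γ)
    {a b a' b' : UFred (Eminus γ)} {u : Path a b} {v : Path a' b'}
    (h : ContinuousMap.HomotopicWith u.toContinuousMap v.toContinuousMap
      (fun f => f 0 ∈ starSet (Eminus γ) ∧ f 1 ∈ starSet (Eminus γ))) :
    ContinuousMap.HomotopicWith (lagPath hγ J u).toContinuousMap (lagPath hγ J v).toContinuousMap
      (StarEnds γ) := by
  obtain ⟨F⟩ := h
  refine homotopicWith_of_map (fun x => lagPair hγ (F x, J))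
    ((continuous_lagPair hγ).comp (F.continuous.prodMk continuous_const))
    (fun t => congrArg (fun u => lagPair hγ (u, J)) (F.apply_zero t))
    (fun t => congrArg (fun u => lagPair hγ (u, J)) (F.apply_one t)) fun k s hk => ⟨?_, ?_⟩
  · rw [hk]; exact lagPair_mem_GrStar hγ (F.prop s).1
  · rw [hk]; exact lagPair_mem_GrStar hγ (F.prop s).2

/-- Paths of Fredholm pairs with invertible endpoints are classified by the index of
`Φ(f) Φ(g)*`. -/
theorem index_eq_iff_homotopicWith (hγ : IsHermitianSymplectic γ) {a b c d : GrFred γ}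
    (p : Path a b) (q : Path c d) (ha : a.1 ∈ GrStar γ) (hb : b.1 ∈ GrStar γ)
    (hc : c.1 ∈ GrStar γ) (hd : d.1 ∈ GrStar γ) {m n : ℤ}
    (hm : HasIndex (phiPath hγ p) ((toUFred_mem_starSet_iff hγ a).2 ha)
      ((toUFred_mem_starSet_iff hγ b).2 hb) m)
    (hn : HasIndex (phiPath hγ q) ((toUFred_mem_starSet_iff hγ c).2 hc)
      ((toUFred_mem_starSet_iff hγ d).2 hd) n) :
    m = n ↔ ContinuousMap.HomotopicWith p.toContinuousMap q.toContinuousMap (StarEnds γ) := by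
  obtain ⟨J⟩ := exists_unitaryMap hγ
  rw [hm.eq_iff hn]
  constructor
  · intro h
    exact (homotopicWith_lagPath hγ J p ha hb).trans
      ((lagPath_homotopicWith hγ J h).trans (homotopicWith_lagPath hγ J q hc hd).symm)
  · exact fun h => starEnds_map hγ h

theorem HasIndex.congr_apply {K : Type*} [NormedAddCommGroup K] [InnerProductSpace ℂ K]
    [CompleteSpace K] {a b a' b' : UFred K} {p : Path a b} {q : Path a' b'} {ha : a ∈ starSet K}
    {hb : b ∈ starSet K} {n : ℤ} (h : HasIndex p ha hb n) (e : ∀ t, p t = q t)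
    (ha' : a' ∈ starSet K) (hb' : b' ∈ starSet K) : HasIndex q ha' hb' n := by
  obtain rfl : a = a' := by rw [← p.source, ← q.source, e]
  obtain rfl : b = b' := by rw [← p.target, ← q.target, e]
  obtain rfl : p = q := Path.ext (funext e)
  exact h

theorem nontrivial_Eminus [Nontrivial H] (hγ : IsHermitianSymplectic γ) : Nontrivial (Eminus γ) := by
  by_contra h
  rw [not_nontrivial_iff_subsingleton] at h
  obtain ⟨J⟩ := hγ.dim_eq
  have h2 : Subsingleton (Eplus γ) := J.injective.subsingleton
  refine not_subsingleton H ⟨fun x y => ?_⟩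
  have h3 : ∀ x : H, x = 0 := fun x => by
    obtain ⟨y, z, rfl⟩ := exists_add_plus_minus hγ x
    rw [Subsingleton.elim y 0, Subsingleton.elim z 0]
    simp
  rw [h3 x, h3 y]

end Pairs

/-! ### The negative winding number as the only Maslov index -/

section MaslovIndex

variable {H : Type*} [NormedAddCommGroup H] [InnerProductSpace ℂ H] [CompleteSpace H]

variable {γ : H →L[ℂ] H}

/-- Minus the winding number of `Φ(f) Φ(g)*`. -/
def negWinding (hγ : IsHermitianSymplectic γ) ⦃a b : GrFred γ⦄ (p : Path a b) : ℤ :=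
  -(existsUnique_hasWinding (phiPath hγ p)).choose

theorem hasWinding_negWinding (hγ : IsHermitianSymplectic γ) {a b : GrFred γ} (p : Path a b) :
    HasWinding (phiPath hγ p) (-negWinding hγ p) := by
  rw [negWinding, neg_neg]
  exact (existsUnique_hasWinding (phiPath hγ p)).choose_spec.1

theorem hasIndex_negWinding (hγ : IsHermitianSymplectic γ) {a b : GrFred γ} (p : Path a b)
    (ha : a.1 ∈ GrStar γ) (hb : b.1 ∈ GrStar γ) :
    HasIndex (phiPath hγ p) ((toUFred_mem_starSet_iff hγ a).2 ha)
      ((toUFred_mem_starSet_iff hγ b).2 hb) (-negWinding hγ p) :=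
  (hasWinding_negWinding hγ p).hasIndex_self _ _

theorem negWinding_eq (hγ : IsHermitianSymplectic γ) {a b : GrFred γ} (p : Path a b)
    {ha : toUFred hγ a ∈ starSet (Eminus γ)} {hb : toUFred hγ b ∈ starSet (Eminus γ)} {n : ℤ}
    (h : HasIndex (phiPath hγ p) ha hb n) : negWinding hγ p = -n := by
  have h1 := (hasWinding_negWinding hγ p).hasIndex_self ha hb
  rw [← (existsUnique_hasIndex (phiPath hγ p) ha hb).unique h1 h, neg_neg]

theorem phiPath_trans (hγ : IsHermitianSymplectic γ) {a b c : GrFred γ} (p : Path a b)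
    (q : Path b c) : phiPath hγ (p.trans q) = (phiPath hγ p).trans (phiPath hγ q) :=
  Path.map_trans p q _

/-- The pair `(P, Q)` with `Φ(Q) = J` and `Φ(P) Φ(Q)* = 1`. -/
def basePair (hγ : IsHermitianSymplectic γ) (J : UnitaryMap γ) : GrFred γ :=
  lagPair hγ (oneUFred (Eminus γ), J)

theorem basePair_mem (hγ : IsHermitianSymplectic γ) (J : UnitaryMap γ) :
    (basePair hγ J).1 ∈ GrStar γ :=
  lagPair_mem_GrStar hγ (show oneUFred (Eminus γ) ∈ starSet (Eminus γ) from one_mem_UStar)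

/-- The standard loops of Fredholm pairs. -/
def baseLoop (hγ : IsHermitianSymplectic γ) (J : UnitaryMap γ) (n : ℤ) :
    Path (basePair hγ J) (basePair hγ J) :=
  lagPath hγ J (stdLoop (Eminus γ) n)

theorem negWinding_baseLoop [Nontrivial H] (hγ : IsHermitianSymplectic γ) (J : UnitaryMap γ)
    (n : ℤ) : negWinding hγ (baseLoop hγ J n) = -n := by
  have := nontrivial_Eminus hγ
  have h1 : oneUFred (Eminus γ) ∈ starSet (Eminus γ) := one_mem_UStar
  have h2 := HasIndex.of_loopWinding h1 (hasLoopWinding_stdLoop (K := Eminus γ) n)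
  have h3 := (toUFred_mem_starSet_iff hγ _).2 (basePair_mem hγ J)
  exact negWinding_eq hγ _ (h2.congr_apply (fun t => (phiPath_lagPath hγ J _ t).symm) h3 h3)

theorem PhiPair_rotate_exp (hγ : IsHermitianSymplectic γ) (x : GrFred γ) (s φ : ℝ)
    (h : φ = -2 * s) : PhiPair γ (rotate γ s x.1) =
      Complex.exp (φ * Complex.I) • PhiPair γ x.1 := by
  rw [PhiPair_rotate hγ x.2.1, h]

theorem rotate_mem_GrStar_iff (hγ : IsHermitianSymplectic γ) (x : GrFred γ) (s φ : ℝ)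
    (h : φ = -2 * s) : rotate γ s x.1 ∈ GrStar γ ↔
      Complex.exp (φ * Complex.I) • PhiPair γ x.1 ∈ UStar (Eminus γ) := by
  rw [← PhiPair_rotate_exp hγ x s φ h]
  exact mem_GrStar_iff hγ (rotate_fst_mem hγ x.2.1 s) x.2.2.1

theorem rotate_mem_GrFred_iff (hγ : IsHermitianSymplectic γ) (x : GrFred γ) (s φ : ℝ)
    (h : φ = -2 * s) : rotate γ s x.1 ∈ GrFred γ ↔
      Complex.exp (φ * Complex.I) • PhiPair γ x.1 ∈ UFred (Eminus γ) := by
  rw [← PhiPair_rotate_exp hγ x s φ h]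
  exact ⟨PhiPair_mem_UFred hγ, mem_GrFred_of_mem_UFred hγ (rotate_fst_mem hγ x.2.1 s) x.2.2.1⟩

/-- The angle is φ = −2s, so s from −ε to ε means φ from 2ε down to −2ε. This is the crossing path
with α = 2ε, whose index is minus the multiplicity. -/
theorem negWinding_rotate (hγ : IsHermitianSymplectic γ) (x : GrFred γ) (ε : ℝ) (hε : 0 < ε)
    (h : ∀ s : ℝ, s ≠ 0 → |s| ≤ ε → rotate γ s x.1 ∈ GrStar γ) {a b : GrFred γ} (p : Path a b)
    (hp : ∀ t : I, (p t).1 = rotate γ (ε * (2 * (t : ℝ) - 1)) x.1) :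
    negWinding hγ p = Module.finrank ℂ ↥(x.1.1.ker ⊓ x.1.2.range) := by
  have ha : a.1 ∈ GrStar γ := by
    rw [← p.source, hp]
    refine h _ (by simp [hε.ne']) ?_
    rw [Set.Icc.coe_zero, mul_zero, zero_sub, mul_neg_one, abs_neg, abs_of_pos hε]
  have hb : b.1 ∈ GrStar γ := by
    rw [← p.target, hp]
    have e : ε * (2 * ((1 : I) : ℝ) - 1) = ε := by rw [Set.Icc.coe_one]; ring
    rw [e]
    exact h _ hε.ne' (by rw [abs_of_pos hε])
  have h1 : HasIndex (phiPath hγ p) ((toUFred_mem_starSet_iff hγ a).2 ha)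
      ((toUFred_mem_starSet_iff hγ b).2 hb)
      (-Module.finrank ℂ (PhiPair γ x.1 + 1).ker) := by
    refine hasIndex_crossing (PhiPair_mem_UFred hγ x.2) (α := 2 * ε) (by positivity)
      (fun φ h0 hφ => ?_) (fun t => ?_) _ _
    · refine (rotate_mem_GrStar_iff hγ x (-φ / 2) φ (by ring)).1 (h _ ?_ ?_)
      · exact div_ne_zero (neg_ne_zero.2 h0) two_ne_zero
      · rw [abs_div, abs_neg, abs_two]; linarith
    · change PhiPair γ (p t).1 = _
      rw [hp]
      exact PhiPair_rotate_exp hγ x _ _ (by ring)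
  rw [negWinding_eq hγ p h1, neg_neg, finrank_ker_inf_range hγ x.2.1 x.2.2.1]

/-- Rotation by e^{εγ} is multiplication by e^{−2iε}, the same direction as in the definition of the
winding number of an arbitrary path. -/
theorem negWinding_endpoints (hγ : IsHermitianSymplectic γ) {a b : GrFred γ} (p : Path a b) (ε : ℝ)
    (hε : 0 < ε) (h1 : ∀ s ∈ Set.Icc 0 ε, ∀ t : I, rotate γ s (p t).1 ∈ GrFred γ)
    (h2 : ∀ s ∈ Set.Ioc 0 ε, rotate γ s a.1 ∈ GrStar γ ∧ rotate γ s b.1 ∈ GrStar γ)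
    {a' b' : GrFred γ} (q : Path a' b') (hq : ∀ t : I, (q t).1 = rotate γ ε (p t).1) :
    negWinding hγ p = negWinding hγ q := by
  have ha : a'.1 ∈ GrStar γ := by
    rw [← q.source, hq, p.source]; exact (h2 ε ⟨hε, le_rfl⟩).1
  have hb : b'.1 ∈ GrStar γ := by
    rw [← q.target, hq, p.target]; exact (h2 ε ⟨hε, le_rfl⟩).2
  have h3 : HasIndex (phiPath hγ q) ((toUFred_mem_starSet_iff hγ a').2 ha)
      ((toUFred_mem_starSet_iff hγ b').2 hb) (-negWinding hγ p) := by
    refine (hasWinding_negWinding hγ p).hasIndex (φ₀ := -2 * ε) (fun φ hφ t => ?_)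
      (fun φ hφ h0 => ?_) (by linarith) _ _ fun t => ?_
    · refine (rotate_mem_GrFred_iff hγ (p t) (-φ / 2) φ (by ring)).1 (h1 _ ?_ t)
      constructor <;> linarith [hφ.1, hφ.2]
    · have h4 : -φ / 2 ∈ Set.Ioc 0 ε := by
        have h5 : φ < 0 := by
          rcases h0 with rfl | h0
          · linarith
          · exact lt_of_le_of_ne hφ.2 h0
        constructor <;> linarith [hφ.1]
      exact ⟨(rotate_mem_GrStar_iff hγ a _ φ (by ring)).1 (h2 _ h4).1,
        (rotate_mem_GrStar_iff hγ b _ φ (by ring)).1 (h2 _ h4).2⟩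
    · change PhiPair γ (q t).1 = _
      rw [hq]
      exact PhiPair_rotate_exp hγ (p t) _ _ rfl
  rw [negWinding_eq hγ q h3, neg_neg]

theorem isMaslovIndex_negWinding (hγ : IsHermitianSymplectic γ) :
    IsMaslovIndex γ (negWinding hγ) where
  eq_iff_homotopic a b c d p q ha hb hc hd := by
    rw [← index_eq_iff_homotopicWith hγ p q ha hb hc hd (hasIndex_negWinding hγ p ha hb)
      (hasIndex_negWinding hγ q hc hd), neg_inj]
  map_trans a b c p q ha hb hc := by
    have h := (hasIndex_negWinding hγ p ha hb).trans (hasIndex_negWinding hγ q hb hc)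
    rw [← phiPath_trans] at h
    rw [negWinding_eq hγ _ h]; ring
  surjective hH n := by
    obtain ⟨J⟩ := exists_unitaryMap hγ
    exact ⟨_, _, baseLoop hγ J (-n), basePair_mem hγ J, basePair_mem hγ J, by
      rw [negWinding_baseLoop, neg_neg]⟩
  normalization x ε hε h a b p hp := negWinding_rotate hγ x ε hε h p hp
  endpoints a b p ε hε h1 h2 a' b' q hq := negWinding_endpoints hγ p ε hε h1 h2 q hq

/-! ### Uniqueness -/

theorem continuous_rotate {Y : Type*} [TopologicalSpace Y] {s : Y → ℝ} (hs : Continuous s)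
    {p : Y → (H →L[ℂ] H) × (H →L[ℂ] H)} (hp : Continuous p) :
    Continuous fun y => rotate γ (s y) (p y) := by
  let _ : NormedAlgebra ℚ (H →L[ℂ] H) := NormedAlgebra.restrictScalars ℚ ℂ _
  have h1 : Continuous fun y => NormedSpace.exp ((s y : ℂ) • γ) :=
    (NormedSpace.exp_continuous (𝔸 := H →L[ℂ] H)).comp (by fun_prop)
  have h2 : Continuous fun y => NormedSpace.exp (-((s y : ℂ) • γ)) :=
    (NormedSpace.exp_continuous (𝔸 := H →L[ℂ] H)).comp (by fun_prop)
  unfold rotate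
  fun_prop

/-- The path `(e^{sγ} f e^{-sγ}, g)`, where `s` depends on the time. -/
def rotatePath (γ : H →L[ℂ] H) {a b : GrFred γ} (p : Path a b) (s : I → ℝ) (hs : Continuous s)
    (h : ∀ t : I, rotate γ (s t) (p t).1 ∈ GrFred γ) :
    Path (⟨_, h 0⟩ : GrFred γ) ⟨_, h 1⟩ where
  toFun t := ⟨_, h t⟩
  continuous_toFun := Continuous.subtype_mk
    (continuous_rotate hs (continuous_subtype_val.comp p.continuous)) _
  source' := rfl
  target' := rfl

/-- There is a path as in the normalization of the Maslov index. -/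
theorem exists_crossing_path (hγ : IsHermitianSymplectic γ) (x : GrFred γ) :
    ∃ (ε : ℝ) (a b : GrFred γ) (p : Path a b), 0 < ε ∧ a.1 ∈ GrStar γ ∧ b.1 ∈ GrStar γ ∧
      (∀ s : ℝ, s ≠ 0 → |s| ≤ ε → rotate γ s x.1 ∈ GrStar γ) ∧
      ∀ t : I, (p t).1 = rotate γ (ε * (2 * (t : ℝ) - 1)) x.1 := by
  obtain ⟨α, hα⟩ := exists_isSmallAngle (phiPath hγ (Path.refl x))
  have hα0 := hα.pos
  have hs : ∀ s : ℝ, |s| ≤ α / 2 → -2 * s ∈ Set.Icc (-α) α := fun s h => by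
    rw [abs_le] at h
    constructor <;> linarith [h.1, h.2]
  have hle : ∀ t : I, |α / 2 * (2 * (t : ℝ) - 1)| ≤ α / 2 := fun t => by
    rw [abs_mul, abs_of_pos (half_pos hα0)]
    have : |2 * (t : ℝ) - 1| ≤ 1 := by
      rw [abs_le]; constructor <;> linarith [t.2.1, t.2.2]
    nlinarith
  have h1 : ∀ s : ℝ, s ≠ 0 → |s| ≤ α / 2 → rotate γ s x.1 ∈ GrStar γ := fun s h0 h =>
    (rotate_mem_GrStar_iff hγ x s _ rfl).2 (hα.ends _ (hs s h) (by simpa using h0)).1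
  have h2 : ∀ t : I, rotate γ (α / 2 * (2 * (t : ℝ) - 1)) (Path.refl x t).1 ∈ GrFred γ := fun t =>
    (rotate_mem_GrFred_iff hγ x _ _ rfl).2 (hα.mem _ (hs _ (hle t)) t)
  refine ⟨α / 2, _, _, rotatePath γ (Path.refl x) (fun t => α / 2 * (2 * (t : ℝ) - 1))
    (by fun_prop) h2, half_pos hα0, h1 _ ?_ (hle 0), h1 _ ?_ (hle 1), h1, fun t => rfl⟩
  · simp [hα0.ne']
  · rw [Set.Icc.coe_one]; norm_num; exact hα0.ne'

/-- Take Φ(P)Φ(Q)* = 1 − 2p with p of rank one. This crossing of multiplicity one calibrates a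
Maslov index. -/
theorem exists_finrank_eq_one [Nontrivial H] (hγ : IsHermitianSymplectic γ) :
    ∃ x : GrFred γ, Module.finrank ℂ ↥(x.1.1.ker ⊓ x.1.2.range) = 1 := by
  obtain ⟨J⟩ := exists_unitaryMap hγ
  have := nontrivial_Eminus hγ
  let U : UFred (Eminus γ) := ⟨1 + ((-1 : ℂ) - 1) • stdProj (Eminus γ),
    one_add_smul_mem_UFred isStarProjection_stdProj hasFiniteRange_stdProj (by simp)⟩
  refine ⟨lagPair hγ (U, J), ?_⟩
  rw [finrank_ker_inf_range hγ (lagPair hγ (U, J)).2.1 (lagPair hγ (U, J)).2.2.1]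
  have h1 : PhiPair γ ((lagPair hγ (U, J)).1.1, (lagPair hγ (U, J)).1.2) =
      1 + ((-1 : ℂ) - 1) • stdProj (Eminus γ) :=
    congrArg Subtype.val (toUFred_lagPair hγ (U, J))
  have h2 : (1 + ((-1 : ℂ) - 1) • stdProj (Eminus γ) + 1).ker = (stdProj (Eminus γ)).range := by
    ext y
    rw [mem_ker_add_one, add_apply, one_apply_eq_self, smul_apply]
    constructor
    · intro h
      refine ⟨y, ?_⟩
      have h3 : (2 : ℂ) • (stdProj (Eminus γ) y - y) = 0 := by
        rw [smul_sub, sub_eq_zero]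
        have h4 : y + ((-1 : ℂ) - 1) • stdProj (Eminus γ) y + y = 0 := by rw [h]; simp
        rw [← sub_eq_zero]
        rw [← neg_eq_zero, ← h4]
        module
      exact sub_eq_zero.1 ((smul_eq_zero.1 h3).resolve_left two_ne_zero)
    · rintro ⟨z, rfl⟩
      change stdProj (Eminus γ) z + ((-1 : ℂ) - 1) • stdProj (Eminus γ) (stdProj (Eminus γ) z) = _
      rw [starProj_idem isStarProjection_stdProj]
      change _ = -(stdProj (Eminus γ) z)
      module
  rw [h1, h2, finrank_stdProj]

variable {M : ∀ ⦃a b : GrFred γ⦄, Path a b → ℤ}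

/-- The values of a Maslov index on the standard loops. -/
theorem IsMaslovIndex.baseLoop_add [Nontrivial H] (hM : IsMaslovIndex γ M)
    (hγ : IsHermitianSymplectic γ) (J : UnitaryMap γ) (m n : ℤ) :
    M (baseLoop hγ J (m + n)) = M (baseLoop hγ J m) + M (baseLoop hγ J n) := by
  have h0 := basePair_mem hγ J
  have h1 := isMaslovIndex_negWinding hγ
  rw [← hM.map_trans _ _ h0 h0 h0, hM.eq_iff_homotopic _ _ h0 h0 h0 h0,
    ← h1.eq_iff_homotopic _ _ h0 h0 h0 h0, h1.map_trans _ _ h0 h0 h0]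
  simp only [negWinding_baseLoop]
  ring

/-- Every such path is homotopic to a standard loop, on which M is a homomorphism ℤ → ℤ; the
normalization at a crossing of multiplicity one forces M to be −1 on the first loop. If H = 0, the
only path p satisfies p · p = p, so additivity gives index 0. -/
theorem IsMaslovIndex.eq_of_mem_GrStar (hM : IsMaslovIndex γ M) (hγ : IsHermitianSymplectic γ)
    {a b : GrFred γ} (p : Path a b) (ha : a.1 ∈ GrStar γ) (hb : b.1 ∈ GrStar γ) :
    M p = negWinding hγ p := by
  have h1 := isMaslovIndex_negWinding hγ
  cases subsingleton_or_nontrivial H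
  · have hx : ∀ x y : GrFred γ, x = y := fun x y =>
      Subtype.ext (Prod.ext (ContinuousLinearMap.ext fun _ => Subsingleton.elim _ _)
        (ContinuousLinearMap.ext fun _ => Subsingleton.elim _ _))
    obtain rfl := hx a b
    have key : ∀ {M : ∀ ⦃a b : GrFred γ⦄, Path a b → ℤ}, IsMaslovIndex γ M → M p = 0 := fun hM => by
      have h2 := hM.map_trans p p ha ha ha
      have h3 : p.trans p = p := Path.ext (funext fun t => hx _ _)
      rw [h3] at h2
      omega
    rw [key hM, key h1]
  · obtain ⟨J⟩ := exists_unitaryMap hγ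
    have h0 := basePair_mem hγ J
    have hp : ∀ {a b : GrFred γ} (p : Path a b), a.1 ∈ GrStar γ → b.1 ∈ GrStar γ →
        M p = M (baseLoop hγ J (-negWinding hγ p)) := fun p ha hb => by
      rw [hM.eq_iff_homotopic _ _ ha hb h0 h0, ← h1.eq_iff_homotopic _ _ ha hb h0 h0,
        negWinding_baseLoop, neg_neg]
    let φ : ℤ →+ ℤ := AddMonoidHom.mk' (fun n => M (baseLoop hγ J n)) (hM.baseLoop_add hγ J)
    have hφ : ∀ n, M (baseLoop hγ J n) = n * M (baseLoop hγ J 1) := fun n => by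
      have := map_zsmul φ n 1
      simpa [φ] using this
    obtain ⟨x, hx⟩ := exists_finrank_eq_one hγ
    obtain ⟨ε, a', b', r, hε, ha', hb', hs, hr⟩ := exists_crossing_path hγ x
    have h2 := hM.normalization x ε hε hs r hr
    have h3 := h1.normalization x ε hε hs r hr
    rw [hp r ha' hb', h3, hφ, hx] at h2
    rw [hp p ha hb, hφ]
    push_cast at h2
    have h4 : M (baseLoop hγ J 1) = -1 := by linarith
    rw [h4]; ring

/-- Both indices obey the endpoint rule, so a small common rotation reduces to paths with invertible
endpoints. -/
theorem IsMaslovIndex.eq_negWinding (hM : IsMaslovIndex γ M) (hγ : IsHermitianSymplectic γ) :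
    M = negWinding hγ := by
  funext a b p
  obtain ⟨α, hα⟩ := exists_isSmallAngle (phiPath hγ p)
  have hα0 := hα.pos
  have hs : ∀ s ∈ Set.Icc 0 (α / 2), -2 * s ∈ Set.Icc (-α) α := fun s h => by
    constructor <;> linarith [h.1, h.2]
  have h1 : ∀ s ∈ Set.Icc 0 (α / 2), ∀ t : I, rotate γ s (p t).1 ∈ GrFred γ := fun s h t =>
    (rotate_mem_GrFred_iff hγ (p t) s _ rfl).2 (hα.mem _ (hs s h) t)
  have h2 : ∀ s ∈ Set.Ioc 0 (α / 2), rotate γ s a.1 ∈ GrStar γ ∧ rotate γ s b.1 ∈ GrStar γ :=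
    fun s h => by
      have h3 := hα.ends _ (hs s ⟨h.1.le, h.2⟩) (by linarith [h.1])
      exact ⟨(rotate_mem_GrStar_iff hγ a s _ rfl).2 h3.1,
        (rotate_mem_GrStar_iff hγ b s _ rfl).2 h3.2⟩
  have h3 : α / 2 ∈ Set.Ioc 0 (α / 2) := ⟨half_pos hα0, le_rfl⟩
  let q := rotatePath γ p (fun _ => α / 2) continuous_const
    fun t => h1 _ ⟨h3.1.le, h3.2⟩ t
  rw [hM.endpoints p _ h3.1 h1 h2 q fun t => rfl,
    (isMaslovIndex_negWinding hγ).endpoints p _ h3.1 h1 h2 q fun t => rfl]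
  refine hM.eq_of_mem_GrStar hγ q ?_ ?_
  · change rotate γ (α / 2) (p 0).1 ∈ GrStar γ
    rw [p.source]; exact (h2 _ h3).1
  · change rotate γ (α / 2) (p 1).1 ∈ GrStar γ
    rw [p.target]; exact (h2 _ h3).2

theorem mas_eq (hγ : IsHermitianSymplectic γ) : mas γ = negWinding hγ :=
  (Classical.epsilon_spec (p := IsMaslovIndex γ) ⟨_, isMaslovIndex_negWinding hγ⟩).eq_negWinding hγ

theorem wind_phiPath (hγ : IsHermitianSymplectic γ) {a b : GrFred γ} (p : Path a b) :
    wind (phiPath hγ p) = -negWinding hγ p :=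
  (existsUnique_hasWinding (phiPath hγ p)).unique
    (Classical.epsilon_spec (p := HasWinding (phiPath hγ p)) ⟨_, hasWinding_negWinding hγ p⟩)
    (hasWinding_negWinding hγ p)

end MaslovIndex

end Maslov

end

theorem mainTheorem12 {H : Type*} [NormedAddCommGroup H] [InnerProductSpace ℂ H] [CompleteSpace H]
    [TopologicalSpace.SeparableSpace H] (γ : H →L[ℂ] H) (hγ : Maslov.IsHermitianSymplectic γ) :
    (∃! M : ∀ ⦃a b : Maslov.GrFred γ⦄, Path a b → ℤ, Maslov.IsMaslovIndex γ M) ∧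
    ∀ (a b : Maslov.GrFred γ) (p : Path a b),
      (∃! n : ℤ, Maslov.HasWinding (Maslov.phiPath hγ p) n) ∧
      Maslov.mas γ p = -Maslov.wind (Maslov.phiPath hγ p) := by
  refine ⟨⟨Maslov.negWinding hγ, Maslov.isMaslovIndex_negWinding hγ,
    fun M hM => hM.eq_negWinding hγ⟩, fun a b p => ⟨Maslov.existsUnique_hasWinding _, ?_⟩⟩
  rw [Maslov.mas_eq hγ, Maslov.wind_phiPath hγ, neg_neg]
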